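/- Let $k$ be an algebraically closed field of characteristic $0$, $S$ a smooth variety over $k$ (i.e. a smooth separated $k$-scheme of finite type, not necessarily irreducible), $E$ a vector bundle of even rank $n=2m$ on $S$, $\mathcal L$ a line bundle on $S$, and $\sigma:\mathcal L\to S^2E^*$ an embedding of vector bundles, i.e. a nowhere vanishing quadratic form on $E$ with values in $\mathcal L^*$. Write $\sigma(v,w)(l)\in\mathcal O_S$ ($v,w\in E$, $l\in\mathcal L$) for the associated symmetric form. Let $S_d\subset S$ be the $d$-th degeneration locus, the zero locus of the image of $\Lambda^{n+1-d}E\otimes\Lambda^{n+1-d}E\otimes\mathcal L^{n+1-d}\to\mathcal O_S$ (the locus where $\sigma$ has corank $\ge d$). Let $\mathcal B_0$ be the sheaf of even parts of Clifford algebras of $\sigma$, i.e. the sheaf associated with the presheaf sending an open $U$ to the $\mathcal O_S(U)$-algebra generated by symbols $vwl$ ($v,w\in E(U)$, $l\in\mathcal L(U)$), trilinear in $v,w,l$, with relations $vvl=\sigma(v,v)(l)$ and $(vwl)(wxl')=\sigma(w,w)(l)\,(vxl')$. (Where $\mathcal L$ is trivialized by a section $l$, this is the even part of the Clifford algebra of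 the quadratic form $v\mapsto\sigma(v,v)(l)$.) Let $\mathcal Z\subset\mathcal B_0$ be the subsheaf of $\mathcal O_S$-algebras generated locally by the antisymmetrized products $\sum_{\tau\in\mathfrak S_{2m}}\operatorname{sgn}(\tau)\,(v_{\tau(1)}v_{\tau(2)}l_1)\cdots(v_{\tau(2m-1)}v_{\tau(2m)}l_m)$ with $v_i\in E$, $l_j\in\mathcal L$. Then: 1. $\mathcal Z$ is central in $\mathcal B_0$, and antisymmetrization induces an isomorphism of $\mathcal O_S$-modules $\mathcal O_S\oplus(\det E\otimes\mathcal L^{m})\cong\mathcal Z$. 2. Let $\phi:\tilde S=\operatorname{Spec}_S(\mathcal Z)\to S$. There is a quasi-coherent sheaf of algebras $\tilde{\mathcal B}_0$ on $\tilde S$ with $\phi_*\tilde{\mathcal B}_0\cong\mathcal B_0$ as sheaves of algebras over $\phi_*\mathcal O_{\tilde S}=\mathcal Z$. 3. $\phi$ is a double covering ramified over $S_1$: it is finite, flat and of finite presentation, of degree $2$, and for an open $V\subset S$ the morphism $\phi^{-1}(V)\to V$ is étale if and only if $V\cap S_1=\emptyset$. 4. Let $\tilde S_2=\phi^{-1}(S_2)$.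 For every $\tilde{\mathcal B}_0$ as in 2, the restriction of $\tilde{\mathcal B}_0$ to $\tilde S\setminus\tilde S_2$ is a sheaf of Azumaya algebras of rank (degree) $2^{m-1}$, i.e. an Azumaya algebra which is locally free of rank $(2^{m-1})^2$ as an $\mathcal O_{\tilde S}$-module. -/

import Mathlib

open CategoryTheory TopologicalSpace AlgebraicGeometry Opposite
open scoped TensorProduct

universe u

noncomputable section

/-! ## The even Clifford algebra of a line-valued quadratic form -/

section EvenClifford

variable {R E L : Type u} [CommRing R] [AddCommGroup E] [Module R E] [AddCommGroup L] [Module R L]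

/-- The defining relations of the even Clifford algebra of the quadratic form
`v ↦ b v v` with values in the dual of `L`. -/
inductive EvenCliffordRel (b : E →ₗ[R] E →ₗ[R] L →ₗ[R] R) :
    TensorAlgebra R ((E ⊗[R] E) ⊗[R] L) → TensorAlgebra R ((E ⊗[R] E) ⊗[R] L) → Prop
  | contract (v : E) (l : L) :
      EvenCliffordRel b (TensorAlgebra.ι R ((v ⊗ₜ v) ⊗ₜ l)) (algebraMap R _ (b v v l))
  | contract_mid (v w x : E) (l l' : L) :
      EvenCliffordRel b
        (TensorAlgebra.ι R ((v ⊗ₜ w) ⊗ₜ l) * TensorAlgebra.ι R ((w ⊗ₜ x) ⊗ₜ l'))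
        (b w w l • TensorAlgebra.ι R ((v ⊗ₜ x) ⊗ₜ l'))

/-- The even Clifford algebra of a quadratic form on `E` with values in the dual of `L`:
the `R`-algebra generated by symbols `v w l` (`v w : E`, `l : L`), trilinear in `v, w, l`, with
`v v l = q(v)(l)` and `(v w l)(w x l') = q(w)(l) (v x l')`, where `q(v)(l) = b v v l`.
If `L` is free of rank one it is the even part of the usual Clifford algebra,
see `EvenClifford.equivEven`. -/
def EvenClifford (b : E →ₗ[R] E →ₗ[R] L →ₗ[R] R) : Type u :=
  RingQuot (EvenCliffordRel b)

namespace EvenClifford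

variable (b : E →ₗ[R] E →ₗ[R] L →ₗ[R] R)

instance : Ring (EvenClifford b) := inferInstanceAs (Ring (RingQuot (EvenCliffordRel b)))

instance : Algebra R (EvenClifford b) :=
  inferInstanceAs (Algebra R (RingQuot (EvenCliffordRel b)))

/-- The generator `v w l`, as a linear map on the tensor product. -/
def ι : (E ⊗[R] E) ⊗[R] L →ₗ[R] EvenClifford b :=
  (RingQuot.mkAlgHom R (EvenCliffordRel b)).toLinearMap ∘ₗ TensorAlgebra.ι R

/-- The generator `v w l`. -/
def gen (v w : E) (l : L) : EvenClifford b := ι b ((v ⊗ₜ w) ⊗ₜ l)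

theorem gen_contract (v : E) (l : L) :
    gen b v v l = algebraMap R (EvenClifford b) (b v v l) := by
  have h := RingQuot.mkAlgHom_rel R (EvenCliffordRel.contract (b := b) v l)
  rw [AlgHom.commutes] at h
  exact h

theorem gen_contract_mid (v w x : E) (l l' : L) :
    gen b v w l * gen b w x l' = b w w l • gen b v x l' := by
  have h := RingQuot.mkAlgHom_rel R (EvenCliffordRel.contract_mid (b := b) v w x l l')
  rw [map_mul, map_smul] at h
  exact h

/-- The universal property of the even Clifford algebra. -/
def lift {A : Type*} [Ring A] [Algebra R A] (f : (E ⊗[R] E) ⊗[R] L →ₗ[R] A)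
    (h₁ : ∀ v l, f ((v ⊗ₜ v) ⊗ₜ l) = algebraMap R A (b v v l))
    (h₂ : ∀ v w x l l', f ((v ⊗ₜ w) ⊗ₜ l) * f ((w ⊗ₜ x) ⊗ₜ l') = b w w l • f ((v ⊗ₜ x) ⊗ₜ l')) :
    EvenClifford b →ₐ[R] A :=
  RingQuot.liftAlgHom R ⟨TensorAlgebra.lift R f, by
    intro x y h
    cases h with
    | contract v l => simpa using h₁ v l
    | contract_mid v w x l l' => simpa using h₂ v w x l l'⟩

theorem lift_ι {A : Type*} [Ring A] [Algebra R A] (f : (E ⊗[R] E) ⊗[R] L →ₗ[R] A)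
    (h₁ : ∀ v l, f ((v ⊗ₜ v) ⊗ₜ l) = algebraMap R A (b v v l))
    (h₂ : ∀ v w x l l', f ((v ⊗ₜ w) ⊗ₜ l) * f ((w ⊗ₜ x) ⊗ₜ l') = b w w l • f ((v ⊗ₜ x) ⊗ₜ l'))
    (t : (E ⊗[R] E) ⊗[R] L) : lift b f h₁ h₂ (ι b t) = f t := by
  have := RingQuot.liftAlgHom_mkAlgHom_apply R (s := EvenCliffordRel b) (TensorAlgebra.lift R f)
    (by
      intro x y h
      cases h with
      | contract v l => simpa using h₁ v l
      | contract_mid v w x l l' => simpa using h₂ v w x l l') (TensorAlgebra.ι R t)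
  rw [TensorAlgebra.lift_ι_apply] at this
  exact this

variable {b} in
/-- A ring homomorphism out of the even Clifford algebra is determined by its values on scalars
and on generators. -/
theorem ringHom_ext {A : Type*} [Ring A] {f g : EvenClifford b →+* A}
    (h₀ : ∀ r : R, f (algebraMap R _ r) = g (algebraMap R _ r))
    (h₁ : ∀ v w l, f (gen b v w l) = g (gen b v w l)) : f = g := by
  have hι : ∀ t, f (ι b t) = g (ι b t) := by
    intro t
    induction t with
    | zero => simp
    | add x y hx hy => simp [hx, hy]
    | tmul s l =>
      induction s with
      | zero => simp
      | add x y hx hy => simp [TensorProduct.add_tmul, hx, hy]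
      | tmul v w => exact h₁ v w l
  let p : TensorAlgebra R ((E ⊗[R] E) ⊗[R] L) →ₐ[R] EvenClifford b :=
    RingQuot.mkAlgHom R (EvenCliffordRel b)
  have hp : ∀ y, f (p y) = g (p y) := by
    intro y
    induction y using TensorAlgebra.induction with
    | algebraMap r => rw [AlgHom.commutes]; exact h₀ r
    | ι t => exact hι t
    | mul x y hx hy => rw [map_mul, map_mul, map_mul, hx, hy]
    | add x y hx hy => rw [map_add, map_add, map_add, hx, hy]
  ext x
  obtain ⟨y, rfl⟩ := RingQuot.mkAlgHom_surjective R (EvenCliffordRel b) x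
  exact hp y

/-- Functoriality of the even Clifford algebra along semilinear isometries. -/
def map {R' E' L' : Type u} [CommRing R'] [AddCommGroup E'] [Module R' E'] [AddCommGroup L']
    [Module R' L'] (b' : E' →ₗ[R'] E' →ₗ[R'] L' →ₗ[R'] R') (f : R →+* R')
    (fE : E →ₛₗ[f] E') (fL : L →ₛₗ[f] L')
    (h : ∀ v w l, b' (fE v) (fE w) (fL l) = f (b v w l)) :
    EvenClifford b →+* EvenClifford b' :=
  letI : Algebra R (EvenClifford b') :=
    ((algebraMap R' (EvenClifford b')).comp f).toAlgebra'
      fun r x => Algebra.commutes (f r) x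
  have hs : ∀ (r : R) (x : EvenClifford b'), r • x = f r • x := fun r x =>
    (Algebra.smul_def (f r) x).symm
  let T : E →ₗ[R] E →ₗ[R] L →ₗ[R] EvenClifford b' :=
    LinearMap.mk₂ R
      (fun v w =>
        { toFun := fun l => gen b' (fE v) (fE w) (fL l)
          map_add' := fun l l' => by simp [gen, TensorProduct.tmul_add]
          map_smul' := fun r l => by simp [gen, TensorProduct.tmul_smul, hs] })
      (fun v v' w => by ext l; simp [gen, TensorProduct.add_tmul])
      (fun r v w => by ext l; simp [gen, ← TensorProduct.smul_tmul', hs])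
      (fun v w w' => by ext l; simp [gen, TensorProduct.add_tmul, TensorProduct.tmul_add])
      (fun r v w => by
        ext l; simp [gen, ← TensorProduct.smul_tmul', TensorProduct.tmul_smul, hs])
  (lift b (TensorProduct.lift (TensorProduct.lift T))
    (fun v l => by
      show gen b' (fE v) (fE v) (fL l) = _
      rw [gen_contract, h]; rfl)
    (fun v w x l l' => by
      show gen b' (fE v) (fE w) (fL l) * gen b' (fE w) (fE x) (fL l') = _ • gen b' _ _ _
      rw [gen_contract_mid, h, hs])).toRingHom

theorem map_algebraMap {R' E' L' : Type u} [CommRing R'] [AddCommGroup E'] [Module R' E']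
    [AddCommGroup L'] [Module R' L'] (b' : E' →ₗ[R'] E' →ₗ[R'] L' →ₗ[R'] R') (f : R →+* R')
    (fE : E →ₛₗ[f] E') (fL : L →ₛₗ[f] L')
    (h : ∀ v w l, b' (fE v) (fE w) (fL l) = f (b v w l)) (r : R) :
    map b b' f fE fL h (algebraMap R _ r) = algebraMap R' _ (f r) :=
  letI : Algebra R (EvenClifford b') :=
    ((algebraMap R' (EvenClifford b')).comp f).toAlgebra'
      fun r x => Algebra.commutes (f r) x
  AlgHom.commutes (lift b (A := EvenClifford b') _ _ _) r

theorem map_gen {R' E' L' : Type u} [CommRing R'] [AddCommGroup E'] [Module R' E']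
    [AddCommGroup L'] [Module R' L'] (b' : E' →ₗ[R'] E' →ₗ[R'] L' →ₗ[R'] R') (f : R →+* R')
    (fE : E →ₛₗ[f] E') (fL : L →ₛₗ[f] L')
    (h : ∀ v w l, b' (fE v) (fE w) (fL l) = f (b v w l)) (v w : E) (l : L) :
    map b b' f fE fL h (gen b v w l) = gen b' (fE v) (fE w) (fL l) :=
  letI : Algebra R (EvenClifford b') :=
    ((algebraMap R' (EvenClifford b')).comp f).toAlgebra'
      fun r x => Algebra.commutes (f r) x
  lift_ι b (A := EvenClifford b') _ _ _ _

/-- The scalar quadratic form `v ↦ b v v l₀`. -/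
def scalarForm (l₀ : L) : QuadraticForm R E :=
  LinearMap.BilinMap.toQuadraticMap (b.compr₂ (LinearMap.applyₗ l₀))

/-- If `L` is free of rank one, the even Clifford algebra is the even part of the usual Clifford
algebra of the scalar quadratic form obtained from a generator of `L`. -/
def equivEven (e : L ≃ₗ[R] R) :
    EvenClifford b ≃ₐ[R] CliffordAlgebra.even (scalarForm b (e.symm 1)) :=
  have he : ∀ v w l, b v w l = e l • b v w (e.symm 1) := fun v w l => by
    rw [← map_smul, ← map_smul, smul_eq_mul, mul_one, e.symm_apply_apply]
  let Q := scalarForm b (e.symm 1)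
  let F : (E ⊗[R] E) ⊗[R] L →ₗ[R] CliffordAlgebra.even Q :=
    TensorProduct.lift ((LinearMap.lsmul R _).flip ∘ₗ
      TensorProduct.lift (CliffordAlgebra.even.ι Q).bilin) ∘ₗ
      TensorProduct.map LinearMap.id e.toLinearMap
  have hF : ∀ v w l, F ((v ⊗ₜ w) ⊗ₜ l) = e l • (CliffordAlgebra.even.ι Q).bilin v w :=
    fun v w l => rfl
  let G : CliffordAlgebra.EvenHom Q (EvenClifford b) :=
    { bilin := LinearMap.mk₂ R (fun v w => gen b v w (e.symm 1))
        (fun v v' w => by simp [gen, TensorProduct.add_tmul])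
        (fun r v w => by simp [gen, ← TensorProduct.smul_tmul'])
        (fun v w w' => by simp [gen, TensorProduct.tmul_add, TensorProduct.add_tmul])
        (fun r v w => by simp [gen, TensorProduct.tmul_smul, ← TensorProduct.smul_tmul'])
      contract := fun v => gen_contract b v _
      contract_mid := fun v w x => gen_contract_mid b v w x _ _ }
  AlgEquiv.ofAlgHom
    (lift b F
      (fun v l => by
        rw [hF, (CliffordAlgebra.even.ι Q).contract, he, Algebra.algebraMap_eq_smul_one,
          Algebra.algebraMap_eq_smul_one, smul_assoc]; rfl)
      (fun v w x l l' => by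
        rw [hF, hF, hF, smul_mul_smul_comm, (CliffordAlgebra.even.ι Q).contract_mid, he w w l,
          smul_smul, smul_smul]
        congr 1
        show e l * e l' * b w w (e.symm 1) = e l * b w w (e.symm 1) * e l'
        ring))
    (CliffordAlgebra.even.lift Q G)
    (by
      apply CliffordAlgebra.even.algHom_ext
      apply CliffordAlgebra.EvenHom.ext
      apply LinearMap.ext₂
      intro v w
      show lift b F _ _ (CliffordAlgebra.even.lift Q G ((CliffordAlgebra.even.ι Q).bilin v w)) =
        (CliffordAlgebra.even.ι Q).bilin v w
      rw [CliffordAlgebra.even.lift_ι]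
      show lift b F _ _ (ι b _) = _
      rw [lift_ι, hF, e.apply_symm_apply, one_smul])
    (by
      apply AlgHom.coe_ringHom_injective
      apply ringHom_ext
      · intro r; simp
      · intro v w l
        show CliffordAlgebra.even.lift Q G (lift b F _ _ (ι b _)) = gen b v w l
        rw [lift_ι, hF, map_smul, CliffordAlgebra.even.lift_ι]
        show e l • ι b _ = ι b _
        rw [← map_smul, ← TensorProduct.tmul_smul, ← map_smul, smul_eq_mul, mul_one,
          e.symm_apply_apply])

/-- The antisymmetrised product
`∑ τ, sign τ • (e (τ 0) e (τ 1) l 0) (e (τ 2) e (τ 3) l 1) ⋯` of `2 m` vectors and `m` elements of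
`L`. For vectors which are pairwise orthogonal this is `(2 m)!` times their Clifford product. -/
def antisymm {m : ℕ} (e : Fin (2 * m) → E) (l : Fin m → L) : EvenClifford b :=
  ∑ τ : Equiv.Perm (Fin (2 * m)), (Equiv.Perm.sign τ : ℤ) •
    (List.ofFn fun i : Fin m =>
      gen b (e (τ ⟨2 * i, by omega⟩)) (e (τ ⟨2 * i + 1, by omega⟩)) (l i)).prod

end EvenClifford

end EvenClifford

/-! ## Sheaves of algebras on a scheme -/

/-- A sheaf of (not necessarily commutative) `𝒪_X`-algebras on a scheme `X`: a sheaf of rings with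
a morphism from the structure sheaf whose image is central. -/
structure AlgSheaf (X : Scheme.{u}) where
  /-- the underlying sheaf of rings -/
  carrier : Sheaf (Opens.grothendieckTopology X) RingCat.{u}
  /-- the structure morphism -/
  unit : X.ringCatSheaf ⟶ carrier
  central : ∀ (U : X.Opens) (r : Γ(X, U)) (a : carrier.obj.obj (op U)),
    Commute ((unit.hom.app (op U)).hom r) a

namespace AlgSheaf

variable {X Y : Scheme.{u}} (A : AlgSheaf X)

/-- The sections of a sheaf of algebras over an open subset. -/
def sec (U : X.Opens) : Type u := A.carrier.obj.obj (op U)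

instance (U : X.Opens) : Ring (A.sec U) := inferInstanceAs (Ring (A.carrier.obj.obj (op U)))

instance (U : X.Opens) : Algebra Γ(X, U) (A.sec U) :=
  RingHom.toAlgebra' ((A.unit.hom.app (op U)).hom : Γ(X, U) →+* A.sec U) (A.central U)

/-- Restriction of sections. -/
def res {U V : X.Opens} (h : U ≤ V) : A.sec V →+* A.sec U :=
  (A.carrier.obj.map (homOfLE h).op).hom

/-- The underlying `𝒪_X`-module. -/
def toModules : X.Modules :=
  (SheafOfModules.restrictScalars A.unit).obj (SheafOfModules.unit A.carrier)

/-- Pushforward of a sheaf of algebras along a morphism of schemes. -/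
def pushforward (φ : X ⟶ Y) : AlgSheaf Y where
  carrier := (TopCat.Sheaf.pushforward RingCat φ.base).obj A.carrier
  unit := φ.toRingCatSheafHom ≫ (TopCat.Sheaf.pushforward RingCat φ.base).map A.unit
  central U r a := A.central (φ ⁻¹ᵁ U) (φ.app U r) a

/-- Isomorphisms of sheaves of `𝒪_X`-algebras. -/
structure Iso (A B : AlgSheaf X) where
  /-- the underlying isomorphism of sheaves of rings -/
  ringIso : A.carrier ≅ B.carrier
  unit_comp : A.unit ≫ ringIso.hom = B.unit

/-- The action of an isomorphism on sections. -/
def Iso.app {A B : AlgSheaf X} (e : A.Iso B) (U : X.Opens) : A.sec U →+* B.sec U :=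
  (e.ringIso.hom.hom.app (op U)).hom

/-- The restriction of `A` to the open subset `W` is a sheaf of Azumaya algebras of rank `r`
(that is, locally free of rank `r ^ 2` as a module, with geometric fibres the algebras of
`r × r` matrices). -/
def IsAzumayaOn (W : X.Opens) (r : ℕ) : Prop :=
  A.toModules.IsQuasicoherent ∧
  ∀ U : X.Opens, IsAffineOpen U → U ≤ W →
    IsAzumaya Γ(X, U) (A.sec U) ∧
    ∀ p : PrimeSpectrum Γ(X, U), Module.rankAtStalk (A.sec U) p = r ^ 2

end AlgSheaf

/-! ## Vector bundles and quadratic forms on them -/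

section Bundles

variable {S : Scheme.{u}}

/-- The restriction maps of an `𝒪_S`-module, as semilinear maps. -/
def resSemilinear (E : S.Modules) {U V : S.Opens} (i : U ⟶ V) :
    Γ(E, V) →ₛₗ[(S.presheaf.map i.op).hom] Γ(E, U) where
  toFun v := E.presheaf.map i.op v
  map_add' v w := map_add _ v w
  map_smul' r v := E.map_smul i r v

/-- A frame of an `𝒪_S`-module over an open subset `U`: sections over `U` which form a basis of
the sections over every smaller open subset, that is, an isomorphism of `E` over `U` with
the free module `𝒪_U ^ n`. -/
def IsFrame (E : S.Modules) (U : S.Opens) {n : ℕ} (e : Fin n → Γ(E, U)) : Prop :=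
  ∀ (V : S.Opens) (h : V ≤ U),
    LinearIndependent Γ(S, V) (fun i => (E.presheaf.map (homOfLE h).op (e i) : Γ(E, V))) ∧
    Submodule.span Γ(S, V)
      (Set.range fun i => (E.presheaf.map (homOfLE h).op (e i) : Γ(E, V))) = ⊤

/-- `E` is a vector bundle of rank `n`. -/
def IsVectorBundle (E : S.Modules) (n : ℕ) : Prop :=
  ∀ x : S, ∃ U : S.Opens, x ∈ U ∧ ∃ e : Fin n → Γ(E, U), IsFrame E U e

/-- A symmetric bilinear form on `E` with values in the dual of `L`, given on local sections as a
form `σ(v, w)(l)`. If `E` is a vector bundle and `L` a line bundle, and `2` is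
invertible, this is a global section of `S²E* ⊗ L*`, i.e. a morphism `L → S²E*`. -/
structure LineValuedForm (E L : S.Modules) where
  /-- the form on sections -/
  form (U : S.Opens) : Γ(E, U) →ₗ[Γ(S, U)] Γ(E, U) →ₗ[Γ(S, U)] Γ(L, U) →ₗ[Γ(S, U)] Γ(S, U)
  symm : ∀ (U : S.Opens) (v w : Γ(E, U)), form U v w = form U w v
  map_res : ∀ {U V : S.Opens} (i : U ⟶ V) (v w : Γ(E, V)) (l : Γ(L, V)),
    form U (E.presheaf.map i.op v) (E.presheaf.map i.op w) (L.presheaf.map i.op l) =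
      S.presheaf.map i.op (form V v w l)

namespace LineValuedForm

variable {E L : S.Modules} (σ : LineValuedForm E L)

/-- `σ : L → S²E*` is an embedding of vector bundles: it vanishes at no point. -/
def IsEmbedding : Prop :=
  ∀ x : S, ∃ (U : S.Opens) (v w : Γ(E, U)) (l : Γ(L, U)), x ∈ S.basicOpen (σ.form U v w l)

/-- The complement `S ∖ S_d` of the `d`-th degeneration locus of a form `σ` on a bundle `E` of rank
`n`. Here `S_d` is the closed subscheme whose ideal is the image of
`Λ^k E ⊗ Λ^k E ⊗ L^k → 𝒪_S`, `k = n + 1 - d`, i.e. the locus where `σ` has corank at least `d`; its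
complement is the union of the open subsets on which some section of this ideal, a
`k × k` minor of `σ`, is invertible. -/
def degeneracyCompl (n d : ℕ) : S.Opens :=
  ⨆ (U : S.Opens) (v : Fin (n + 1 - d) → Γ(E, U)) (w : Fin (n + 1 - d) → Γ(E, U))
    (l : Fin (n + 1 - d) → Γ(L, U)),
    S.basicOpen (Matrix.of fun i j => σ.form U (v i) (w j) (l i)).det

/-- The restriction maps of the presheaf of even Clifford algebras. -/
def cliffordRes {U V : S.Opens} (i : U ⟶ V) :
    EvenClifford (σ.form V) →+* EvenClifford (σ.form U) :=
  EvenClifford.map (σ.form V) (σ.form U) (S.presheaf.map i.op).hom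
    (resSemilinear E i) (resSemilinear L i) (σ.map_res i)

theorem cliffordRes_algebraMap {U V : S.Opens} (i : U ⟶ V) (r : Γ(S, V)) :
    σ.cliffordRes i (algebraMap Γ(S, V) _ r) = algebraMap Γ(S, U) _ (S.presheaf.map i.op r) :=
  EvenClifford.map_algebraMap _ _ _ _ _ _ r

theorem cliffordRes_gen {U V : S.Opens} (i : U ⟶ V) (v w : Γ(E, V)) (l : Γ(L, V)) :
    σ.cliffordRes i (EvenClifford.gen _ v w l) =
      EvenClifford.gen _ (E.presheaf.map i.op v) (E.presheaf.map i.op w) (L.presheaf.map i.op l) :=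
  EvenClifford.map_gen _ _ _ _ _ _ v w l

/-- The presheaf `U ↦` even Clifford algebra of `σ` over `U`. -/
def cliffordPresheaf : S.Opensᵒᵖ ⥤ RingCat.{u} where
  obj U := RingCat.of (EvenClifford (σ.form U.unop))
  map i := RingCat.ofHom (σ.cliffordRes i.unop)
  map_id U := by
    apply RingCat.hom_ext
    apply EvenClifford.ringHom_ext
    · intro r
      refine (σ.cliffordRes_algebraMap (𝟙 U.unop) r).trans ?_
      rw [op_id, S.presheaf.map_id]
      rfl
    · intro v w l
      refine (σ.cliffordRes_gen (𝟙 U.unop) v w l).trans ?_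
      rw [op_id, E.presheaf.map_id, L.presheaf.map_id]
      rfl
  map_comp {U V W} i j := by
    apply RingCat.hom_ext
    apply EvenClifford.ringHom_ext
    · intro r
      refine (σ.cliffordRes_algebraMap (j.unop ≫ i.unop) r).trans ?_
      refine Eq.trans ?_ (congrArg (σ.cliffordRes j.unop)
        (σ.cliffordRes_algebraMap i.unop r)).symm
      refine Eq.trans ?_ (σ.cliffordRes_algebraMap j.unop _).symm
      rw [op_comp, S.presheaf.map_comp]
      rfl
    · intro v w l
      refine (σ.cliffordRes_gen (j.unop ≫ i.unop) v w l).trans ?_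
      refine Eq.trans ?_ (congrArg (σ.cliffordRes j.unop)
        (σ.cliffordRes_gen i.unop v w l)).symm
      refine Eq.trans ?_ (σ.cliffordRes_gen j.unop _ _ _).symm
      rw [op_comp, E.presheaf.map_comp, L.presheaf.map_comp]
      rfl

/-- The structure morphism of the presheaf of even Clifford algebras. -/
def cliffordPresheafUnit : S.ringCatSheaf.obj ⟶ σ.cliffordPresheaf where
  app U := RingCat.ofHom (algebraMap Γ(S, U.unop) (EvenClifford (σ.form U.unop)))
  naturality U V i := by
    apply RingCat.hom_ext
    apply RingHom.ext
    intro r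
    exact (σ.cliffordRes_algebraMap i.unop r).symm

/-- The sheaf `𝓑₀` of even parts of Clifford algebras of `σ`: the sheaf associated with
the presheaf `U ↦` even Clifford algebra of `σ` over `U`. -/
def evenCliffordSheaf : AlgSheaf S where
  carrier := (presheafToSheaf (Opens.grothendieckTopology S) RingCat.{u}).obj σ.cliffordPresheaf
  unit := ⟨σ.cliffordPresheafUnit ≫ toSheafify _ _⟩
  central U r a := by
    let J := Opens.grothendieckTopology S
    let P := σ.cliffordPresheaf
    let F := (presheafToSheaf J RingCat.{u}).obj P
    let η : P ⟶ F.obj := toSheafify J P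
    refine Sheaf.isSeparated F U _ (Presheaf.imageSieve_mem J η a) _ _ ?_
    intro V i hi
    obtain ⟨t₀, ht⟩ := hi
    let t : EvenClifford (σ.form V) := t₀
    let g : EvenClifford (σ.form V) →+* F.obj.obj (op V) := (η.app (op V)).hom
    let ρ : F.obj.obj (op U) →+* F.obj.obj (op V) := (F.obj.map i.op).hom
    let s : F.obj.obj (op U) := (η.app (op U)).hom (algebraMap Γ(S, U) (EvenClifford _) r)
    let r' : EvenClifford (σ.form V) := algebraMap Γ(S, V) _ (S.presheaf.map i.op r)
    have hr : ρ s = g r' :=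
      (NatTrans.naturality_apply η i.op _).symm.trans
        (congrArg (η.app (op V)).hom (σ.cliffordRes_algebraMap i r))
    have ht' : ρ a = g t := ht.symm
    have hc : r' * t = t * r' := Algebra.commutes (A := EvenClifford (σ.form V)) _ t
    show ρ (s * a) = ρ (a * s)
    rw [map_mul, map_mul, hr, ht']
    exact (map_mul g _ _).symm.trans ((congrArg g hc).trans (map_mul g _ _))

/-- The canonical map from the even Clifford algebra over `U` to the sections of `𝓑₀`. -/
def toSheaf (U : S.Opens) : EvenClifford (σ.form U) →+* σ.evenCliffordSheaf.sec U :=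
  ((toSheafify (Opens.grothendieckTopology S) σ.cliffordPresheaf).app (op U)).hom

/-- The sections over `U` of the subsheaf `𝓩 = 𝒪_S ⊕ det E ⊗ L^m` of algebras of `𝓑₀`, for `E` of
rank `2 m`: the sections which locally lie in the subalgebra generated by the antisymmetrised
products of `2 m` sections of `E` and `m` sections of `L`. -/
def centralPart (m : ℕ) (U : S.Opens) : Set (σ.evenCliffordSheaf.sec U) :=
  {z | ∀ x ∈ U, ∃ (V : S.Opens) (h : V ≤ U), x ∈ V ∧
    σ.evenCliffordSheaf.res h z ∈ Algebra.adjoin Γ(S, V)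
      (Set.range fun p : (Fin (2 * m) → Γ(E, V)) × (Fin m → Γ(L, V)) =>
        σ.toSheaf V (EvenClifford.antisymm (σ.form V) p.1 p.2))}

/-- The double covering `φ : S̃ = Spec_S 𝓩 ⟶ S` together with the sheaf of algebras `𝓑̃₀` on `S̃`
corresponding to `𝓑₀`: `φ` is affine, `𝓑̃₀` is quasi-coherent, `φ_* 𝓑̃₀` is identified with `𝓑₀`,
and under this identification `φ_* 𝒪_S̃` becomes the subalgebra `𝓩` of `𝓑₀`. -/
structure CentralReduction (m : ℕ) where
  /-- the scheme `S̃` -/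
  cover : Scheme.{u}
  /-- the projection `φ` -/
  proj : cover ⟶ S
  isAffineHom : IsAffineHom proj
  /-- the sheaf of algebras `𝓑̃₀` -/
  alg : AlgSheaf cover
  isQuasicoherent : alg.toModules.IsQuasicoherent
  /-- the identification `φ_* 𝓑̃₀ ≅ 𝓑₀` -/
  iso : (alg.pushforward proj).Iso σ.evenCliffordSheaf
  injective : ∀ U : S.Opens,
    Function.Injective fun r : Γ(cover, proj ⁻¹ᵁ U) =>
      iso.app U (algebraMap Γ(cover, proj ⁻¹ᵁ U) (alg.sec (proj ⁻¹ᵁ U)) r)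
  range_eq : ∀ U : S.Opens,
    (Set.range fun r : Γ(cover, proj ⁻¹ᵁ U) =>
      iso.app U (algebraMap Γ(cover, proj ⁻¹ᵁ U) (alg.sec (proj ⁻¹ᵁ U)) r)) =
      σ.centralPart m U

end LineValuedForm

end Bundles

end

/-!
Everything is local on `S`, so the heart of the matter is the even Clifford algebra `B` of a
symmetric form on a free module of rank `n = 2m` with basis `e`, with values in the dual of a free
module of rank one, over a `ℚ`-algebra `R`.

* The products of an even number of members of `e` form a basis of `B` over `R`
  (`EvenClifford.evenBasis`). These bases are compatible with restriction, so over open subsets with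
  frames the presheaf of even Clifford algebras agrees with its sheafification `𝓑₀`
  (`LineValuedForm.toSheaf_bijective`).

* An antisymmetrised product of `n` vectors is an alternating function of the vectors, hence a
  multiple of the antisymmetrised product `ω` of the basis (`EvenClifford.antisymm_eq_smul_omega`).
  If `e` is orthogonal, then `ω` is `n !` times the Clifford product of the basis, and one sees that
  `ω` is central and that its square is the scalar `± (n !)² det (b (e i) (e j))`. This covers forms
  over fields, where orthogonal bases exist. The form over a polynomial ring with generic symmetric
  Gram matrix embeds into the one over the fraction field, and every symmetric form is a
  specialisation of it (`EvenClifford.exists_generic`), so both facts hold in general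
  (`EvenClifford.commute_omega`, `EvenClifford.omega_mul_self`). The coefficient at the product of all
  of `e` shows that `1` and `ω` are linearly independent (`EvenClifford.add_smul_omega_injective`).
  Therefore `𝓩 = 𝒪 ⊕ 𝒪 ω` locally (`LineValuedForm.mem_centralPart_iff`).

* Thus `𝓩` is a quasi-coherent sheaf of commutative algebras, and `S̃` is its relative spectrum
  (`LineValuedForm.nonempty_centralCover`). Locally its algebra is `R[ω] / (ω² - d)`, where `d` is a
  unit times the determinant of the Gram matrix (`LineValuedForm.CentralCover.exists_equiv`). It is
  free of rank two and, as `2` is invertible, étale exactly where `d` is invertible, that is,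
  outside `S₁` (`LineValuedForm.CentralCover.etale_restrict_iff`).

* The sheaf `𝓑̃₀` is `φ⁻¹ 𝓑₀` with scalars extended from `φ⁻¹ 𝓩` to `𝒪`. Since `φ` is flat and of
  finite presentation, it is open, and `φ⁻¹` can be described by sections over the open sets `φ V`.
  Over the preimage of an affine open subset with frames the resulting presheaf localises, because
  sections of `𝓑₀` over smaller open subsets arise by base change along the functions on `S̃`
  (`LineValuedForm.CentralCover.isBaseChange_res`); hence `𝓑̃₀` is there the quasi-coherent sheaf
  defined by the sections of `𝓑₀`
  (`LineValuedForm.CentralCover.coverHom_bijective_and_isLocalizingOn`).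

* Near a point outside `S₂` the corank is at most one, so there is an orthogonal frame whose first
  `n - 1` members have invertible norm (`LineValuedForm.exists_orthogonal_framing`). The elements
  `e j * e (n - 2)` with `j < n - 2` are anticommuting units of `B`. The only further generator,
  `e (n - 1) * e (n - 2)`, is a product of these units and `ω`, up to a unit of `R`; counting ranks,
  the `2 ^ (n - 2)` products of the anticommuting units form a basis of `B` over `R[ω]`
  (`EvenClifford.exists_basis_over_centre`). An algebra with such a basis is Azumaya: conjugations by
  the units act on the basis by signs, which separate its members as their number `n - 2` is even, so
  left and right multiplications generate all endomorphisms (`isAzumaya_of_anticommuting`). The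
  Azumaya property is local (`AlgSheaf.isAzumayaOn_of_locally`), which gives the last assertion.
-/

noncomputable section

/-! ### Ordered products of anticommuting elements -/

section BoolProd

/-- The ordered product of the `g i` with `ε i = true`. -/
def boolProd {A : Type*} [Monoid A] {n : ℕ} (g : Fin n → A) (ε : Fin n → Bool) : A :=
  (List.ofFn fun i => if ε i then g i else 1).prod

theorem boolProd_succ {A : Type*} [Monoid A] {n : ℕ} (g : Fin (n + 1) → A)
    (ε : Fin (n + 1) → Bool) :
    boolProd g ε =
      (if ε 0 then g 0 else 1) * boolProd (fun i => g i.succ) (fun i => ε i.succ) := by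
  simp [boolProd, List.ofFn_succ]

theorem map_boolProd {A B F : Type*} [Monoid A] [Monoid B] [FunLike F A B] [MonoidHomClass F A B]
    (f : F) {n : ℕ} (g : Fin n → A) (ε : Fin n → Bool) :
    f (boolProd g ε) = boolProd (fun i => f (g i)) ε := by
  induction n with
  | zero => simp [boolProd]
  | succ n ih => rw [boolProd_succ, boolProd_succ, map_mul, ih]; split <;> simp

variable {R A : Type*} [CommRing R] [Ring A] [Algebra R A]

theorem one_mem_span_boolProd {n : ℕ} (g : Fin n → A) :
    (1 : A) ∈ Submodule.span R (Set.range (boolProd g)) :=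
  Submodule.subset_span ⟨fun _ => false, by simp [boolProd]⟩

/-- If the `g i` satisfy Clifford relations up to scalars, the span of the ordered products is
stable under left multiplication by each `g k`. -/
theorem mul_mem_span_boolProd {n : ℕ} (g : Fin n → A)
    (hg : ∀ i j, ∃ r : R, g i * g j + g j * g i = algebraMap R A r)
    (hsq : ∀ i, ∃ r : R, g i * g i = algebraMap R A r) (k : Fin n) {x : A}
    (hx : x ∈ Submodule.span R (Set.range (boolProd g))) :
    g k * x ∈ Submodule.span R (Set.range (boolProd g)) := by
  induction n generalizing x with
  | zero => exact k.elim0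
  | succ n ih =>
    let T := Submodule.span R (Set.range (boolProd fun i : Fin n => g i.succ))
    have hT : ∀ y ∈ T, y ∈ Submodule.span R (Set.range (boolProd g)) := by
      intro y hy
      refine Submodule.span_mono ?_ hy
      rintro _ ⟨ε, rfl⟩
      exact ⟨Fin.cons false ε, by simp [boolProd_succ]⟩
    have hT0 : ∀ y ∈ T, g 0 * y ∈ Submodule.span R (Set.range (boolProd g)) := by
      intro y hy
      induction hy using Submodule.span_induction with
      | mem y hy =>
        obtain ⟨ε, rfl⟩ := hy
        exact Submodule.subset_span ⟨Fin.cons true ε, by simp [boolProd_succ]⟩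
      | zero => simp
      | add a b _ _ ha hb => rw [mul_add]; exact add_mem ha hb
      | smul r a _ ha => rw [mul_smul_comm]; exact Submodule.smul_mem _ _ ha
    have key : ∀ y ∈ T, g k * y ∈ Submodule.span R (Set.range (boolProd g)) ∧
        g k * (g 0 * y) ∈ Submodule.span R (Set.range (boolProd g)) := by
      intro y hy
      obtain rfl | ⟨j, rfl⟩ := Fin.eq_zero_or_eq_succ k
      · refine ⟨hT0 y hy, ?_⟩
        obtain ⟨r, hr⟩ := hsq 0
        rw [← mul_assoc, hr, ← Algebra.smul_def]
        exact Submodule.smul_mem _ _ (hT y hy)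
      · have hj := ih (fun i => g i.succ) (fun i j => hg _ _) (fun i => hsq _) j hy
        refine ⟨hT _ hj, ?_⟩
        obtain ⟨r, hr⟩ := hg j.succ 0
        rw [← mul_assoc, eq_sub_of_add_eq hr, sub_mul, ← Algebra.smul_def, mul_assoc]
        exact sub_mem (Submodule.smul_mem _ _ (hT y hy)) (hT0 _ hj)
    induction hx using Submodule.span_induction with
    | mem y hy =>
      obtain ⟨ε, rfl⟩ := hy
      rw [boolProd_succ]
      have hm : boolProd (fun i : Fin n => g i.succ) (fun i => ε i.succ) ∈ T :=
        Submodule.subset_span ⟨_, rfl⟩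
      split
      · exact (key _ hm).2
      · rw [one_mul]; exact (key _ hm).1
    | zero => simp
    | add a b _ _ ha hb => rw [mul_add]; exact add_mem ha hb
    | smul r a _ ha => rw [mul_smul_comm]; exact Submodule.smul_mem _ _ ha

/-- A spanning family with as many members as a basis is linearly independent. -/
theorem linearIndependent_of_span_eq_top_of_card_eq {M ι κ : Type*} [AddCommGroup M] [Module R M]
    [Fintype ι] [Fintype κ] (b : Module.Basis κ R M) (v : ι → M)
    (hv : Submodule.span R (Set.range v) = ⊤) (h : Fintype.card ι = Fintype.card κ) :
    LinearIndependent R v := by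
  classical
  let e : κ ≃ ι := (Fintype.equivOfCardEq h).symm
  let f : M →ₗ[R] M := b.constr R fun k => v (e k)
  have hf : Function.Surjective f := by
    rw [← LinearMap.range_eq_top, Module.Basis.constr_range]
    rw [show (fun k => v (e k)) = v ∘ e from rfl, e.surjective.range_comp, hv]
  have : Module.Finite R M := Module.Finite.of_basis b
  have hinj : Function.Injective f := OrzechProperty.injective_of_surjective_endomorphism f hf
  have : LinearIndependent R (f ∘ b) := b.linearIndependent.map' f (LinearMap.ker_eq_bot.2 hinj)
  have h2 : v = (f ∘ b) ∘ e.symm := by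
    ext i
    simp [f]
  rw [h2]
  exact this.comp _ e.symm.injective

/-- If the elements of a list commute or anticommute pairwise, reordering the list changes its
product at most by a sign. -/
theorem List.Perm.prod_eq_or_eq_neg {l l' : List A} (h : l.Perm l')
    (hl : ∀ x ∈ l, ∀ y ∈ l, x * y = y * x ∨ x * y = -(y * x)) :
    l.prod = l'.prod ∨ l.prod = -l'.prod := by
  induction h with
  | nil => simp
  | cons x h ih =>
    rcases ih fun a ha b hb => hl a (by simp [ha]) b (by simp [hb]) with h1 | h1 <;>
      simp [h1]
  | swap x y l =>
    rcases hl y (by simp) x (by simp) with h1 | h1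
    · left; simp [← mul_assoc, h1]
    · right; simp [← mul_assoc, h1]
  | trans h1 h2 ih1 ih2 =>
    have := ih1 hl
    have h3 := ih2 fun a ha b hb => hl a (h1.mem_iff.2 ha) b (h1.mem_iff.2 hb)
    rcases this with h4 | h4 <;> rcases h3 with h5 | h5 <;> simp [h4, h5]

end BoolProd

/-! ### A basis of the Clifford algebra -/

namespace CliffordAlgebra

variable {R E : Type*} [CommRing R] [AddCommGroup E] [Module R E] (Q : QuadraticForm R E) {n : ℕ}
  (e : Module.Basis (Fin n) R E)

theorem span_boolProd_ι_eq_top :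
    Submodule.span R (Set.range (boolProd fun i => ι Q (e i))) = ⊤ := by
  have key : ∀ (v : E), ∀ x ∈ Submodule.span R (Set.range (boolProd fun i => ι Q (e i))),
      ι Q v * x ∈ Submodule.span R (Set.range (boolProd fun i => ι Q (e i))) := by
    intro v x hx
    induction e.mem_span v using Submodule.span_induction with
    | mem v hv =>
      obtain ⟨i, rfl⟩ := hv
      exact mul_mem_span_boolProd (fun i => ι Q (e i))
        (fun i j => ⟨_, ι_mul_ι_add_swap (e i) (e j)⟩) (fun i => ⟨_, ι_sq_scalar Q (e i)⟩) i hx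
    | zero => simp
    | add v w _ _ hv hw => rw [map_add, add_mul]; exact add_mem hv hw
    | smul r v _ hv => rw [map_smul, smul_mul_assoc]; exact Submodule.smul_mem _ _ hv
  rw [eq_top_iff]
  intro x _
  induction x using CliffordAlgebra.left_induction with
  | algebraMap r =>
    rw [Algebra.algebraMap_eq_smul_one]
    exact Submodule.smul_mem _ _ (one_mem_span_boolProd _)
  | add x y hx hy => exact add_mem (hx trivial) (hy trivial)
  | ι_mul x v hx => exact key v x (hx trivial)

variable [Invertible (2 : R)]

/-- The basis of ordered products of basis vectors of the Clifford algebra. -/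
def boolBasis : Module.Basis (Fin n → Bool) R (CliffordAlgebra Q) :=
  Module.Basis.mk (linearIndependent_of_span_eq_top_of_card_eq
    (e.ExteriorAlgebra.map (equivExterior Q).symm) _ (span_boolProd_ι_eq_top Q e) (by simp))
    (span_boolProd_ι_eq_top Q e).ge

@[simp]
theorem boolBasis_apply (ε : Fin n → Bool) :
    boolBasis Q e ε = boolProd (fun i => ι Q (e i)) ε := by
  simp [boolBasis]

end CliffordAlgebra

/-- The number of elements of the subset of `Fin n` given by `ε`, modulo `2`. -/
def boolParity {n : ℕ} (ε : Fin n → Bool) : ZMod 2 := ∑ i, if ε i then 1 else 0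

theorem boolParity_succ {n : ℕ} (ε : Fin (n + 1) → Bool) :
    boolParity ε = (if ε 0 then 1 else 0) + boolParity fun i => ε i.succ := by
  unfold boolParity
  exact Fin.sum_univ_succ _

/-- The subsets of `Fin n` of even cardinality. -/
abbrev EvenBool (n : ℕ) := {ε : Fin n → Bool // boolParity ε = 0}

theorem card_evenBool (n : ℕ) : Fintype.card (EvenBool (n + 1)) = 2 ^ n := by
  have e : EvenBool (n + 1) ≃ (Fin n → Bool) :=
    { toFun := fun ε i => ε.1 i.succ
      invFun := fun ε => ⟨Fin.cons (decide (boolParity ε = 1)) ε, by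
        rw [boolParity_succ]
        simp only [Fin.cons_zero, Fin.cons_succ, decide_eq_true_eq]
        generalize boolParity ε = x
        revert x; decide⟩
      left_inv := fun ε => by
        obtain ⟨ε, h⟩ := ε
        ext i
        refine Fin.cases ?_ (fun j => ?_) i
        · rw [boolParity_succ] at h
          simp only [Fin.cons_zero]
          cases h0 : ε 0 <;> simp only [h0] at h <;> generalize boolParity _ = x at h ⊢ <;>
            revert x <;> decide
        · simp
      right_inv := fun ε => by ext i; simp }
  rw [Fintype.card_congr e]
  simp

namespace CliffordAlgebra

variable {R E : Type*} [CommRing R] [AddCommGroup E] [Module R E] (Q : QuadraticForm R E) {n : ℕ}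
  (e : Module.Basis (Fin n) R E)

theorem boolProd_ι_mem_evenOdd (v : Fin n → E) (ε : Fin n → Bool) :
    boolProd (fun i => ι Q (v i)) ε ∈ evenOdd Q (boolParity ε) := by
  induction n with
  | zero => simpa [boolProd, boolParity] using SetLike.GradedOne.one_mem (A := evenOdd Q)
  | succ n ih =>
    rw [boolProd_succ, boolParity_succ]
    refine SetLike.mul_mem_graded ?_ (ih _ _)
    split
    · exact ι_mem_evenOdd_one Q _
    · exact SetLike.GradedOne.one_mem

theorem span_boolProd_even :
    Submodule.span R (Set.range fun ε : EvenBool n => boolProd (fun i => ι Q (e i)) ε.1) =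
      evenOdd Q 0 := by
  classical
  let s : Fin 2 → Submodule R (CliffordAlgebra Q) := fun j =>
    Submodule.span R (boolProd (fun i => ι Q (e i)) '' {ε | boolParity ε = (j : ZMod 2)})
  have h0 : s 0 ≤ evenOdd Q 0 := Submodule.span_le.2 (by
    rintro _ ⟨ε, hε, rfl⟩
    have := boolProd_ι_mem_evenOdd Q e ε
    rwa [show boolParity ε = 0 from hε] at this)
  have h1 : s 1 ≤ evenOdd Q 1 := Submodule.span_le.2 (by
    rintro _ ⟨ε, hε, rfl⟩
    have := boolProd_ι_mem_evenOdd Q e ε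
    rwa [show boolParity ε = 1 from hε] at this)
  have hsup : s 0 ⊔ s 1 = ⊤ := by
    rw [eq_top_iff, ← span_boolProd_ι_eq_top Q e, Submodule.span_le]
    rintro _ ⟨ε, rfl⟩
    have : ∀ x : ZMod 2, x = 0 ∨ x = 1 := by decide
    rcases this (boolParity ε) with h | h
    · exact Submodule.mem_sup_left (Submodule.subset_span ⟨ε, h, rfl⟩)
    · exact Submodule.mem_sup_right (Submodule.subset_span ⟨ε, h, rfl⟩)
  have hs0 : Submodule.span R
      (Set.range fun ε : EvenBool n => boolProd (fun i => ι Q (e i)) ε.1) = s 0 := by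
    congr 1
    ext x
    constructor
    · rintro ⟨ε, rfl⟩
      exact ⟨ε.1, ε.2, rfl⟩
    · rintro ⟨ε, hε, rfl⟩
      exact ⟨⟨ε, hε⟩, rfl⟩
  rw [hs0]
  refine le_antisymm h0 fun x hx => ?_
  obtain ⟨y, hy, z, hz, rfl⟩ := Submodule.mem_sup.1 (hsup.ge (Submodule.mem_top (x := x)))
  have hz0 : z ∈ evenOdd Q 0 := by simpa using sub_mem hx (h0 hy)
  have : z = 0 := Submodule.disjoint_def.1 (evenOdd_isCompl Q).disjoint z hz0 (h1 hz)
  rw [this, add_zero]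
  exact hy

/-! ### The top coefficient -/

/-- The span of the products of at most `k` vectors. -/
def filtration (k : ℕ) : Submodule R (CliffordAlgebra Q) :=
  Submodule.span R {x | ∃ l : List E, l.length ≤ k ∧ x = (l.map (ι Q)).prod}

theorem filtration_mono {k l : ℕ} (h : k ≤ l) : filtration Q k ≤ filtration Q l :=
  Submodule.span_mono fun _ ⟨t, ht, hx⟩ => ⟨t, ht.trans h, hx⟩

theorem ι_mul_mem_filtration (v : E) {k : ℕ} {x : CliffordAlgebra Q} (hx : x ∈ filtration Q k) :
    ι Q v * x ∈ filtration Q (k + 1) := by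
  induction hx using Submodule.span_induction with
  | mem x hx =>
    obtain ⟨l, hl, rfl⟩ := hx
    exact Submodule.subset_span ⟨v :: l, by simpa using hl, by simp⟩
  | zero => simp
  | add a b _ _ ha hb => rw [mul_add]; exact add_mem ha hb
  | smul r a _ ha => rw [mul_smul_comm]; exact Submodule.smul_mem _ _ ha

theorem contractLeft_mem_filtration (d : Module.Dual R E) {k : ℕ} {x : CliffordAlgebra Q}
    (hx : x ∈ filtration Q k) : contractLeft d x ∈ filtration Q k := by
  have key : ∀ l : List E, contractLeft d (l.map (ι Q)).prod ∈ filtration Q l.length := by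
    intro l
    induction l with
    | nil => simp
    | cons v l ih =>
      rw [List.map_cons, List.prod_cons, contractLeft_ι_mul]
      refine sub_mem (Submodule.smul_mem _ _ (Submodule.subset_span ⟨l, by simp, rfl⟩)) ?_
      exact ι_mul_mem_filtration Q v ih
  induction hx using Submodule.span_induction with
  | mem x hx =>
    obtain ⟨l, hl, rfl⟩ := hx
    exact filtration_mono Q hl (key l)
  | zero => simp
  | add a b _ _ ha hb => rw [map_add]; exact add_mem ha hb
  | smul r a _ ha => rw [map_smul]; exact Submodule.smul_mem _ _ ha

theorem liftAlternating_single_list {k : ℕ} (f : E [⋀^Fin n]→ₗ[R] R) (v : Fin k → E) :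
    ExteriorAlgebra.liftAlternating (R := R) (M := E) (N := R) (Pi.single n f)
      ((List.ofFn v).map (ι (0 : QuadraticForm R E))).prod = Pi.single (M := fun i => E [⋀^Fin i]→ₗ[R] R) n f k v := by
  have := ExteriorAlgebra.liftAlternating_apply_ιMulti (R := R) (M := E) (N := R)
    (Pi.single n f) v
  rw [← this, ExteriorAlgebra.ιMulti_apply, List.map_ofFn]
  rfl

theorem liftAlternating_single_filtration {k : ℕ} (hk : k < n) (f : E [⋀^Fin n]→ₗ[R] R)
    {x : CliffordAlgebra (0 : QuadraticForm R E)} (hx : x ∈ filtration 0 k) :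
    ExteriorAlgebra.liftAlternating (R := R) (M := E) (N := R) (Pi.single n f) x = 0 := by
  induction hx using Submodule.span_induction with
  | mem x hx =>
    obtain ⟨l, hl, rfl⟩ := hx
    have := liftAlternating_single_list f l.get
    rw [List.ofFn_get] at this
    rw [this, Pi.single_eq_of_ne (by lia)]
    rfl
  | zero => exact map_zero _
  | add a b _ _ ha hb => exact (map_add _ _ _).trans (by rw [ha, hb, add_zero])
  | smul r a _ ha => exact (map_smul _ _ _).trans (by rw [ha, smul_zero])

variable [Invertible (2 : R)]

/-- The image of a product of vectors in the exterior algebra agrees with their wedge product up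
to terms of smaller degree. -/
theorem equivExterior_list_prod_sub_mem (l : List E) :
    equivExterior Q (l.map (ι Q)).prod - (l.map (ι (0 : QuadraticForm R E))).prod ∈
      filtration (0 : QuadraticForm R E) (l.length - 1) := by
  induction l with
  | nil => simp
  | cons v l ih =>
    simp only [List.map_cons, List.prod_cons, List.length_cons, Nat.add_sub_cancel]
    have h1 : equivExterior Q (ι Q v * (l.map (ι Q)).prod) =
        ι (0 : QuadraticForm R E) v * equivExterior Q (l.map (ι Q)).prod -
          contractLeft (QuadraticMap.associated (R := R) (-Q) v)
            (equivExterior Q (l.map (ι Q)).prod) :=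
      changeForm_ι_mul changeForm.associated_neg_proof v _
    have h2 : equivExterior Q (l.map (ι Q)).prod ∈
        filtration (0 : QuadraticForm R E) l.length := by
      have := add_mem (filtration_mono _ (Nat.sub_le _ 1) ih) (Submodule.subset_span
        ⟨l, le_rfl, rfl⟩ : (l.map (ι (0 : QuadraticForm R E))).prod ∈
          filtration (0 : QuadraticForm R E) l.length)
      rwa [sub_add_cancel] at this
    rw [h1, sub_right_comm, ← mul_sub]
    refine sub_mem ?_ (contractLeft_mem_filtration _ _ h2)
    rcases l with _ | ⟨w, l⟩
    · simp
    · exact ι_mul_mem_filtration _ v ih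

/-- The coefficient of a product of the basis vectors in the exterior algebra, transported to
the Clifford algebra. -/
def topCoeff : CliffordAlgebra Q →ₗ[R] R :=
  (ExteriorAlgebra.liftAlternating (R := R) (M := E) (N := R) (Pi.single n e.det)) ∘ₗ
    (equivExterior Q).toLinearMap

theorem topCoeff_prod_ofFn (v : Fin n → E) (hn : 0 < n) :
    topCoeff Q e (List.ofFn fun i => ι Q (v i)).prod = e.det v := by
  have h1 := equivExterior_list_prod_sub_mem Q (List.ofFn v)
  have h2 := liftAlternating_single_filtration (n := n) (by simp; lia) e.det h1
  have h3 := liftAlternating_single_list (n := n) e.det v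
  rw [Pi.single_eq_same] at h3
  rw [map_sub, sub_eq_zero] at h2
  rw [show (List.ofFn fun i => ι Q (v i)) = (List.ofFn v).map (ι Q) by simp [List.map_ofFn]; rfl]
  exact h2.trans h3

theorem topCoeff_algebraMap (hn : 0 < n) (r : R) : topCoeff Q e (algebraMap R _ r) = 0 := by
  have h : equivExterior Q (algebraMap R _ r) ∈ filtration (0 : QuadraticForm R E) 0 := by
    rw [Algebra.algebraMap_eq_smul_one, map_smul]
    refine Submodule.smul_mem _ _ (Submodule.subset_span ⟨[], by simp, ?_⟩)
    exact changeForm_one changeForm.associated_neg_proof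
  exact liftAlternating_single_filtration hn e.det h

end CliffordAlgebra

/-! ### The even Clifford algebra of a form on a free module -/

section Lists

theorem List.prod_map_ite_one {A α : Type*} [Monoid A] (p : α → Bool) (g : α → A) (l : List α) :
    (l.map fun i => if p i then g i else 1).prod = ((l.filter p).map g).prod := by
  induction l with
  | nil => simp
  | cons x l ih => by_cases h : p x <;> simp [h, ih]

theorem boolProd_eq_prod_filter {A : Type*} [Monoid A] {n : ℕ} (g : Fin n → A)
    (ε : Fin n → Bool) : boolProd g ε = (((List.finRange n).filter ε).map g).prod := by
  rw [← List.prod_map_ite_one, boolProd, List.ofFn_eq_map]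

theorem boolParity_eq_length {n : ℕ} (ε : Fin n → Bool) :
    boolParity ε = (((List.finRange n).filter ε).length : ZMod 2) := by
  have : ∀ l : List (Fin n), (l.map fun i => if ε i then (1 : ZMod 2) else 0).sum =
      ((l.filter ε).length : ZMod 2) := by
    intro l
    induction l with
    | nil => simp
    | cons x l ih => by_cases h : ε x <;> simp [h, ih, add_comm]
  rw [← this, boolParity, ← List.sum_ofFn, List.ofFn_eq_map]

/-- The sign by which `x` commutes with a product is the product of the signs of the factors. -/
theorem mul_prod_ofFn_of_sign {A : Type*} [Ring A] {n : ℕ} (g : Fin n → A) (x : A)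
    (s : Fin n → ℤ) (h : ∀ i, x * g i = s i • (g i * x)) :
    x * (List.ofFn g).prod = (∏ i, s i) • ((List.ofFn g).prod * x) := by
  induction n with
  | zero => simp
  | succ n ih =>
    rw [List.ofFn_succ, List.prod_cons, Fin.prod_univ_succ, ← mul_assoc, h 0, smul_mul_assoc,
      mul_assoc, ih _ _ fun i => h i.succ, mul_smul_comm, smul_smul, mul_assoc]

theorem prod_ite_neg_one {n : ℕ} (j : Fin n) :
    (∏ i : Fin n, if i = j then (1 : ℤ) else -1) = (-1) ^ (n - 1) := by
  rw [← Finset.mul_prod_erase _ _ (Finset.mem_univ j)]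
  rw [if_pos rfl, one_mul, Finset.prod_congr rfl fun i hi => if_neg (Finset.ne_of_mem_erase hi)]
  simp

/-- The sign of the square of a product of `n` anticommuting elements. -/
def squareSign (n : ℕ) : ℤ := (-1) ^ (∑ i ∈ Finset.range n, i)

theorem squareSign_mul_self (n : ℕ) : squareSign n * squareSign n = 1 := by
  rw [squareSign, ← mul_pow]; simp

theorem prod_ofFn_mul_self {R A : Type*} [CommRing R] [Ring A] [Algebra R A] {n : ℕ}
    (g : Fin n → A) (c : Fin n → R) (h : ∀ i j, i ≠ j → g i * g j = -(g j * g i))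
    (hc : ∀ i, g i * g i = algebraMap R A (c i)) :
    (List.ofFn g).prod * (List.ofFn g).prod = squareSign n • algebraMap R A (∏ i, c i) := by
  induction n with
  | zero => simp [squareSign]
  | succ n ih =>
    have h1 : (List.ofFn fun i : Fin n => g i.succ).prod * g 0 =
        ((-1 : ℤ) ^ n) • (g 0 * (List.ofFn fun i : Fin n => g i.succ).prod) := by
      rw [mul_prod_ofFn_of_sign (fun i : Fin n => g i.succ) (g 0) (fun _ => -1) fun i => by
        rw [h 0 i.succ (by simp [Fin.ext_iff])]; simp]
      rw [smul_smul, Finset.prod_const, Finset.card_univ, Fintype.card_fin, ← mul_pow]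
      simp
    rw [List.ofFn_succ, List.prod_cons, mul_assoc, ← mul_assoc _ (g 0), h1, smul_mul_assoc,
      mul_smul_comm, mul_assoc, ih _ _ (fun i j hij => h _ _ (by simpa using hij)) fun i => hc _,
      ← mul_assoc, hc, mul_smul_comm, ← map_mul, Fin.prod_univ_succ, smul_smul, squareSign,
      squareSign, Finset.sum_range_succ, pow_add, mul_comm ((-1 : ℤ) ^ n)]

end Lists

namespace EvenClifford

variable {R E L : Type u} [CommRing R] [AddCommGroup E] [Module R E] [AddCommGroup L] [Module R L]
  (b : E →ₗ[R] E →ₗ[R] L →ₗ[R] R)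

/-- The product of the elements of a list of even length, as an element of the even Clifford
algebra. -/
def genList (l : L) : List E → EvenClifford b
  | v :: w :: t => gen b v w l * genList l t
  | _ => 1

theorem map_genList {R' E' L' : Type u} [CommRing R'] [AddCommGroup E'] [Module R' E']
    [AddCommGroup L'] [Module R' L'] (b' : E' →ₗ[R'] E' →ₗ[R'] L' →ₗ[R'] R') (f : R →+* R')
    (fE : E →ₛₗ[f] E') (fL : L →ₛₗ[f] L')
    (h : ∀ v w l, b' (fE v) (fE w) (fL l) = f (b v w l)) (l : L) :
    ∀ t : List E, map b b' f fE fL h (genList b l t) = genList b' (fL l) (t.map fE)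
  | [] => map_one _
  | [_] => map_one _
  | v :: w :: t => by
    simp only [genList, List.map_cons, map_mul, map_gen, map_genList b' f fE fL h l t]

theorem map_antisymm {R' E' L' : Type u} [CommRing R'] [AddCommGroup E'] [Module R' E']
    [AddCommGroup L'] [Module R' L'] (b' : E' →ₗ[R'] E' →ₗ[R'] L' →ₗ[R'] R') (f : R →+* R')
    (fE : E →ₛₗ[f] E') (fL : L →ₛₗ[f] L')
    (h : ∀ v w l, b' (fE v) (fE w) (fL l) = f (b v w l)) {m : ℕ} (v : Fin (2 * m) → E)
    (t : Fin m → L) :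
    map b b' f fE fL h (antisymm b v t) = antisymm b' (fun i => fE (v i)) fun i => fL (t i) := by
  rw [antisymm, antisymm, map_sum]
  refine Finset.sum_congr rfl fun τ _ => ?_
  rw [map_zsmul, map_list_prod, List.map_ofFn]
  congr 3
  ext i
  exact map_gen _ _ _ _ _ _ _ _ _

section Free

variable (l : Module.Basis (Fin 1) R L)

/-- The coordinate on a free module of rank one. -/
def lineEquiv : L ≃ₗ[R] R := l.equivFun ≪≫ₗ LinearEquiv.funUnique (Fin 1) R R

@[simp]
theorem lineEquiv_symm_one : (lineEquiv l).symm 1 = l 0 := by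
  rw [LinearEquiv.symm_apply_eq]
  simp [lineEquiv]

@[simp]
theorem lineEquiv_self : lineEquiv l (l 0) = 1 := by
  simp [lineEquiv]

/-- The scalar quadratic form obtained from a line-valued form by a generator of the line. -/
abbrev lineForm : QuadraticForm R E := scalarForm b ((lineEquiv l).symm 1)

theorem lineForm_apply (v : E) : lineForm b l v = b v v (l 0) := by
  rw [← lineEquiv_symm_one]; rfl

theorem polar_lineForm (hb : ∀ v w, b v w = b w v) (v w : E) :
    QuadraticMap.polar (lineForm b l) v w = 2 * b v w (l 0) := by
  simp only [QuadraticMap.polar, lineForm_apply, map_add, LinearMap.add_apply, hb w v]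
  ring

/-- The embedding of the even Clifford algebra into the Clifford algebra given by a generator of
the line. -/
def toClifford : EvenClifford b →ₐ[R] CliffordAlgebra (lineForm b l) :=
  (CliffordAlgebra.even (lineForm b l)).val.comp (equivEven b (lineEquiv l)).toAlgHom

theorem toClifford_injective : Function.Injective (toClifford b l) :=
  Subtype.val_injective.comp (equivEven b (lineEquiv l)).injective

theorem range_toClifford :
    LinearMap.range (toClifford b l).toLinearMap = CliffordAlgebra.evenOdd (lineForm b l) 0 := by
  ext x
  constructor
  · rintro ⟨y, rfl⟩
    exact (equivEven b (lineEquiv l) y).2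
  · intro hx
    obtain ⟨y, hy⟩ := (equivEven b (lineEquiv l)).surjective ⟨x, hx⟩
    exact ⟨y, congrArg Subtype.val hy⟩

theorem toClifford_gen (v w : E) (t : L) :
    toClifford b l (gen b v w t) =
      lineEquiv l t • (CliffordAlgebra.ι _ v * CliffordAlgebra.ι _ w) := by
  have : equivEven b (lineEquiv l) (gen b v w t) =
      lineEquiv l t • (CliffordAlgebra.even.ι (lineForm b l)).bilin v w := lift_ι b _ _ _ _
  exact congrArg Subtype.val this

theorem toClifford_gen_self (v w : E) :
    toClifford b l (gen b v w (l 0)) = CliffordAlgebra.ι _ v * CliffordAlgebra.ι _ w := by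
  rw [toClifford_gen, lineEquiv_self, one_smul]

theorem toClifford_genList : ∀ t : List E, Even t.length →
    toClifford b l (genList b (l 0) t) = (t.map (CliffordAlgebra.ι (lineForm b l))).prod
  | [], _ => map_one _
  | [_], h => by simp at h
  | v :: w :: t, h => by
    rw [genList, map_mul, toClifford_gen_self, toClifford_genList t (by
      simpa [Nat.even_add_one] using h)]
    simp [mul_assoc]

variable {n : ℕ} (e : Module.Basis (Fin n) R E)

theorem toClifford_genList_bool (ε : EvenBool n) :
    toClifford b l (genList b (l 0) (((List.finRange n).filter ε.1).map e)) =
      boolProd (fun i => CliffordAlgebra.ι _ (e i)) ε.1 := by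
  rw [toClifford_genList, List.map_map, boolProd_eq_prod_filter]
  · rfl
  · have h := ε.2
    rw [boolParity_eq_length, ZMod.natCast_eq_zero_iff_even] at h
    simpa using h

variable [Invertible (2 : R)]

/-- The basis of the even Clifford algebra consisting of the ordered products of even numbers of
basis vectors. -/
def evenBasis : Module.Basis (EvenBool n) R (EvenClifford b) :=
  Module.Basis.mk (v := fun ε => genList b (l 0) (((List.finRange n).filter ε.1).map e))
    (by
      refine LinearIndependent.of_comp (toClifford b l).toLinearMap ?_
      have h := (CliffordAlgebra.boolBasis (lineForm b l) e).linearIndependent.comp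
        (Subtype.val : EvenBool n → _) Subtype.val_injective
      convert h using 1
      ext ε
      exact (toClifford_genList_bool b l e ε).trans (by simp))
    (by
      refine (Submodule.map_injective_of_injective (f := (toClifford b l).toLinearMap)
        (toClifford_injective b l) ?_).ge
      rw [Submodule.map_top, range_toClifford, Submodule.map_span, ← Set.range_comp,
        ← CliffordAlgebra.span_boolProd_even (lineForm b l) e]
      congr 2
      ext ε
      exact toClifford_genList_bool b l e ε)

theorem evenBasis_apply (ε : EvenBool n) :
    evenBasis b l e ε = genList b (l 0) (((List.finRange n).filter ε.1).map e) := by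
  simp [evenBasis]

theorem algebraMap_injective_of_basis (l : Module.Basis (Fin 1) R L) {n : ℕ}
    (e : Module.Basis (Fin n) R E) : Function.Injective (algebraMap R (EvenClifford b)) := by
  have h0 : boolParity (fun _ : Fin n => false) = 0 := by simp [boolParity]
  have h1 : evenBasis b l e ⟨_, h0⟩ = 1 := by
    rw [evenBasis_apply]; simp [genList]
  intro r s h
  rw [Algebra.algebraMap_eq_smul_one, Algebra.algebraMap_eq_smul_one, ← h1] at h
  have := congrArg (fun x => (evenBasis b l e).repr x ⟨_, h0⟩) h
  simpa using this

end Free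

theorem map_evenBasis {R' E' L' : Type u} [CommRing R'] [AddCommGroup E'] [Module R' E']
    [AddCommGroup L'] [Module R' L'] [Invertible (2 : R)] [Invertible (2 : R')]
    (b' : E' →ₗ[R'] E' →ₗ[R'] L' →ₗ[R'] R') (f : R →+* R')
    (fE : E →ₛₗ[f] E') (fL : L →ₛₗ[f] L')
    (h : ∀ v w l, b' (fE v) (fE w) (fL l) = f (b v w l)) {n : ℕ} (e : Module.Basis (Fin n) R E)
    (l : Module.Basis (Fin 1) R L) (e' : Module.Basis (Fin n) R' E')
    (l' : Module.Basis (Fin 1) R' L') (he : ∀ i, fE (e i) = e' i) (hl : fL (l 0) = l' 0)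
    (ε : EvenBool n) :
    map b b' f fE fL h (evenBasis b l e ε) = evenBasis b' l' e' ε := by
  rw [evenBasis_apply, evenBasis_apply, map_genList, hl, List.map_map]
  congr 2
  ext i
  exact he i

theorem map_smul_eq {R' E' L' : Type u} [CommRing R'] [AddCommGroup E'] [Module R' E']
    [AddCommGroup L'] [Module R' L'] (b' : E' →ₗ[R'] E' →ₗ[R'] L' →ₗ[R'] R') (f : R →+* R')
    (fE : E →ₛₗ[f] E') (fL : L →ₛₗ[f] L')
    (h : ∀ v w l, b' (fE v) (fE w) (fL l) = f (b v w l)) (r : R) (x : EvenClifford b) :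
    map b b' f fE fL h (r • x) = f r • map b b' f fE fL h x := by
  rw [Algebra.smul_def, map_mul, map_algebraMap, Algebra.smul_def]

/-- Base change along an injective homomorphism is injective on even Clifford algebras. -/
theorem map_injective {R' E' L' : Type u} [CommRing R'] [AddCommGroup E'] [Module R' E']
    [AddCommGroup L'] [Module R' L'] [Invertible (2 : R)] [Invertible (2 : R')]
    (b' : E' →ₗ[R'] E' →ₗ[R'] L' →ₗ[R'] R') (f : R →+* R')
    (fE : E →ₛₗ[f] E') (fL : L →ₛₗ[f] L')
    (h : ∀ v w l, b' (fE v) (fE w) (fL l) = f (b v w l)) {n : ℕ} (e : Module.Basis (Fin n) R E)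
    (l : Module.Basis (Fin 1) R L) (e' : Module.Basis (Fin n) R' E')
    (l' : Module.Basis (Fin 1) R' L') (he : ∀ i, fE (e i) = e' i) (hl : fL (l 0) = l' 0)
    (hf : Function.Injective f) : Function.Injective (map b b' f fE fL h) := by
  refine (injective_iff_map_eq_zero _).2 fun x hx => ?_
  have h1 : map b b' f fE fL h x =
      ∑ ε, f ((evenBasis b l e).repr x ε) • evenBasis b' l' e' ε := by
    conv_lhs => rw [← (evenBasis b l e).sum_repr x, map_sum]
    refine Finset.sum_congr rfl fun ε _ => ?_
    rw [map_smul_eq, map_evenBasis b b' f fE fL h e l e' l' he hl]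
  rw [hx] at h1
  have h2 := Fintype.linearIndependent_iff.1 (evenBasis b' l' e').linearIndependent _ h1.symm
  rw [← (evenBasis b l e).sum_repr x]
  exact Finset.sum_eq_zero fun ε _ => by
    rw [(map_eq_zero_iff f hf).1 (h2 ε), zero_smul]

/-! ### The antisymmetrised product -/

section Omega

variable (l : Module.Basis (Fin 1) R L)

/-- The antisymmetrised product of `n` vectors in the Clifford algebra. -/
def altProd (n : ℕ) : E [⋀^Fin n]→ₗ[R] CliffordAlgebra (lineForm b l) :=
  MultilinearMap.alternatization
    ((MultilinearMap.mkPiAlgebraFin R n (CliffordAlgebra (lineForm b l))).compLinearMap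
      fun _ => CliffordAlgebra.ι (lineForm b l))

theorem altProd_apply {n : ℕ} (v : Fin n → E) :
    altProd b l n v = ∑ τ : Equiv.Perm (Fin n), (Equiv.Perm.sign τ : ℤ) •
      (List.ofFn fun i => CliffordAlgebra.ι (lineForm b l) (v (τ i))).prod := by
  rw [altProd, MultilinearMap.alternatization_apply]
  rfl

theorem toClifford_prod_gen {m : ℕ} (v : Fin (2 * m) → E) (t : Fin m → L) :
    toClifford b l (List.ofFn fun i : Fin m =>
      gen b (v ⟨2 * i, by omega⟩) (v ⟨2 * i + 1, by omega⟩) (t i)).prod =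
      (∏ i, lineEquiv l (t i)) • (List.ofFn fun i => CliffordAlgebra.ι (lineForm b l) (v i)).prod := by
  rw [map_list_prod, List.map_ofFn]
  induction m with
  | zero => simp
  | succ m ih =>
    have h2 := ih (fun i => v ⟨i + 2, by omega⟩) (fun i => t i.succ)
    rw [List.ofFn_succ, List.prod_cons, Fin.prod_univ_succ]
    have h3 : (List.ofFn fun i : Fin (2 * (m + 1)) => CliffordAlgebra.ι (lineForm b l) (v i)) =
        CliffordAlgebra.ι _ (v ⟨0, by omega⟩) :: CliffordAlgebra.ι _ (v ⟨1, by omega⟩) ::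
          (List.ofFn fun i : Fin (2 * m) => CliffordAlgebra.ι _ (v ⟨i + 2, by omega⟩)) := by
      rw [List.ofFn_congr (show 2 * (m + 1) = 2 * m + 1 + 1 by ring), List.ofFn_succ,
        List.ofFn_succ]
      rfl
    have h4 : (List.ofFn fun i : Fin m => (⇑(toClifford b l) ∘ fun i : Fin (m + 1) =>
        gen b (v ⟨2 * i, by omega⟩) (v ⟨2 * i + 1, by omega⟩) (t i)) i.succ) =
        List.ofFn (⇑(toClifford b l) ∘ fun i : Fin m => gen b (v ⟨2 * i + 2, by omega⟩)
          (v ⟨2 * i + 1 + 2, by omega⟩) (t i.succ)) := by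
      congr 1
    rw [h3, List.prod_cons, List.prod_cons, h4, h2]
    simp only [Function.comp_apply, toClifford_gen, smul_mul_smul_comm, mul_assoc]
    rfl

theorem toClifford_antisymm {m : ℕ} (v : Fin (2 * m) → E) (t : Fin m → L) :
    toClifford b l (antisymm b v t) =
      (∏ i, lineEquiv l (t i)) • altProd b l (2 * m) v := by
  rw [antisymm, altProd_apply, map_sum, Finset.smul_sum]
  refine Finset.sum_congr rfl fun τ _ => ?_
  rw [map_zsmul, toClifford_prod_gen b l (fun i => v (τ i)), smul_comm]

theorem _root_.AlternatingMap.eq_basis_det_smul {N : Type*} [AddCommGroup N] [Module R N] {n : ℕ}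
    (e : Module.Basis (Fin n) R E) (f : E [⋀^Fin n]→ₗ[R] N) (v : Fin n → E) :
    f v = e.det v • f e := by
  have : f = (LinearMap.toSpanSingleton R N (f e)).compAlternatingMap e.det := by
    refine Module.Basis.ext_alternating e fun w hw => ?_
    let τ : Equiv.Perm (Fin n) := Equiv.ofBijective w (Finite.injective_iff_bijective.1 hw)
    have h1 := f.map_perm (fun i => e i) τ
    have h2 := e.det.map_perm (fun i => e i) τ
    change f (fun i => e (w i)) = LinearMap.toSpanSingleton R N (f e) (e.det fun i => e (w i))
    change f (fun i => e (w i)) = _ at h1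
    change e.det (fun i => e (w i)) = _ at h2
    rw [h1, h2, show (fun i => e i) = ⇑e from rfl, e.det_self]
    rcases Int.units_eq_one_or (Equiv.Perm.sign τ) with h | h <;> simp [h]
  conv_lhs => rw [this]
  simp

variable {m : ℕ} (e : Module.Basis (Fin (2 * m)) R E)

/-- The antisymmetrised product of the members of a basis. -/
def omega : EvenClifford b := antisymm b e fun _ : Fin m => l 0

theorem antisymm_eq_smul_omega (v : Fin (2 * m) → E) (t : Fin m → L) :
    antisymm b v t = (e.det v * ∏ i, lineEquiv l (t i)) • omega b l e := by
  apply toClifford_injective b l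
  rw [map_smul, omega, toClifford_antisymm, toClifford_antisymm,
    AlternatingMap.eq_basis_det_smul e _ v]
  simp [smul_smul, mul_comm]

theorem toClifford_omega : toClifford b l (omega b l e) = altProd b l (2 * m) e := by
  rw [omega, toClifford_antisymm]; simp

/-- Every summand of the antisymmetrised product of a basis has top coefficient `1`: the sign of the
permutation cancels the determinant of the permuted basis. -/
theorem topCoeff_altProd [Invertible (2 : R)] (hm : 0 < m) :
    CliffordAlgebra.topCoeff (lineForm b l) e (altProd b l (2 * m) e) = (2 * m).factorial := by
  rw [altProd_apply, map_sum]
  have : ∀ τ : Equiv.Perm (Fin (2 * m)), CliffordAlgebra.topCoeff (lineForm b l) e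
      ((Equiv.Perm.sign τ : ℤ) • (List.ofFn fun i => CliffordAlgebra.ι (lineForm b l)
        (e (τ i))).prod) = 1 := by
    intro τ
    rw [map_zsmul, CliffordAlgebra.topCoeff_prod_ofFn _ e (fun i => e (τ i)) (by lia)]
    have h2 := e.det.map_perm (fun i => e i) τ
    change e.det (fun i => e (τ i)) = _ at h2
    rw [h2, show (fun i => e i) = ⇑e from rfl, e.det_self]
    rcases Int.units_eq_one_or (Equiv.Perm.sign τ) with h | h <;> simp [h]
  rw [Finset.sum_congr rfl fun τ _ => this τ]
  simp [Fintype.card_perm]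

/-- For an orthogonal basis, the antisymmetrised product is a multiple of the Clifford
product. -/
theorem altProd_of_orthogonal [Invertible (2 : R)] (hm : 0 < m)
    (ho : ∀ i j, i ≠ j → CliffordAlgebra.ι (lineForm b l) (e i) * CliffordAlgebra.ι _ (e j) =
      -(CliffordAlgebra.ι _ (e j) * CliffordAlgebra.ι _ (e i))) :
    altProd b l (2 * m) e = ((2 * m).factorial : R) •
      (List.ofFn fun i => CliffordAlgebra.ι (lineForm b l) (e i)).prod := by
  set p := (List.ofFn fun i => CliffordAlgebra.ι (lineForm b l) (e i)).prod with hp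
  have h1 : ∀ τ : Equiv.Perm (Fin (2 * m)), ∃ c : ℤ, (Equiv.Perm.sign τ : ℤ) •
      (List.ofFn fun i => CliffordAlgebra.ι (lineForm b l) (e (τ i))).prod = c • p := by
    intro τ
    have hperm : (List.ofFn fun i => CliffordAlgebra.ι (lineForm b l) (e (τ i))).Perm
        (List.ofFn fun i => CliffordAlgebra.ι (lineForm b l) (e i)) :=
      Equiv.Perm.ofFn_comp_perm τ fun i => CliffordAlgebra.ι (lineForm b l) (e i)
    rcases List.Perm.prod_eq_or_eq_neg hperm (by
      intro x hx y hy
      rw [List.mem_ofFn] at hx hy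
      obtain ⟨i, rfl⟩ := hx
      obtain ⟨j, rfl⟩ := hy
      by_cases hij : τ i = τ j
      · left; simp only [hij]
      · right; exact ho _ _ hij) with h | h
    · exact ⟨Equiv.Perm.sign τ, by rw [h]⟩
    · exact ⟨-(Equiv.Perm.sign τ), by rw [h]; simp [hp]⟩
  -- Each summand is an integer multiple of `p`; the sum of the integers is read off from the top
  -- coefficient, which avoids following the signs.
  choose c hc using h1
  have h2 : altProd b l (2 * m) e = (∑ τ, c τ) • p := by
    rw [altProd_apply, Finset.sum_smul]
    exact Finset.sum_congr rfl fun τ _ => hc τ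
  have h3 := congrArg (CliffordAlgebra.topCoeff (lineForm b l) e) h2
  rw [topCoeff_altProd b l e hm, map_zsmul, hp, CliffordAlgebra.topCoeff_prod_ofFn _ e _ (by lia),
    e.det_self] at h3
  rw [h2, h3, smul_assoc, one_smul]

variable [Algebra ℚ R] [Invertible (2 : R)]

theorem isUnit_natCast_factorial (R : Type*) [CommRing R] [Algebra ℚ R] (n : ℕ) :
    IsUnit (n.factorial : R) := by
  have := (IsUnit.mk0 (n.factorial : ℚ) (by positivity)).map (algebraMap ℚ R)
  simpa using this

/-- `1` and `ω` are linearly independent: the top coefficient kills `1` and is `(2m)!` on `ω`. -/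
theorem add_smul_omega_injective (hm : 0 < m) :
    Function.Injective fun q : R × R => algebraMap R (EvenClifford b) q.1 + q.2 • omega b l e := by
  have key : ∀ r s : R, algebraMap R (EvenClifford b) r + s • omega b l e = 0 →
      r = 0 ∧ s = 0 := by
    intro r s h
    have h1 := congrArg (fun x => CliffordAlgebra.topCoeff (lineForm b l) e (toClifford b l x)) h
    simp only [map_add, AlgHom.commutes, map_smul, toClifford_omega, map_zero] at h1
    rw [CliffordAlgebra.topCoeff_algebraMap _ e (by lia), topCoeff_altProd b l e hm, zero_add,
      smul_eq_mul] at h1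
    have hs : s = 0 := (isUnit_natCast_factorial R _).mul_left_eq_zero.1 h1
    refine ⟨?_, hs⟩
    rw [hs, zero_smul, add_zero] at h
    exact algebraMap_injective_of_basis b l e (h.trans (map_zero _).symm)
  rintro ⟨r, s⟩ ⟨r', s'⟩ h
  have h1 := key (r - r') (s - s') (by
    simp only at h
    rw [map_sub, sub_smul, sub_add_sub_comm, h, sub_self])
  ext
  · exact sub_eq_zero.1 h1.1
  · exact sub_eq_zero.1 h1.2

end Omega

end EvenClifford

/-! ### Centrality and the square of the antisymmetrised product -/

namespace EvenClifford

section Gram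

variable {R E L : Type u} [CommRing R] [AddCommGroup E] [Module R E] [AddCommGroup L] [Module R L]
  (b : E →ₗ[R] E →ₗ[R] L →ₗ[R] R) (l : Module.Basis (Fin 1) R L) {n : ℕ}

/-- The Gram matrix of a family of vectors with respect to a generator of the line. -/
def gram (e : Fin n → E) : Matrix (Fin n) (Fin n) R := Matrix.of fun i j => b (e i) (e j) (l 0)

theorem gram_basis (e f : Module.Basis (Fin n) R E) :
    gram b l e = (f.toMatrix e).transpose * gram b l f * f.toMatrix e := by
  have h : ∀ c : Module.Basis (Fin n) R E, gram b l c =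
      LinearMap.BilinForm.toMatrix c (b.compr₂ (LinearMap.applyₗ (l 0))) := by
    intro c
    ext i j
    rw [LinearMap.BilinForm.toMatrix_apply]
    rfl
  rw [h, h, LinearMap.BilinForm.toMatrix_mul_basis_toMatrix]

theorem det_gram_basis (e f : Module.Basis (Fin n) R E) :
    (gram b l e).det = f.det e ^ 2 * (gram b l f).det := by
  rw [gram_basis b l e f, Matrix.det_mul, Matrix.det_mul, Matrix.det_transpose,
    Module.Basis.det_apply]
  ring

end Gram

section Orthogonal

variable {R E L : Type u} [CommRing R] [AddCommGroup E] [Module R E] [AddCommGroup L] [Module R L]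
  (b : E →ₗ[R] E →ₗ[R] L →ₗ[R] R) (hb : ∀ v w, b v w = b w v)
  (l : Module.Basis (Fin 1) R L) {m : ℕ} (e : Module.Basis (Fin (2 * m)) R E)

include hb in
theorem ι_mul_ι_of_orthogonal {v w : E} (h : b v w (l 0) = 0) :
    CliffordAlgebra.ι (lineForm b l) v * CliffordAlgebra.ι (lineForm b l) w =
      -(CliffordAlgebra.ι (lineForm b l) w * CliffordAlgebra.ι (lineForm b l) v) := by
  rw [eq_neg_iff_add_eq_zero, CliffordAlgebra.ι_mul_ι_add_swap, polar_lineForm b l hb, h]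
  simp

include hb in
theorem ι_mul_prod_of_orthogonal (ho : ∀ i j, i ≠ j → b (e i) (e j) (l 0) = 0) (v : E) :
    CliffordAlgebra.ι (lineForm b l) v *
        (List.ofFn fun i => CliffordAlgebra.ι (lineForm b l) (e i)).prod =
      -((List.ofFn fun i => CliffordAlgebra.ι (lineForm b l) (e i)).prod *
        CliffordAlgebra.ι (lineForm b l) v) := by
  induction e.mem_span v using Submodule.span_induction with
  | mem v hv =>
    obtain ⟨j, rfl⟩ := hv
    rw [mul_prod_ofFn_of_sign _ _ (fun i => if i = j then (1 : ℤ) else -1), prod_ite_neg_one]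
    · have : Odd (2 * m - 1) := by
        have := j.2
        exact ⟨m - 1, by omega⟩
      rw [this.neg_one_pow, neg_one_smul]
    · intro i
      split_ifs with h
      · subst h; simp
      · rw [ι_mul_ι_of_orthogonal b hb l (ho j i (Ne.symm h))]; simp
  | zero => simp
  | add x y _ _ hx hy => simp only [map_add, add_mul, mul_add, hx, hy, neg_add]
  | smul r x _ hx => simp only [map_smul, smul_mul_assoc, mul_smul_comm, hx, smul_neg]

theorem toClifford_omega_of_orthogonal [Invertible (2 : R)] (hm : 0 < m)
    (hb : ∀ v w, b v w = b w v) (ho : ∀ i j, i ≠ j → b (e i) (e j) (l 0) = 0) :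
    toClifford b l (omega b l e) = ((2 * m).factorial : R) •
      (List.ofFn fun i => CliffordAlgebra.ι (lineForm b l) (e i)).prod := by
  rw [toClifford_omega, altProd_of_orthogonal b l e hm fun i j hij =>
    ι_mul_ι_of_orthogonal b hb l (ho i j hij)]

/-- An element commuting with the generators is central. -/
theorem commute_of_gen {x : EvenClifford b} (h : ∀ v w t, Commute (gen b v w t) x)
    (y : EvenClifford b) : Commute y x := by
  let p : TensorAlgebra R ((E ⊗[R] E) ⊗[R] L) →ₐ[R] EvenClifford b :=
    RingQuot.mkAlgHom R (EvenCliffordRel b)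
  obtain ⟨z, rfl⟩ : ∃ z, p z = y := RingQuot.mkAlgHom_surjective R (EvenCliffordRel b) y
  induction z using TensorAlgebra.induction with
  | algebraMap r => rw [AlgHom.commutes]; exact Algebra.commutes _ _
  | ι t =>
    change Commute (ι b t) x
    induction t with
    | zero => simp
    | add x y hx hy => rw [map_add]; exact hx.add_left hy
    | tmul s l =>
      induction s with
      | zero => simp
      | add x y hx hy => rw [TensorProduct.add_tmul, map_add]; exact hx.add_left hy
      | tmul v w => exact h v w l
  | mul x y hx hy => rw [map_mul]; exact hx.mul_left hy
  | add x y hx hy => rw [map_add]; exact hx.add_left hy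

theorem commute_omega_of_orthogonal [Invertible (2 : R)] (hm : 0 < m)
    (hb : ∀ v w, b v w = b w v) (ho : ∀ i j, i ≠ j → b (e i) (e j) (l 0) = 0)
    (x : EvenClifford b) : Commute x (omega b l e) := by
  refine commute_of_gen b (fun v w t => ?_) x
  apply toClifford_injective b l
  rw [map_mul, map_mul, toClifford_omega_of_orthogonal b l e hm hb ho, toClifford_gen]
  simp only [smul_mul_assoc, mul_smul_comm, mul_assoc,
    ι_mul_prod_of_orthogonal b hb l e ho w, mul_neg]
  rw [← mul_assoc, ι_mul_prod_of_orthogonal b hb l e ho v, neg_mul, neg_neg, mul_assoc, smul_comm]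

/-- The square of the antisymmetrised product of a basis is the discriminant, up to a sign and the
square of a factorial. -/
def discr : R := squareSign (2 * m) * ((2 * m).factorial : R) ^ 2 * (gram b l e).det

theorem omega_mul_self_of_orthogonal [Invertible (2 : R)] (hm : 0 < m)
    (hb : ∀ v w, b v w = b w v) (ho : ∀ i j, i ≠ j → b (e i) (e j) (l 0) = 0) :
    omega b l e * omega b l e = algebraMap R _ (discr b l e) := by
  apply toClifford_injective b l
  have hdet : (gram b l e).det = ∏ i, b (e i) (e i) (l 0) := by
    rw [show gram b l e = Matrix.diagonal fun i => b (e i) (e i) (l 0) from ?_,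
      Matrix.det_diagonal]
    ext i j
    by_cases h : i = j
    · subst h; simp [gram]
    · simp [gram, h, ho i j h]
  rw [map_mul, toClifford_omega_of_orthogonal b l e hm hb ho, AlgHom.commutes, smul_mul_smul_comm,
    prod_ofFn_mul_self (R := R) _ (fun i => b (e i) (e i) (l 0))
      (fun i j hij => ι_mul_ι_of_orthogonal b hb l (ho i j hij))
      (fun i => by rw [CliffordAlgebra.ι_sq_scalar, lineForm_apply]), discr, hdet]
  rw [← map_zsmul, Algebra.smul_def, ← map_mul, zsmul_eq_mul]
  congr 1
  ring

end Orthogonal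

theorem omega_eq_smul {R E L : Type u} [CommRing R] [AddCommGroup E] [Module R E]
    [AddCommGroup L] [Module R L] (b : E →ₗ[R] E →ₗ[R] L →ₗ[R] R) (l : Module.Basis (Fin 1) R L)
    {m : ℕ} (e f : Module.Basis (Fin (2 * m)) R E) :
    omega b l e = f.det e • omega b l f := by
  rw [omega, antisymm_eq_smul_omega b l f]
  simp

section Field

variable {K E L : Type u} [Field K] [Invertible (2 : K)] [AddCommGroup E] [Module K E]
  [AddCommGroup L] [Module K L]
  (b : E →ₗ[K] E →ₗ[K] L →ₗ[K] K) (hb : ∀ v w, b v w = b w v)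
  (l : Module.Basis (Fin 1) K L) {m : ℕ} (e : Module.Basis (Fin (2 * m)) K E)

include hb e in
theorem exists_orthogonal_basis : ∃ f : Module.Basis (Fin (2 * m)) K E,
    ∀ i j, i ≠ j → b (f i) (f j) (l 0) = 0 := by
  have : Module.Finite K E := Module.Finite.of_basis e
  obtain ⟨f, hf⟩ := LinearMap.BilinForm.exists_orthogonal_basis
    (B := b.compr₂ (LinearMap.applyₗ (l 0))) ⟨fun v w => by
      show b v w (l 0) = b w v (l 0)
      rw [hb]⟩
  have hr : Module.finrank K E = 2 * m := by simp [Module.finrank_eq_card_basis e]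
  refine ⟨f.reindex (finCongr hr), fun i j hij => ?_⟩
  rw [Module.Basis.reindex_apply, Module.Basis.reindex_apply]
  exact hf (by simpa using hij)

include hb in
theorem commute_omega_of_field (hm : 0 < m) (x : EvenClifford b) :
    Commute x (omega b l e) := by
  obtain ⟨f, hf⟩ := exists_orthogonal_basis b hb l e
  rw [omega_eq_smul b l e f]
  exact (commute_omega_of_orthogonal b l f hm hb hf x).smul_right _

include hb in
theorem omega_mul_self_of_field (hm : 0 < m) :
    omega b l e * omega b l e = algebraMap K _ (discr b l e) := by
  obtain ⟨f, hf⟩ := exists_orthogonal_basis b hb l e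
  rw [omega_eq_smul b l e f, smul_mul_smul_comm, omega_mul_self_of_orthogonal b l f hm hb hf,
    Algebra.smul_def, ← map_mul, discr, discr, det_gram_basis b l e f]
  congr 1
  ring

end Field

/-! The general case follows from the case of the generic symmetric matrix, whose entries lie in
a domain. -/

/-- The form with given Gram matrix on a free module. -/
def gramForm {R : Type u} [CommRing R] {n : ℕ} (G : Matrix (Fin n) (Fin n) R) :
    (Fin n → R) →ₗ[R] (Fin n → R) →ₗ[R] R →ₗ[R] R :=
  (Matrix.toBilin' G).compr₂ (LinearMap.mul R R)

theorem gramForm_apply {R : Type u} [CommRing R] {n : ℕ} (G : Matrix (Fin n) (Fin n) R)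
    (v w : Fin n → R) (r : R) : gramForm G v w r = (∑ i, ∑ j, v i * G i j * w j) * r := by
  simp [gramForm, Matrix.toBilin'_apply, Finset.sum_mul]

theorem gramForm_symm {R : Type u} [CommRing R] {n : ℕ} (G : Matrix (Fin n) (Fin n) R)
    (hG : ∀ i j, G i j = G j i) (v w : Fin n → R) : gramForm G v w = gramForm G w v := by
  ext
  rw [gramForm_apply, gramForm_apply, Finset.sum_comm]
  congr 1
  refine Finset.sum_congr rfl fun i _ => Finset.sum_congr rfl fun j _ => ?_
  rw [hG]; ring

section Specialise

variable {P R E L : Type u} [CommRing P] [CommRing R] [AddCommGroup E] [Module R E]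
  [AddCommGroup L] [Module R L] (b : E →ₗ[R] E →ₗ[R] L →ₗ[R] R) (f : P →+* R)
  {n : ℕ} (e : Fin n → E) (l : L)

/-- The semilinear map sending the standard basis to a given family. -/
def specVec : (Fin n → P) →ₛₗ[f] E where
  toFun v := ∑ i, f (v i) • e i
  map_add' v w := by simp [add_smul, Finset.sum_add_distrib]
  map_smul' r v := by simp [Finset.smul_sum, mul_smul]

/-- The semilinear map sending `1` to a given element. -/
def specLine : P →ₛₗ[f] L where
  toFun p := f p • l
  map_add' v w := by simp [add_smul]
  map_smul' r v := by simp [mul_smul]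

theorem specVec_single (i : Fin n) : specVec f e (Pi.single i 1) = e i := by
  simp only [specVec, LinearMap.coe_mk, AddHom.coe_mk]
  rw [Finset.sum_eq_single i]
  · simp
  · intro j _ hj
    simp [hj]
  · simp

theorem form_spec (G : Matrix (Fin n) (Fin n) P) (hG : ∀ i j, b (e i) (e j) l = f (G i j))
    (v w : Fin n → P) (p : P) :
    b (specVec f e v) (specVec f e w) (specLine f l p) = f (gramForm G v w p) := by
  simp only [specVec, specLine, LinearMap.coe_mk, AddHom.coe_mk, gramForm_apply, map_sum,
    LinearMap.sum_apply, map_smul, LinearMap.smul_apply, hG, smul_eq_mul, map_mul,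
    Finset.mul_sum, Finset.sum_mul]
  refine (Finset.sum_comm).trans (Finset.sum_congr rfl fun i _ => Finset.sum_congr rfl fun j _ => ?_)
  ring

/-- The homomorphism from the even Clifford algebra with given Gram matrix. -/
def spec (G : Matrix (Fin n) (Fin n) P) (hG : ∀ i j, b (e i) (e j) l = f (G i j)) :
    EvenClifford (gramForm G) →+* EvenClifford b :=
  map (gramForm G) b f (specVec f e) (specLine f l) (form_spec b f e l G hG)

end Specialise

/-- The standard basis of a free module of rank one. -/
def stdLine (P : Type u) [CommRing P] : Module.Basis (Fin 1) P P :=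
  Module.Basis.singleton (Fin 1) P

theorem spec_omega {P R E L : Type u} [CommRing P] [CommRing R] [AddCommGroup E] [Module R E]
    [AddCommGroup L] [Module R L] (b : E →ₗ[R] E →ₗ[R] L →ₗ[R] R) (f : P →+* R)
    {m : ℕ} (e : Module.Basis (Fin (2 * m)) R E) (l : Module.Basis (Fin 1) R L)
    (G : Matrix (Fin (2 * m)) (Fin (2 * m)) P) (hG : ∀ i j, b (e i) (e j) (l 0) = f (G i j)) :
    spec b f e (l 0) G hG (omega (gramForm G) (stdLine P) (Pi.basisFun P _)) = omega b l e := by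
  rw [spec, omega, map_antisymm, omega]
  congr 1
  · ext i; simp [specVec_single]
  · ext i; simp [specLine, stdLine]

theorem gram_gramForm {P : Type u} [CommRing P] {n : ℕ} (G : Matrix (Fin n) (Fin n) P) :
    gram (gramForm G) (stdLine P) (Pi.basisFun P _) = G := by
  ext i j
  simp [gram, gramForm, stdLine, Matrix.toBilin'_single]

theorem gramForm_spec_injective {P K : Type u} [CommRing P] [CommRing K] [Invertible (2 : P)]
    [Invertible (2 : K)] (f : P →+* K) (hf : Function.Injective f) {n : ℕ}
    (G : Matrix (Fin n) (Fin n) P) (hG : ∀ i j, gramForm (G.map f) (Pi.basisFun K _ i)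
      (Pi.basisFun K _ j) (stdLine K 0) = f (G i j)) :
    Function.Injective (spec (gramForm (G.map f)) f (Pi.basisFun K (Fin n)) (stdLine K 0) G hG) := by
  refine map_injective _ _ _ _ _ _ (Pi.basisFun P _) (stdLine P) (Pi.basisFun K _) (stdLine K)
    ?_ ?_ hf
  · intro i; rw [Pi.basisFun_apply, specVec_single]
  · simp [specLine, stdLine]

variable {R E L : Type u} [CommRing R] [Algebra ℚ R] [AddCommGroup E] [Module R E]
  [AddCommGroup L] [Module R L]
  (b : E →ₗ[R] E →ₗ[R] L →ₗ[R] R) (hb : ∀ v w, b v w = b w v)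
  (l : Module.Basis (Fin 1) R L) {m : ℕ} (e : Module.Basis (Fin (2 * m)) R E)

/-- Every symmetric form is a specialisation of a form over a polynomial ring over `ℚ` for which `ω` is
central with square the discriminant. The generic form has a Clifford algebra that embeds into the
one over the fraction field, where an orthogonal basis exists; hence both identities descend to all
symmetric forms. -/
theorem exists_generic (hb : ∀ v w, b v w = b w v) (hm : 0 < m) :
    ∃ (P : Type u) (_ : CommRing P) (f : P →+* R) (G : Matrix (Fin (2 * m)) (Fin (2 * m)) P)
      (_ : ∀ i j, b (e i) (e j) (l 0) = f (G i j)),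
      (∀ x, Commute x (omega (gramForm G) (stdLine P) (Pi.basisFun P _))) ∧
      omega (gramForm G) (stdLine P) (Pi.basisFun P _) *
        omega (gramForm G) (stdLine P) (Pi.basisFun P _) =
          algebraMap P _ (discr (gramForm G) (stdLine P) (Pi.basisFun P _)) := by
  -- The Gram matrix `X i j + X j i` is symmetric, and `X i j ↦ b (e i) (e j) / 2` sends it to the Gram
  -- matrix of `b`.
  let P := MvPolynomial (ULift.{u} (Fin (2 * m) × Fin (2 * m))) ℚ
  let K := FractionRing P
  let G : Matrix (Fin (2 * m)) (Fin (2 * m)) P := Matrix.of fun i j =>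
    MvPolynomial.X ⟨i, j⟩ + MvPolynomial.X ⟨j, i⟩
  have hGs : ∀ i j, G i j = G j i := fun i j => add_comm _ _
  let f : P →+* R := (MvPolynomial.aeval fun p : ULift.{u} (Fin (2 * m) × Fin (2 * m)) =>
    (2⁻¹ : ℚ) • b (e p.down.1) (e p.down.2) (l 0)).toRingHom
  let _ : Invertible (2 : P) := (Invertible.map (algebraMap ℚ P) 2).copy _ (map_ofNat _ 2).symm
  let _ : Invertible (2 : K) := (Invertible.map (algebraMap P K) 2).copy _ (map_ofNat _ 2).symm
  let j : P →+* K := algebraMap P K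
  have hj : Function.Injective j := IsFractionRing.injective P K
  have hGK : ∀ i k, gramForm (G.map j) (Pi.basisFun K _ i)
      (Pi.basisFun K _ k) (stdLine K 0) = j (G i k) := fun i k =>
    congrFun (congrFun (gram_gramForm (G.map j)) i) k
  have hinj := gramForm_spec_injective j hj G hGK
  have hsymm := gramForm_symm (G.map j) fun i k => congrArg j (hGs i k)
  refine ⟨P, inferInstance, f, G, fun i k => ?_, fun x => ?_, ?_⟩
  · have hX : ∀ p, f (MvPolynomial.X p) = (2⁻¹ : ℚ) • b (e p.down.1) (e p.down.2) (l 0) :=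
      fun p => MvPolynomial.aeval_X _ _
    change _ = f (MvPolynomial.X _ + MvPolynomial.X _)
    rw [map_add, hX, hX, hb (e k) (e i), ← add_smul]
    norm_num
  · apply hinj
    rw [map_mul, map_mul, spec_omega]
    exact commute_omega_of_field _ hsymm _ _ hm _
  · apply hinj
    rw [map_mul, spec_omega, omega_mul_self_of_field _ hsymm _ _ hm, spec, map_algebraMap]
    congr 1
    rw [discr, discr, gram_gramForm, gram_gramForm]
    simp only [map_mul, map_pow, map_intCast, map_natCast, RingHom.map_det]
    rfl

include hb in
theorem commute_omega (hm : 0 < m) (x : EvenClifford b) : Commute x (omega b l e) := by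
  obtain ⟨P, _, f, G, hG, h, -⟩ := exists_generic b l e hb hm
  refine commute_of_gen b (fun v w t => ?_) x
  have key : ∀ i j, Commute (gen b (e i) (e j) (l 0)) (omega b l e) := by
    intro i j
    have h1 := (h (gen _ (Pi.single i 1) (Pi.single j 1) 1)).map (spec b f e (l 0) G hG)
    rw [spec_omega, spec, map_gen, specVec_single, specVec_single] at h1
    simpa [specLine] using h1
  have h1 : gen b v w t = ∑ i, ∑ j, (lineEquiv l t * e.repr v i * e.repr w j) •
      gen b (e i) (e j) (l 0) := by
    apply toClifford_injective b l
    simp only [map_sum, map_smul, toClifford_gen_self]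
    rw [toClifford_gen]
    conv_lhs => rw [← e.sum_repr v, ← e.sum_repr w]
    simp only [map_sum, map_smul, Finset.sum_mul_sum, Finset.smul_sum, smul_mul_smul_comm,
      smul_smul, mul_assoc]
  rw [h1]
  exact Commute.sum_left _ _ _ fun i _ => Commute.sum_left _ _ _ fun j _ => (key i j).smul_left _

include hb in
theorem omega_mul_self (hm : 0 < m) :
    omega b l e * omega b l e = algebraMap R _ (discr b l e) := by
  obtain ⟨P, _, f, G, hG, -, h⟩ := exists_generic b l e hb hm
  have h1 := congrArg (spec b f e (l 0) G hG) h
  rw [map_mul, spec_omega, spec, map_algebraMap] at h1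
  rw [h1]
  congr 1
  rw [discr, discr, gram_gramForm]
  simp only [map_mul, map_pow, map_intCast, map_natCast, RingHom.map_det]
  congr 2
  ext i j
  exact (hG i j).symm

/-- The algebra generated by all antisymmetrised products is spanned by `1` and `ω`. -/
theorem mem_adjoin_antisymm_iff (hb : ∀ v w, b v w = b w v) (hm : 0 < m) (z : EvenClifford b) :
    z ∈ Algebra.adjoin R (Set.range fun p : (Fin (2 * m) → E) × (Fin m → L) =>
        antisymm b p.1 p.2) ↔
      ∃ r s : R, z = algebraMap R _ r + s • omega b l e := by
  constructor
  · intro hz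
    induction hz using Algebra.adjoin_induction with
    | mem z hz =>
      obtain ⟨p, rfl⟩ := hz
      exact ⟨0, _, by rw [map_zero, zero_add]; exact antisymm_eq_smul_omega b l e p.1 p.2⟩
    | algebraMap r => exact ⟨r, 0, by simp⟩
    | add x y _ _ hx hy =>
      obtain ⟨r, s, rfl⟩ := hx
      obtain ⟨r', s', rfl⟩ := hy
      exact ⟨r + r', s + s', by rw [map_add, add_smul]; abel⟩
    | mul x y _ _ hx hy =>
      obtain ⟨r, s, rfl⟩ := hx
      obtain ⟨r', s', rfl⟩ := hy
      refine ⟨r * r' + s * s' * discr b l e, r * s' + s * r', ?_⟩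
      rw [add_mul, mul_add, mul_add, ← map_mul, smul_mul_smul_comm, omega_mul_self b hb l e hm,
        ← Algebra.smul_def, smul_mul_assoc, ← Algebra.commutes, ← Algebra.smul_def, map_add,
        map_mul _ (s * s'), Algebra.smul_def (s * s'), add_smul, smul_smul, smul_smul]
      abel
  · rintro ⟨r, s, rfl⟩
    have h : omega b l e ∈ Algebra.adjoin R (Set.range fun p : (Fin (2 * m) → E) × (Fin m → L) =>
        antisymm b p.1 p.2) := Algebra.subset_adjoin ⟨(e, fun _ => l 0), rfl⟩
    exact add_mem (Subalgebra.algebraMap_mem _ _) (Subalgebra.smul_mem _ h _)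

end EvenClifford

/-! ### Azumaya algebras generated by anticommuting units -/

section Azumaya

variable {Z A : Type*} [CommRing Z] [Ring A] [Algebra Z A] {N : ℕ} (g : Fin N → A)

/-- The product of all anticommuting elements but the `k`-th anticommutes with the `k`-th and
commutes with the others. -/
theorem boolProd_ne_mul (hN : Even N) (hg : ∀ i j, i ≠ j → g i * g j = -(g j * g i))
    (k i : Fin N) :
    boolProd g (fun j => decide (j ≠ k)) * g i =
      (if i = k then (-1 : ℤ) else 1) • (g i * boolProd g fun j => decide (j ≠ k)) := by
  have h1 : g i * boolProd g (fun j => decide (j ≠ k)) =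
      (∏ j : Fin N, if j = k then (1 : ℤ) else if j = i then 1 else -1) •
        (boolProd g (fun j => decide (j ≠ k)) * g i) := by
    refine mul_prod_ofFn_of_sign _ _ _ fun j => ?_
    by_cases hk : j = k
    · simp [hk]
    · by_cases hi : j = i
      · subst hi; simp [hk]
      · simp [hk, hi, hg i j (Ne.symm hi)]
  have h2 : (∏ j : Fin N, if j = k then (1 : ℤ) else if j = i then 1 else -1) =
      if i = k then (-1 : ℤ) else 1 := by
    have hN1 : 0 < N := i.pos
    by_cases hik : i = k
    · subst hik
      have : (fun j : Fin N => if j = i then (1 : ℤ) else if j = i then 1 else -1) =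
          fun j => if j = i then (1 : ℤ) else -1 := by
        ext j; split_ifs <;> rfl
      rw [this, prod_ite_neg_one, if_pos rfl, Odd.neg_one_pow]
      exact Nat.Even.sub_odd hN1 hN odd_one
    · rw [← Finset.mul_prod_erase _ _ (Finset.mem_univ k), if_pos rfl, one_mul,
        ← Finset.mul_prod_erase _ _ (Finset.mem_erase.2 ⟨hik, Finset.mem_univ i⟩), if_neg hik,
        if_neg hik, if_pos rfl, one_mul, Finset.prod_congr rfl (g := fun _ => (-1 : ℤ)),
        Finset.prod_const, Finset.card_erase_of_mem (by simp [hik]),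
        Finset.card_erase_of_mem (by simp), Finset.card_univ, Fintype.card_fin, Even.neg_one_pow]
      · obtain ⟨r, rfl⟩ := hN; exact ⟨r - 1, by omega⟩
      · intro j hj
        simp only [Finset.mem_erase] at hj
        rw [if_neg hj.2.1, if_neg hj.1]
  rw [h1, h2, smul_smul]
  split_ifs <;> simp

theorem isUnit_boolProd (hg : ∀ i, IsUnit (g i)) (ε : Fin N → Bool) : IsUnit (boolProd g ε) := by
  induction N with
  | zero => simp [boolProd]
  | succ n ih =>
    rw [boolProd_succ]
    refine IsUnit.mul ?_ (ih _ (fun i => hg _) _)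
    split
    · exact hg 0
    · exact isUnit_one

theorem List.prod_apply_of_eigen {M : Type*} [AddCommGroup M] [Module Z M] {n : ℕ}
    (p : Fin n → Module.End Z M) (c : Fin n → Z) (x : M) (h : ∀ i, p i x = c i • x) :
    (List.ofFn p).prod x = (∏ i, c i) • x := by
  induction n with
  | zero => simp
  | succ n ih =>
    rw [List.ofFn_succ, List.prod_cons, Module.End.mul_apply, ih _ _ fun i => h i.succ, map_smul,
      h 0, smul_smul, Fin.prod_univ_succ, mul_comm]

/-- If the ordered products of an even number of anticommuting units span an algebra, every
endomorphism is a sum of two-sided multiplications: the conjugations by the products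
of all but one of the units act on the ordered products by signs which separate them. -/
theorem mulLeftRight_surjective_of_anticommuting [Invertible (2 : Z)] (hN : Even N)
    (hg : ∀ i j, i ≠ j → g i * g j = -(g j * g i)) (hu : ∀ i, IsUnit (g i))
    (hspan : Submodule.span Z (Set.range (boolProd g)) = ⊤) :
    Function.Surjective (AlgHom.mulLeftRight Z A) := by
  let T := (AlgHom.mulLeftRight Z A).range
  have hL : ∀ a : A, LinearMap.mulLeft Z a ∈ T := fun a =>
    ⟨a ⊗ₜ 1, by ext x; simp⟩
  -- the conjugation by the product of all `g j`, `j ≠ k`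
  have hc : ∀ k, ∃ c ∈ T, ∀ ε, c (boolProd g ε) = (if ε k then (-1 : Z) else 1) • boolProd g ε := by
    intro k
    obtain ⟨u, hu'⟩ := isUnit_boolProd g hu fun j => decide (j ≠ k)
    refine ⟨_, ⟨(u : A) ⊗ₜ MulOpposite.op ((u⁻¹ : Aˣ) : A), rfl⟩, fun ε => ?_⟩
    have h1 : (u : A) * boolProd g ε =
        (∏ i, if i = k then (if ε i then (-1 : ℤ) else 1) else 1) • (boolProd g ε * u) := by
      refine mul_prod_ofFn_of_sign _ _ _ fun i => ?_
      have h2 := boolProd_ne_mul g hN hg k i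
      rw [← hu'] at h2
      by_cases hi : ε i <;> by_cases hk : i = k <;> simp [hi, hk] at h2 ⊢
      all_goals first | exact h2 | (subst hk; simp [hi, h2])
    rw [Finset.prod_ite_eq' Finset.univ k, if_pos (Finset.mem_univ k)] at h1
    change AlgHom.mulLeftRight Z A (_ ⊗ₜ _) _ = _
    rw [AlgHom.mulLeftRight_apply, h1]
    split_ifs <;> simp
  choose c hcT hc using hc
  -- the projection to the line of an ordered product
  let π : (Fin N → Bool) → Module.End Z A := fun J =>
    (List.ofFn fun k => ⅟(2 : Z) • (1 + (if J k then (-1 : Z) else 1) • c k)).prod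
  have hπT : ∀ J, π J ∈ T := fun J => Subalgebra.list_prod_mem _ fun x hx => by
    obtain ⟨k, rfl⟩ := (List.mem_ofFn' _ _).1 hx
    exact T.smul_mem (T.add_mem T.one_mem (T.smul_mem (hcT k) _)) _
  have hπ : ∀ J K, π J (boolProd g K) = if J = K then boolProd g K else 0 := by
    intro J K
    have h1 := List.prod_apply_of_eigen
      (fun k => ⅟(2 : Z) • (1 + (if J k then (-1 : Z) else 1) • c k))
      (fun k => if J k = K k then (1 : Z) else 0) (boolProd g K) (fun k => by
        have h2 : (⅟2 : Z) * (1 + 1) = 1 := by rw [one_add_one_eq_two, invOf_mul_self]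
        simp only [LinearMap.smul_apply, LinearMap.add_apply, Module.End.one_apply, hc]
        rw [smul_smul, ← one_smul Z (boolProd g K), smul_smul, smul_smul, ← add_smul, smul_smul]
        congr 1
        cases J k <;> cases K k <;> simp [h2])
    refine h1.trans ?_
    split_ifs with h
    · subst h; simp
    · obtain ⟨k, hk⟩ := Function.ne_iff.1 h
      rw [Finset.prod_eq_zero (Finset.mem_univ k) (if_neg hk), zero_smul]
  intro f
  have hf : f = ∑ J, LinearMap.mulLeft Z
      (f (boolProd g J) * ((isUnit_boolProd g hu J).unit⁻¹ : Aˣ)) * π J := by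
    refine LinearMap.ext_on hspan ?_
    rintro _ ⟨K, rfl⟩
    rw [LinearMap.sum_apply, Finset.sum_eq_single K]
    · rw [Module.End.mul_apply, hπ, if_pos rfl, LinearMap.mulLeft_apply, mul_assoc]
      simp
    · intro J _ hJ
      rw [Module.End.mul_apply, hπ, if_neg hJ, map_zero]
    · simp
  have : f ∈ T := by
    rw [hf]
    exact T.sum_mem fun J _ => T.mul_mem (hL _) (hπT J)
  exact this

/-- A surjective linear map between finite free modules of the same rank is bijective. -/
theorem bijective_of_surjective_of_card_eq {M M' ι κ : Type*} [AddCommGroup M] [Module Z M]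
    [AddCommGroup M'] [Module Z M'] [Fintype ι] [Fintype κ] (b : Module.Basis ι Z M)
    (b' : Module.Basis κ Z M') (h : Fintype.card ι = Fintype.card κ) (f : M →ₗ[Z] M')
    (hf : Function.Surjective f) : Function.Bijective f := by
  let e : M' ≃ₗ[Z] M := b'.equiv b (Fintype.equivOfCardEq h.symm)
  have : Module.Finite Z M := Module.Finite.of_basis b
  have h1 : Function.Injective (e.toLinearMap ∘ₗ f) :=
    OrzechProperty.injective_of_surjective_endomorphism _ (e.surjective.comp hf)
  exact ⟨fun x y hxy => h1 (congrArg e hxy), hf⟩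

/-- An algebra with a basis of products of an even number of anticommuting units is Azumaya: left and
right multiplications generate all endomorphisms, and both sides of `A ⊗ Aᵒᵖ → End A` are free of the
same rank. -/
theorem isAzumaya_of_anticommuting [Invertible (2 : Z)] (hN : Even N)
    (hg : ∀ i j, i ≠ j → g i * g j = -(g j * g i)) (hu : ∀ i, IsUnit (g i))
    (bas : Module.Basis (Fin N → Bool) Z A) (hbas : ∀ ε, bas ε = boolProd g ε) :
    IsAzumaya Z A := by
  have hbas' : ⇑bas = boolProd g := funext hbas
  have : Module.Free Z A := Module.Free.of_basis bas
  have : Module.Finite Z A := Module.Finite.of_basis bas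
  have hinj : Function.Injective (algebraMap Z A) := by
    have h1 : bas (fun _ => false) = 1 := by rw [hbas]; simp [boolProd]
    intro r s h
    rw [Algebra.algebraMap_eq_smul_one, Algebra.algebraMap_eq_smul_one, ← h1] at h
    simpa using congrArg (fun x => bas.repr x fun _ => false) h
  have hf : FaithfulSMul Z A := (faithfulSMul_iff_algebraMap_injective Z A).2 hinj
  have hs := mulLeftRight_surjective_of_anticommuting g hN hg hu (by rw [← hbas', bas.span_eq])
  let bop : Module.Basis (Fin N → Bool) Z Aᵐᵒᵖ := bas.map (MulOpposite.opLinearEquiv Z)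
  have hb := bijective_of_surjective_of_card_eq (bas.tensorProduct bop) bas.end
    (by simp) (AlgHom.mulLeftRight Z A).toLinearMap hs
  exact { bij := hb }

end Azumaya

/-! ### The even Clifford algebra over its centre, away from corank two -/

namespace EvenClifford

section

variable {R E L : Type u} [CommRing R] [AddCommGroup E] [Module R E] [AddCommGroup L] [Module R L]
  (b : E →ₗ[R] E →ₗ[R] L →ₗ[R] R)

theorem gen_add_gen_swap (hb : ∀ v w, b v w = b w v) (v w : E) (l : L) :
    gen b v w l + gen b w v l = algebraMap R _ (2 * b v w l) := by
  have h := gen_contract b (v + w) l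
  have h1 : gen b (v + w) (v + w) l =
      gen b v v l + gen b v w l + (gen b w v l + gen b w w l) := by
    simp [gen, TensorProduct.add_tmul, TensorProduct.tmul_add]
    abel
  rw [h1, gen_contract, gen_contract] at h
  simp only [map_add, LinearMap.add_apply, hb w v] at h
  rw [two_mul, map_add]
  rw [← sub_eq_zero] at h ⊢
  rw [← h]
  abel

theorem gen_swap_of_orthogonal (hb : ∀ v w, b v w = b w v) {v w : E} {l : L} (h : b v w l = 0) :
    gen b v w l = -gen b w v l := by
  rw [eq_neg_iff_add_eq_zero, gen_add_gen_swap b hb, h, mul_zero, map_zero]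

/-- For vectors `v`, `v'` orthogonal to `w`, the elements `v w` and `v' w` multiply like `v` and
`v'`, up to the norm of `w`. -/
theorem gen_mul_gen_of_orthogonal (hb : ∀ v w, b v w = b w v) {v v' w : E} {l : L}
    (h' : b v' w l = 0) : gen b v w l * gen b v' w l = -(b w w l • gen b v v' l) := by
  rw [gen_swap_of_orthogonal b hb h', mul_neg, gen_contract_mid]

theorem prod_ι_mul_ι (l : Module.Basis (Fin 1) R L) {k : ℕ} (v : Fin k → E) (w : E)
    (h : ∀ i, CliffordAlgebra.ι (lineForm b l) (v i) * CliffordAlgebra.ι _ w =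
      -(CliffordAlgebra.ι _ w * CliffordAlgebra.ι _ (v i))) :
    ∃ s : ℤˣ, (List.ofFn fun i => CliffordAlgebra.ι (lineForm b l) (v i) *
        CliffordAlgebra.ι (lineForm b l) w).prod =
      (s : ℤ) • ((List.ofFn fun i => CliffordAlgebra.ι (lineForm b l) (v i)).prod *
        CliffordAlgebra.ι (lineForm b l) w ^ k) := by
  induction k with
  | zero => exact ⟨1, by simp⟩
  | succ k ih =>
    obtain ⟨s, hs⟩ := ih (fun i => v i.succ) fun i => h i.succ
    have h1 := mul_prod_ofFn_of_sign (fun i : Fin k => CliffordAlgebra.ι (lineForm b l) (v i.succ))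
      (CliffordAlgebra.ι (lineForm b l) w) (fun _ => -1) fun i => by simp [h i.succ]
    rw [Finset.prod_const, Finset.card_univ, Fintype.card_fin] at h1
    refine ⟨s * (-1) ^ k, ?_⟩
    rw [List.ofFn_succ, List.prod_cons, hs, List.ofFn_succ, List.prod_cons, mul_smul_comm,
      mul_assoc, ← mul_assoc (CliffordAlgebra.ι _ w), h1, smul_mul_assoc, mul_smul_comm, smul_smul,
      pow_succ' _ k]
    simp only [mul_assoc, Units.val_mul, Units.val_pow_eq_pow_val, Units.val_neg, Units.val_one]

end

/-- A product of elements with invertible scalar squares divides an invertible scalar. -/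
theorem exists_mul_prod_eq {R A : Type*} [CommRing R] [Ring A] [Algebra R A] {n : ℕ}
    (g : Fin n → A) (hg : ∀ i, ∃ c : Rˣ, g i * g i = algebraMap R A c) (T : Submodule R A)
    (hT : ∀ i, ∀ x ∈ T, g i * x ∈ T) (y : A) (hy : (List.ofFn g).prod * y ∈ T) : y ∈ T := by
  induction n with
  | zero => simpa using hy
  | succ n ih =>
    rw [List.ofFn_succ, List.prod_cons] at hy
    refine ih _ (fun i => hg i.succ) (fun i => hT i.succ) ?_
    obtain ⟨c, hc⟩ := hg 0
    have h1 := T.smul_mem ((c⁻¹ : Rˣ) : R) (hT 0 _ hy)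
    rwa [← mul_assoc, ← mul_assoc, hc, Algebra.algebraMap_eq_smul_one, smul_mul_assoc, one_mul,
      smul_mul_assoc, smul_smul, Units.inv_mul, one_smul] at h1

variable {R E L : Type u} [CommRing R] [AddCommGroup E] [Module R E]
  [AddCommGroup L] [Module R L]
  (b : E →ₗ[R] E →ₗ[R] L →ₗ[R] R) (hb : ∀ v w, b v w = b w v)
  (l : Module.Basis (Fin 1) R L) {r : ℕ} (e : Module.Basis (Fin (2 * (r + 1))) R E)

/-- The generators `e j * e (n - 2)`, `j < n - 2`, of the even Clifford algebra of a form of rank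
`n = 2 (r + 1)` over its centre. -/
def centralGen (j : Fin (2 * r)) : EvenClifford b :=
  gen b (e j.castSucc.castSucc) (e (Fin.last (2 * r)).castSucc) (l 0)

variable (ho : ∀ i j, i ≠ j → b (e i) (e j) (l 0) = 0)
  (hu : ∀ i : Fin (2 * r + 1), IsUnit (b (e i.castSucc) (e i.castSucc) (l 0)))

include hb ho in
theorem centralGen_anticomm (i j : Fin (2 * r)) (hij : i ≠ j) :
    centralGen b l e i * centralGen b l e j = -(centralGen b l e j * centralGen b l e i) := by
  rw [centralGen, centralGen, gen_mul_gen_of_orthogonal b hb, gen_mul_gen_of_orthogonal b hb,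
    gen_swap_of_orthogonal b hb, smul_neg]
  · exact ho _ _ (by simpa [Fin.ext_iff] using hij)
  · exact ho _ _ (by simp [Fin.ext_iff]; omega)
  · exact ho _ _ (by simp [Fin.ext_iff]; omega)

include hb ho hu in
theorem centralGen_sq (i : Fin (2 * r)) :
    ∃ c : Rˣ, centralGen b l e i * centralGen b l e i = algebraMap R _ c := by
  rw [centralGen, gen_mul_gen_of_orthogonal b hb, gen_contract, Algebra.smul_def, ← map_mul,
    ← map_neg]
  · exact ⟨((hu (Fin.last _)).mul (hu i.castSucc)).neg.unit, rfl⟩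
  · exact ho _ _ (by simp [Fin.ext_iff]; omega)

/-- Scalars from `R` act through the subalgebra `R + R ω`, which is the image of `Z`. -/
theorem smul_mem_of_centre {Z : Type*} [CommRing Z] [Algebra Z (EvenClifford b)]
    (hZ : ∀ x : EvenClifford b, x ∈ (algebraMap Z (EvenClifford b)).range ↔
      ∃ r s : R, x = algebraMap R _ r + s • omega b l e)
    (T : Submodule Z (EvenClifford b)) (c : R) {x : EvenClifford b}
    (hx : x ∈ T) : c • x ∈ T := by
  obtain ⟨z, hz⟩ := (hZ (algebraMap R _ c)).2 ⟨c, 0, by simp⟩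
  rw [Algebra.smul_def, ← hz, ← Algebra.smul_def]
  exact T.smul_mem z hx

variable [Algebra ℚ R]

include hb ho hu in
/-- Up to a unit, `ω` is the product of the central generators and `e (n - 1) * e (n - 2)`. Thus the
one even product of two basis vectors that is not visibly generated by the `centralGen` is recovered
from the centre, even where the norm of the last basis vector `e (n - 1)` is not invertible. -/
theorem omega_eq_smul_prod_centralGen : ∃ c : Rˣ,
    (List.ofFn (centralGen b l e)).prod *
      gen b (e (Fin.last _)) (e (Fin.last (2 * r)).castSucc) (l 0) = (c : R) • omega b l e := by
  let _ : Invertible (2 : R) := (Invertible.map (algebraMap ℚ R) 2).copy _ (map_ofNat _ 2).symm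
  obtain ⟨s, hs⟩ := prod_ι_mul_ι b l (fun j : Fin (2 * r) => e j.castSucc.castSucc)
    (e (Fin.last (2 * r)).castSucc) fun i => ι_mul_ι_of_orthogonal b hb l
      (ho _ _ (by simp [Fin.ext_iff]; omega))
  obtain ⟨N, hN⟩ := isUnit_natCast_factorial R (2 * (r + 1))
  obtain ⟨q, hq⟩ := hu (Fin.last _)
  refine ⟨N⁻¹ * q ^ r * -(Units.map (Int.castRingHom R).toMonoidHom s), ?_⟩
  apply toClifford_injective b l
  rw [map_smul, toClifford_omega_of_orthogonal b l e (Nat.succ_pos r) hb ho, map_mul,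
    toClifford_gen_self, map_list_prod, List.map_ofFn]
  have h1 : (toClifford b l ∘ centralGen b l e) = fun j : Fin (2 * r) =>
      CliffordAlgebra.ι (lineForm b l) (e j.castSucc.castSucc) *
        CliffordAlgebra.ι (lineForm b l) (e (Fin.last (2 * r)).castSucc) := by
    ext j
    exact toClifford_gen_self b l _ _
  have h2 : (List.ofFn fun i : Fin (2 * (r + 1)) =>
      CliffordAlgebra.ι (lineForm b l) (e i)).prod =
      (List.ofFn fun j : Fin (2 * r) =>
        CliffordAlgebra.ι (lineForm b l) (e j.castSucc.castSucc)).prod *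
        (CliffordAlgebra.ι (lineForm b l) (e (Fin.last (2 * r)).castSucc) *
          CliffordAlgebra.ι (lineForm b l) (e (Fin.last _))) := by
    have h3 := List.ofFn_succ' (fun i : Fin (2 * r + 2) =>
      CliffordAlgebra.ι (lineForm b l) (e i))
    rw [List.ofFn_succ' fun i : Fin (2 * r + 1) =>
      CliffordAlgebra.ι (lineForm b l) (e i.castSucc)] at h3
    change (List.ofFn (fun i : Fin (2 * r + 2) => CliffordAlgebra.ι (lineForm b l) (e i))).prod = _
    rw [h3]
    simp [List.concat_eq_append]
  have h4 : CliffordAlgebra.ι (lineForm b l) (e (Fin.last (2 * r)).castSucc) ^ (2 * r) =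
      algebraMap R _ ((q : R) ^ r) := by
    rw [pow_mul, pow_two, CliffordAlgebra.ι_sq_scalar, lineForm_apply, ← hq, map_pow]
  have h5 : CliffordAlgebra.ι (lineForm b l) (e (Fin.last _)) *
      CliffordAlgebra.ι (lineForm b l) (e (Fin.last (2 * r)).castSucc) =
        -(CliffordAlgebra.ι (lineForm b l) (e (Fin.last (2 * r)).castSucc) *
          CliffordAlgebra.ι (lineForm b l) (e (Fin.last _))) :=
    ι_mul_ι_of_orthogonal b hb l (ho _ _ (by simp [Fin.ext_iff]))
  rw [h1, hs, h2, h4, h5, ← hN]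
  set P := (List.ofFn fun j : Fin (2 * r) =>
        CliffordAlgebra.ι (lineForm b l) (e j.castSucc.castSucc)).prod
  set y := CliffordAlgebra.ι (lineForm b l) (e (Fin.last (2 * r)).castSucc) *
          CliffordAlgebra.ι (lineForm b l) (e (Fin.last _))
  rw [← Algebra.commutes, ← Algebra.smul_def, smul_smul, smul_mul_assoc, smul_mul_assoc, mul_neg,
    ← Int.cast_smul_eq_zsmul R, smul_smul, smul_neg, ← neg_smul]
  congr 1
  have : ((N⁻¹ : Rˣ) : R) * N = 1 := N.inv_mul
  simp only [Units.val_mul, Units.val_neg, Units.val_pow_eq_pow_val, Units.coe_map]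
  change _ = _ * -((s : ℤ) : R) * (N : R)
  linear_combination (((s : ℤ) : R) * (q : R) ^ r) * this

section Central

variable {Z : Type*} [CommRing Z] [Algebra Z (EvenClifford b)]
  (hZ : ∀ x : EvenClifford b, x ∈ (algebraMap Z (EvenClifford b)).range ↔
    ∃ r s : R, x = algebraMap R _ r + s • omega b l e)

include hb ho hu hZ in
/-- The generators span the even Clifford algebra over its centre. The one missing element
`e (n - 1) * e (n - 2)` comes from the antisymmetrised product, which is central. -/
theorem span_boolProd_centralGen :
    Submodule.span Z (Set.range (boolProd (centralGen b l e))) = ⊤ := by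
  let _ : Invertible (2 : R) := (Invertible.map (algebraMap ℚ R) 2).copy _ (map_ofNat _ 2).symm
  set T := Submodule.span Z (Set.range (boolProd (centralGen b l e)))
  have hsm := fun (c : R) (x : EvenClifford b) (hx : x ∈ T) =>
    smul_mem_of_centre b l e hZ T c hx
  let TR : Submodule R (EvenClifford b) :=
    { T with smul_mem' := fun c x hx => hsm c x hx }
  have hT : ∀ j, ∀ x ∈ T, centralGen b l e j * x ∈ T := by
    refine fun j x hx => mul_mem_span_boolProd _ (fun i j => ?_) (fun i => ?_) j hx
    · by_cases hij : i = j
      · subst hij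
        obtain ⟨c, hc⟩ := centralGen_sq b hb l e ho hu i
        obtain ⟨z, hz⟩ := (hZ (algebraMap R _ (c + c))).2 ⟨c + c, 0, by simp⟩
        exact ⟨z, by rw [hz, hc, map_add]⟩
      · exact ⟨0, by rw [map_zero, centralGen_anticomm b hb l e ho i j hij, neg_add_cancel]⟩
    · obtain ⟨c, hc⟩ := centralGen_sq b hb l e ho hu i
      obtain ⟨z, hz⟩ := (hZ (algebraMap R _ c)).2 ⟨c, 0, by simp⟩
      exact ⟨z, by rw [hz, hc]⟩
  -- multiplication by `e j * e (n - 2)`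
  have ha : ∀ j, ∀ x ∈ T, gen b (e j) (e (Fin.last (2 * r)).castSucc) (l 0) * x ∈ T := by
    intro j x hx
    refine Fin.lastCases (n := 2 * r + 1) ?_ (fun i => Fin.lastCases ?_ (fun i => ?_) i) j
    · -- The last basis vector: the product of the central generators is invertible, so it can be
      -- cancelled from the expression for `ω`.
      obtain ⟨c, hc⟩ := omega_eq_smul_prod_centralGen b hb l e ho hu
      refine exists_mul_prod_eq (centralGen b l e) (centralGen_sq b hb l e ho hu) TR hT _ ?_
      change _ * (gen b (e (Fin.last _)) _ _ * x) ∈ T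
      rw [← mul_assoc]
      change (List.ofFn (centralGen b l e)).prod *
        gen b (e (Fin.last _)) (e (Fin.last (2 * r)).castSucc) (l 0) * x ∈ T
      rw [hc, smul_mul_assoc]
      refine hsm _ _ ?_
      obtain ⟨z, hz⟩ := (hZ (omega b l e)).2 ⟨0, 1, by simp⟩
      rw [← hz, ← Algebra.smul_def]
      exact T.smul_mem z hx
    · rw [gen_contract, ← Algebra.smul_def]
      exact hsm _ _ hx
    · exact hT i x hx
  have hb' : ∀ j, ∀ x ∈ T, gen b (e (Fin.last (2 * r)).castSucc) (e j) (l 0) * x ∈ T := by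
    intro j x hx
    rw [eq_sub_of_add_eq (gen_add_gen_swap b hb (e (Fin.last (2 * r)).castSucc) (e j) (l 0)),
      sub_mul, ← Algebra.smul_def]
    exact sub_mem (hsm _ _ hx) (ha j x hx)
  have hgen : ∀ i j, ∀ x ∈ T, gen b (e i) (e j) (l 0) * x ∈ T := by
    intro i j x hx
    -- `(e i * w) * (w * e j) = q (e i * e j)` for `w = e (n - 2)` of invertible norm `q`
    obtain ⟨q, hq⟩ := hu (Fin.last _)
    have h1 := ha i _ (hb' j x hx)
    rw [← mul_assoc, gen_contract_mid, smul_mul_assoc] at h1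
    have h2 := hsm ((q⁻¹ : Rˣ) : R) _ h1
    rwa [smul_smul, ← hq, Units.inv_mul, one_smul] at h2
  have hlist : ∀ t : List (Fin (2 * (r + 1))), genList b (l 0) (t.map e) ∈ T := by
    intro t
    induction t using List.twoStepInduction with
    | nil => exact one_mem_span_boolProd _
    | singleton _ => exact one_mem_span_boolProd _
    | cons_cons i j t ih _ => exact hgen i j _ ih
  have hTR : TR = ⊤ := by
    rw [eq_top_iff, ← (evenBasis b l e).span_eq, Submodule.span_le]
    rintro _ ⟨ε, rfl⟩
    rw [evenBasis_apply]
    exact hlist _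
  rw [eq_top_iff]
  intro x _
  exact (hTR ▸ Submodule.mem_top : x ∈ TR)

include hb ho hu hZ in
/-- The products of the central generators form a basis over `Z = R + R ω`. There are `2 ^ (n - 2)` of
them, so together with their multiples by `ω` they are a spanning family over `R` of size
`2 ^ (n - 1)`, the rank of the even Clifford algebra, and are therefore independent. -/
theorem exists_basis_over_centre (hinj : Function.Injective (algebraMap Z (EvenClifford b))) :
    ∃ bas : Module.Basis (Fin (2 * r) → Bool) Z (EvenClifford b),
      ∀ ε, bas ε = boolProd (centralGen b l e) ε := by
  let _ : Invertible (2 : R) := (Invertible.map (algebraMap ℚ R) 2).copy _ (map_ofNat _ 2).symm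
  have hspan := span_boolProd_centralGen b hb l e ho hu hZ
  -- over `R`, the products and their multiples by `ω` form a basis
  let v : (Fin (2 * r) → Bool) ⊕ (Fin (2 * r) → Bool) → EvenClifford b :=
    Sum.elim (boolProd (centralGen b l e)) fun J => omega b l e * boolProd (centralGen b l e) J
  have hv : Submodule.span R (Set.range v) = ⊤ := by
    rw [eq_top_iff]
    intro x _
    have hx : x ∈ Submodule.span Z (Set.range (boolProd (centralGen b l e))) :=
      hspan ▸ Submodule.mem_top
    rw [Submodule.mem_span_range_iff_exists_fun] at hx
    obtain ⟨z, rfl⟩ := hx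
    refine Submodule.sum_mem _ fun J _ => ?_
    obtain ⟨r, s, hrs⟩ := (hZ (algebraMap Z _ (z J))).1 ⟨_, rfl⟩
    rw [Algebra.smul_def, hrs, add_mul, smul_mul_assoc, ← Algebra.smul_def]
    exact add_mem (Submodule.smul_mem _ _ (Submodule.subset_span ⟨Sum.inl J, rfl⟩))
      (Submodule.smul_mem _ _ (Submodule.subset_span ⟨Sum.inr J, rfl⟩))
  have hli := linearIndependent_of_span_eq_top_of_card_eq (evenBasis b l e) v hv (by
    rw [show 2 * (r + 1) = (2 * r + 1) + 1 by ring, card_evenBool]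
    simp [pow_succ]
    ring)
  refine ⟨Module.Basis.mk (v := boolProd (centralGen b l e)) ?_ hspan.ge, fun ε => Module.Basis.mk_apply _ _ _⟩
  rw [Fintype.linearIndependent_iff]
  intro z hz J
  have h1 : ∀ J, ∃ r s : R, algebraMap Z _ (z J) = algebraMap R _ r + s • omega b l e :=
    fun J => (hZ (algebraMap Z _ (z J))).1 ⟨_, rfl⟩
  choose c d hcd using h1
  have h2 : ∑ i, Sum.elim c d i • v i = 0 := by
    rw [Fintype.sum_sum_type, ← Finset.sum_add_distrib, ← hz]
    refine Finset.sum_congr rfl fun J _ => ?_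
    rw [Algebra.smul_def (z J), hcd, add_mul, smul_mul_assoc, ← Algebra.smul_def]
    rfl
  have h3 := Fintype.linearIndependent_iff.1 hli _ h2
  apply hinj
  rw [hcd, show c J = 0 from h3 (Sum.inl J), show d J = 0 from h3 (Sum.inr J)]
  simp

end Central

end EvenClifford

/-! ### Diagonalising a form near a point of corank at most one -/

namespace EvenClifford

section

variable {R E L K : Type*} [CommRing R] [AddCommGroup E] [Module R E] [AddCommGroup L] [Module R L]
  [Field K] (b : E →ₗ[R] E →ₗ[R] L →ₗ[R] R) (π : R →+* K)

/-- One step of the Gram–Schmidt process without denominators. The family `f` is orthogonal modulo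
the kernel of `π`, and stays so. -/
theorem gramSchmidt_step (hb : ∀ v w, b v w = b w v) (t : L) {n : ℕ}
    (e : Module.Basis (Fin (n + 1)) R E) (k : ℕ) (hk : k < n) (f : Fin (n + 1) → E)
    (h1 : π (e.det f) ≠ 0) (h2 : ∀ i : Fin n, π (b (f i.castSucc) (f i.castSucc) t) ≠ 0)
    (h3 : ∀ i j, i ≠ j → π (b (f i) (f j) t) = 0)
    (h4 : ∀ i j : Fin (n + 1), i ≠ j → (i : ℕ) < k → b (f i) (f j) t = 0) :
    ∃ f : Fin (n + 1) → E, π (e.det f) ≠ 0 ∧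
      (∀ i : Fin n, π (b (f i.castSucc) (f i.castSucc) t) ≠ 0) ∧
      (∀ i j, i ≠ j → π (b (f i) (f j) t) = 0) ∧
      ∀ i j : Fin (n + 1), i ≠ j → (i : ℕ) < k + 1 → b (f i) (f j) t = 0 := by
  let κ : Fin (n + 1) := ⟨k, by omega⟩
  let d := b (f κ) (f κ) t
  have hd : π d ≠ 0 := h2 ⟨k, hk⟩
  let c : Fin (n + 1) → R := fun j => if (j : ℕ) ≤ k then 1 else d
  let a : Fin (n + 1) → R := fun j => if (j : ℕ) ≤ k then 0 else b (f j) (f κ) t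
  have hc : ∀ j, π (c j) ≠ 0 := by
    intro j
    simp only [c]
    split_ifs <;> simp [hd]
  have ha : ∀ j, π (a j) = 0 := by
    intro j
    simp only [a]
    split_ifs with h
    · simp
    · exact h3 _ _ fun h' => h (by rw [h'])
  let g : Fin (n + 1) → E := fun j => c j • f j - a j • f κ
  have hg : ∀ i j, b (g i) (g j) t = c i * c j * b (f i) (f j) t - c i * a j * b (f i) (f κ) t -
      a i * c j * b (f j) (f κ) t + a i * a j * d := by
    intro i j
    simp only [g, map_sub, map_smul, LinearMap.sub_apply, LinearMap.smul_apply, smul_eq_mul, d,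
      hb (f κ) (f j)]
    ring
  have hgπ : ∀ i j, π (b (g i) (g j) t) = π (c i) * π (c j) * π (b (f i) (f j) t) := by
    intro i j
    rw [hg]
    simp [ha]
  refine ⟨g, ?_, fun i => ?_, fun i j hij => ?_, fun i j hij hi => ?_⟩
  · have : π (e.det g) = (∏ j, π (c j)) * π (e.det f) := by
      rw [Module.Basis.det_apply, Module.Basis.det_apply, RingHom.map_det, RingHom.map_det,
        ← Matrix.det_mul_row]
      congr 1
      ext i j
      simp [Module.Basis.toMatrix_apply, g, ha]
    rw [this]
    exact mul_ne_zero (Finset.prod_ne_zero_iff.2 fun j _ => hc j) h1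
  · rw [hgπ]
    exact mul_ne_zero (mul_ne_zero (hc _) (hc _)) (h2 i)
  · rw [hgπ, h3 i j hij, mul_zero]
  · have hai : a i = 0 := if_pos (by omega)
    have hci : c i = 1 := if_pos (by omega)
    rw [hg, hai, hci]
    rcases Nat.lt_succ_iff_lt_or_eq.1 hi with hi | hi
    · have h5 : b (f i) (f κ) t = 0 := h4 i κ (fun h => by rw [h] at hi; simp [κ] at hi) hi
      rw [h4 i j hij hi, h5]
      ring
    · have hiκ : i = κ := Fin.ext hi
      subst hiκ
      by_cases hj : (j : ℕ) ≤ k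
      · have hj' : (j : ℕ) < k := lt_of_le_of_ne hj fun h => hij (Fin.ext (hi.trans h.symm))
        have : b (f κ) (f j) t = 0 := by rw [hb]; exact h4 j κ (Ne.symm hij) hj'
        simp [a, hj, this]
      · simp only [a, c, if_neg hj, d, hb (f κ) (f j)]
        ring

theorem form_eq_sum (b : E →ₗ[R] E →ₗ[R] L →ₗ[R] R) (t : L) {n : ℕ} (e : Module.Basis (Fin n) R E) (v w : E) :
    b v w t = ∑ i, ∑ j, e.repr v i * b (e i) (e j) t * e.repr w j := by
  conv_lhs => rw [← e.sum_repr v, ← e.sum_repr w]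
  simp only [map_sum, map_smul, LinearMap.sum_apply, LinearMap.smul_apply, smul_eq_mul]
  rw [Finset.sum_comm]
  refine Finset.sum_congr rfl fun i _ => ?_
  rw [Finset.mul_sum]
  refine Finset.sum_congr rfl fun j _ => ?_
  ring

/-- A symmetric matrix with a nonzero minor of size one less can be diagonalised over a field with
at most the last diagonal entry zero. -/
theorem exists_orthogonal_basis_of_minor [Invertible (2 : K)] {n : ℕ}
    (B : LinearMap.BilinForm K (Fin (n + 1) → K)) (hB : ∀ v w, B v w = B w v)
    (v w : Fin n → Fin (n + 1) → K) (t : Fin n → K)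
    (h : (Matrix.of fun i j => B (v i) (w j) * t j).det ≠ 0) :
    ∃ f : Module.Basis (Fin (n + 1)) K (Fin (n + 1) → K), (∀ i j, i ≠ j → B (f i) (f j) = 0) ∧
      ∀ i : Fin n, B (f i.castSucc) (f i.castSucc) ≠ 0 := by
  classical
  obtain ⟨f₀, hf₀⟩ := LinearMap.BilinForm.exists_orthogonal_basis (V := Fin (n + 1) → K) (K := K)
    (B := B) ⟨hB⟩
  have hr : Module.finrank K (Fin (n + 1) → K) = n + 1 := by simp
  obtain ⟨f, hf⟩ : ∃ f : Module.Basis (Fin (n + 1)) K (Fin (n + 1) → K),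
      ∀ i j, i ≠ j → B (f i) (f j) = 0 := by
    refine ⟨f₀.reindex (finCongr hr), fun i j hij => ?_⟩
    rw [Module.Basis.reindex_apply, Module.Basis.reindex_apply]
    exact hf₀ (by simpa using hij)
  let d : Fin (n + 1) → K := fun i => B (f i) (f i)
  have hM : (Matrix.of fun i j => B (v i) (w j) * t j) =
      (Matrix.of fun i a => f.repr (v i) a) * Matrix.diagonal d *
        ((Matrix.of fun a j => f.repr (w j) a) * Matrix.diagonal t) := by
    ext i j
    rw [← Matrix.mul_assoc, Matrix.mul_diagonal, Matrix.mul_apply]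
    simp only [Matrix.mul_diagonal, Matrix.of_apply]
    congr 1
    conv_lhs => rw [← f.sum_repr (v i), ← f.sum_repr (w j)]
    simp only [map_sum, map_smul, LinearMap.sum_apply, LinearMap.smul_apply, smul_eq_mul]
    refine Finset.sum_congr rfl fun a _ => ?_
    rw [Finset.sum_eq_single a]
    · simp only [d]; ring
    · intro c _ hc
      rw [hf c a hc]; ring
    · simp
  have hrank : n ≤ Fintype.card {i // d i ≠ 0} := by
    have h1 := Matrix.rank_of_isUnit _ ((Matrix.isUnit_iff_isUnit_det _).2 (IsUnit.mk0 _ h))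
    rw [Fintype.card_fin] at h1
    rw [← Matrix.rank_diagonal]
    refine h1.symm.le.trans ?_
    rw [hM]
    exact (Matrix.rank_mul_le_left _ _).trans (Matrix.rank_mul_le_right _ _)
  obtain ⟨i₀, hi₀⟩ : ∃ i₀, ∀ i, i ≠ i₀ → d i ≠ 0 := by
    by_cases hz : ∃ i₀, d i₀ = 0
    · obtain ⟨i₀, hz⟩ := hz
      refine ⟨i₀, fun i hi hdi => ?_⟩
      rw [Fintype.card_subtype] at hrank
      have h2 : (Finset.univ.filter fun i => d i ≠ 0) ⊆ (Finset.univ.erase i₀).erase i := by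
        intro j hj
        simp only [Finset.mem_filter, Finset.mem_univ, true_and] at hj
        simp only [Finset.mem_erase, Finset.mem_univ, and_true]
        exact ⟨fun h => hj (h ▸ hdi), fun h => hj (h ▸ hz)⟩
      have h3 := Finset.card_le_card h2
      rw [Finset.card_erase_of_mem (by simp [hi]), Finset.card_erase_of_mem (by simp),
        Finset.card_univ, Fintype.card_fin] at h3
      have : 0 < n := by
        by_contra h0
        obtain rfl : n = 0 := by omega
        exact hi (Fin.ext (by omega))
      omega
    · push Not at hz
      exact ⟨0, fun i _ => hz i⟩
  let σ : Equiv.Perm (Fin (n + 1)) := Equiv.swap i₀ (Fin.last n)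
  refine ⟨f.reindex σ, fun i j hij => ?_, fun i => ?_⟩
  · rw [Module.Basis.reindex_apply, Module.Basis.reindex_apply]
    exact hf _ _ (by simpa using hij)
  · rw [Module.Basis.reindex_apply]
    refine hi₀ _ fun h' => ?_
    rw [Equiv.symm_apply_eq, Equiv.swap_apply_left] at h'
    exact (Fin.castSucc_lt_last i).ne h'

end

variable {R E L K : Type*} [CommRing R] [Algebra ℚ R] [AddCommGroup E] [Module R E]
  [AddCommGroup L] [Module R L] [Field K]

/-- Near a point where the corank is at most one, there is an orthogonal frame whose members, except
possibly the last one, have invertible norm. The frame over the residue field is lifted and then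
orthogonalised. -/
theorem exists_orthogonal_of_minor (b : E →ₗ[R] E →ₗ[R] L →ₗ[R] R) (π : R →+* K)
    (hb : ∀ v w, b v w = b w v)
    (hπ : ∀ x : K, ∃ a s, π s ≠ 0 ∧ x * π s = π a) (l : Module.Basis (Fin 1) R L) {n : ℕ}
    (e : Module.Basis (Fin (n + 1)) R E) (v w : Fin n → E) (t : Fin n → L)
    (h : π (Matrix.of fun i j => b (v i) (w j) (t j)).det ≠ 0) :
    ∃ f : Fin (n + 1) → E, (∀ i j, i ≠ j → b (f i) (f j) (l 0) = 0) ∧ π (e.det f) ≠ 0 ∧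
      ∀ i : Fin n, π (b (f i.castSucc) (f i.castSucc) (l 0)) ≠ 0 := by
  let _ : Invertible (2 : K) := (Invertible.map (π.comp (algebraMap ℚ R)) 2).copy _
    (map_ofNat (π.comp (algebraMap ℚ R)) 2).symm
  let B : LinearMap.BilinForm K (Fin (n + 1) → K) :=
    Matrix.toBilin' (Matrix.of fun i j => π (b (e i) (e j) (l 0)))
  have hB : ∀ x y, B x y = B y x := by
    intro x y
    simp only [B, Matrix.toBilin'_apply, Matrix.of_apply]
    rw [Finset.sum_comm]
    refine Finset.sum_congr rfl fun i _ => Finset.sum_congr rfl fun j _ => ?_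
    rw [hb (e i) (e j)]; ring
  have hBπ : ∀ x y : E, B (fun i => π (e.repr x i)) (fun i => π (e.repr y i)) =
      π (b x y (l 0)) := by
    intro x y
    rw [form_eq_sum b (l 0) e x y]
    simp [B, Matrix.toBilin'_apply]
  have ht : ∀ x y (s : L), b x y s = b x y (l 0) * l.repr s 0 := by
    intro x y s
    conv_lhs => rw [← l.sum_repr s]
    simp [mul_comm]
  obtain ⟨f, hf, hf'⟩ := exists_orthogonal_basis_of_minor B hB
    (fun i j => π (e.repr (v i) j)) (fun i j => π (e.repr (w i) j)) (fun i => π (l.repr (t i) 0))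
    (by
      convert h
      rw [RingHom.map_det]
      congr 1
      ext i j
      simp [hBπ, ht _ _ (t j)])
  choose a s hs has using hπ
  -- clear denominators
  let S : R := ∏ i, ∏ j, s (f i j)
  have hS : π S ≠ 0 := by
    simp only [S, map_prod]
    exact Finset.prod_ne_zero_iff.2 fun i _ => Finset.prod_ne_zero_iff.2 fun j _ => hs _
  have hlift : ∀ i j, ∃ r : R, π r = π S * f i j := by
    intro i j
    have hd : s (f i j) ∣ S :=
      (Finset.dvd_prod_of_mem (fun j => s (f i j)) (Finset.mem_univ j)).trans
        (Finset.dvd_prod_of_mem (fun i => ∏ j, s (f i j)) (Finset.mem_univ i))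
    obtain ⟨c, hc⟩ := hd
    refine ⟨a (f i j) * c, ?_⟩
    rw [hc, map_mul, map_mul, ← has]
    ring
  choose r hr using hlift
  let g : Fin (n + 1) → E := fun i => ∑ j, r i j • e j
  have hg : ∀ i, (fun j => π (e.repr (g i) j)) = π S • f i := by
    intro i
    ext j
    simp only [g]
    rw [e.repr_sum_self, hr]
    rfl
  have hgg : ∀ i j, π (b (g i) (g j) (l 0)) = π S * (π S * B (f i) (f j)) := by
    intro i j
    rw [← hBπ, hg, hg]
    simp
  have hdet : π (e.det g) ≠ 0 := by
    have h1 : π (e.det g) = (∏ _i : Fin (n + 1), π S) * (Pi.basisFun K (Fin (n + 1))).det f := by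
      rw [Module.Basis.det_apply, Module.Basis.det_apply, RingHom.map_det, ← Matrix.det_mul_row]
      congr 1
      ext i j
      have := congrFun (hg j) i
      simpa [Module.Basis.toMatrix_apply] using this
    rw [h1]
    exact mul_ne_zero (Finset.prod_ne_zero_iff.2 fun _ _ => hS)
      ((Pi.basisFun K (Fin (n + 1))).isUnit_det f).ne_zero
  have key : ∀ k ≤ n, ∃ f : Fin (n + 1) → E, π (e.det f) ≠ 0 ∧
      (∀ i : Fin n, π (b (f i.castSucc) (f i.castSucc) (l 0)) ≠ 0) ∧
      (∀ i j, i ≠ j → π (b (f i) (f j) (l 0)) = 0) ∧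
      ∀ i j : Fin (n + 1), i ≠ j → (i : ℕ) < k → b (f i) (f j) (l 0) = 0 := by
    intro k hk
    induction k with
    | zero =>
      refine ⟨g, hdet, fun i => ?_, fun i j hij => ?_, fun i j _ h => absurd h (by omega)⟩
      · rw [hgg]
        exact mul_ne_zero hS (mul_ne_zero hS (hf' i))
      · rw [hgg, hf i j hij]; simp
    | succ k ih =>
      obtain ⟨f, h1, h2, h3, h4⟩ := ih (by omega)
      exact gramSchmidt_step b π hb (l 0) e k (by omega) f h1 h2 h3 h4
  obtain ⟨f, h1, h2, -, h4⟩ := key n le_rfl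
  refine ⟨f, fun i j hij => ?_, h1, h2⟩
  rcases lt_or_ge (i : ℕ) n with hi | hi
  · exact h4 i j hij hi
  · rw [hb]
    refine h4 j i (Ne.symm hij) ?_
    have := j.2
    have := i.2
    have : (i : ℕ) ≠ j := fun h => hij (Fin.ext h)
    omega

end EvenClifford

/-! ### Quadratic algebras -/

namespace QuadraticAlgebra

variable {R : Type*} [CommRing R] (d : R)

/-- Two square roots of a unit which agree modulo a square-zero ideal are equal. -/
theorem _root_.eq_of_mul_self_eq_of_sub_mem {B : Type*} [CommRing B] (h2 : IsUnit (2 : B))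
    {I : Ideal B} (hI : I ^ 2 = ⊥) {x y : B} (hx : IsUnit x) (hxy : x * x = y * y)
    (h : x - y ∈ I) : x = y := by
  have h1 : (x - y) * (x - y) = 0 := by
    have := Ideal.mul_mem_mul h h
    rwa [← pow_two, hI, Ideal.mem_bot] at this
  have h3 : (x - y) * (2 * x) = 0 := by linear_combination h1 + hxy
  exact sub_eq_zero.1 (((h2.mul hx).mul_left_eq_zero).1 h3)

theorem formallyEtale (h2 : IsUnit (2 : R)) (hd : IsUnit d) :
    Algebra.FormallyEtale R (QuadraticAlgebra R d 0) := by
  rw [Algebra.FormallyEtale.iff_comp_bijective]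
  intro B _ _ I hI
  have h2B : IsUnit (2 : B) := by
    have := h2.map (algebraMap R B)
    rwa [map_ofNat] at this
  have hsq : ∀ f : QuadraticAlgebra R d 0 →ₐ[R] B, f ω * f ω = algebraMap R B d := by
    intro f
    rw [← map_mul, omega_mul_omega_eq_add]
    simp [Algebra.algebraMap_eq_smul_one]
  have hunit : ∀ f : QuadraticAlgebra R d 0 →ₐ[R] B, IsUnit (f ω) := by
    intro f
    have := hd.map (algebraMap R B)
    rw [← hsq f] at this
    exact isUnit_of_mul_isUnit_left this
  constructor
  · intro f g hfg
    apply algHom_ext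
    refine eq_of_mul_self_eq_of_sub_mem h2B hI (hunit f) ((hsq f).trans (hsq g).symm) ?_
    have := AlgHom.congr_fun hfg ω
    exact Ideal.Quotient.eq.1 this
  · intro f
    obtain ⟨x, hx⟩ := Ideal.Quotient.mk_surjective (f ω)
    have hmem : x * x - algebraMap R B d ∈ I := by
      rw [← Ideal.Quotient.eq, map_mul, hx, ← map_mul, omega_mul_omega_eq_add]
      simp [Algebra.algebraMap_eq_smul_one]
      rfl
    have h0 : (x * x - algebraMap R B d) * (x * x - algebraMap R B d) = 0 := by
      have := Ideal.mul_mem_mul hmem hmem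
      rwa [← pow_two, hI, Ideal.mem_bot] at this
    have hxu : IsUnit x := by
      have hn : IsNilpotent (x * x - algebraMap R B d) := ⟨2, by rw [pow_two, h0]⟩
      have h3 := hn.isUnit_add_left_of_commute (hd.map (algebraMap R B)) (Commute.all _ _)
      rw [add_sub_cancel] at h3
      exact isUnit_of_mul_isUnit_left h3
    obtain ⟨c, hc⟩ := h2B.mul hxu
    -- one step of Newton's method
    let y := x - (x * x - algebraMap R B d) * ((c⁻¹ : Bˣ) : B)
    have hcc : 2 * x * ((c⁻¹ : Bˣ) : B) = 1 := by rw [← hc]; exact c.mul_inv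
    have hy : y * y = algebraMap R B d := by
      simp only [y]
      linear_combination (-(x * x - algebraMap R B d)) * hcc +
        ((c⁻¹ : Bˣ) : B) ^ 2 * h0
    refine ⟨lift ⟨y, by rw [hy]; simp [Algebra.algebraMap_eq_smul_one]⟩, ?_⟩
    apply algHom_ext
    have : (Ideal.Quotient.mkₐ R I) y = f ω := by
      rw [← hx]
      refine Ideal.Quotient.eq.2 ?_
      simp only [y, sub_sub_cancel_left]
      exact I.neg_mem (I.mul_mem_right _ hmem)
    simpa using this

theorem isUnit_of_formallyUnramified
    [Algebra.FormallyUnramified R (QuadraticAlgebra R d 0)] : IsUnit d := by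
  by_contra hd
  obtain ⟨p, hp, hdp⟩ := exists_max_ideal_of_mem_nonunits hd
  let B := DualNumber (R ⧸ p)
  have hd0 : algebraMap R B d = 0 := by
    rw [IsScalarTower.algebraMap_apply R (R ⧸ p) B, Ideal.Quotient.algebraMap_eq,
      Ideal.Quotient.eq_zero_iff_mem.2 hdp, map_zero]
  have hd1 : d • (1 : B) = 0 := by rw [← Algebra.algebraMap_eq_smul_one, hd0]
  let f : QuadraticAlgebra R d 0 →ₐ[R] B := lift ⟨0, by simp [hd1]⟩
  let g : QuadraticAlgebra R d 0 →ₐ[R] B := lift ⟨DualNumber.eps, by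
    rw [DualNumber.eps_mul_eps, hd1]; simp⟩
  have hfg : f = g := by
    refine Algebra.FormallyUnramified.ext (TrivSqZeroExt.kerIdeal (R ⧸ p) (R ⧸ p))
      ⟨2, TrivSqZeroExt.kerIdeal_sq _ _⟩ fun x => ?_
    rw [Ideal.Quotient.eq, TrivSqZeroExt.mem_kerIdeal_iff_inr]
    ext
    · have h : f x - g x = -(x.im • (DualNumber.eps : B)) := by simp [f, g]
      rw [h, TrivSqZeroExt.fst_neg, TrivSqZeroExt.fst_smul]
      simp
    · simp
  have h1 := congrArg TrivSqZeroExt.snd (AlgHom.congr_fun hfg ω)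
  simp [f, g] at h1

theorem etale_iff (h2 : IsUnit (2 : R)) :
    Algebra.Etale R (QuadraticAlgebra R d 0) ↔ IsUnit d := by
  constructor
  · intro h
    exact isUnit_of_formallyUnramified d
  · intro hd
    have := formallyEtale d h2 hd
    have := Module.finitePresentation_of_projective R (QuadraticAlgebra R d 0)
    exact { }

/-- An algebra freely generated as a module by `1` and a square root of `d`. -/
def equivOfBijective {Z : Type*} [CommRing Z] [Algebra R Z] (w : Z)
    (hw : w * w = algebraMap R Z d)
    (hbij : Function.Bijective fun q : R × R => algebraMap R Z q.1 + q.2 • w) :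
    QuadraticAlgebra R d 0 ≃ₐ[R] Z :=
  AlgEquiv.ofBijective (lift ⟨w, by rw [hw]; simp [Algebra.algebraMap_eq_smul_one]⟩) (by
    convert hbij.comp (equivProd d (0 : R)).bijective using 1
    ext x
    simp [Algebra.algebraMap_eq_smul_one, equivProd])

end QuadraticAlgebra

/-! ### Azumaya algebras can be recognised locally -/

section Local

variable {W A : Type*} [CommRing W] [Ring A] [Algebra W A] (s : Set W) (hs : Ideal.span s = ⊤)
  {W' : s → Type*} {A' : s → Type*} [∀ g, CommRing (W' g)] [∀ g, Algebra W (W' g)]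
  [∀ g : s, IsLocalization.Away g.val (W' g)] [∀ g, Ring (A' g)] [∀ g, Algebra W (A' g)]
  [∀ g, Algebra (W' g) (A' g)] [∀ g, IsScalarTower W (W' g) (A' g)]
  (f : ∀ g, A →ₐ[W] A' g) [∀ g : s, IsLocalizedModule.Away g.val (f g).toLinearMap]

theorem mulLeftRight_bijective_restrictScalars {W W₁ A₁ : Type*} [CommRing W] (S : Submonoid W)
    [CommRing W₁] [Algebra W W₁] [IsLocalization S W₁] [Ring A₁] [Algebra W A₁] [Algebra W₁ A₁]
    [IsScalarTower W W₁ A₁] (h : Function.Bijective (AlgHom.mulLeftRight W₁ A₁)) :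
    Function.Bijective (AlgHom.mulLeftRight W A₁) := by
  let e₁ : A₁ ⊗[W₁] A₁ᵐᵒᵖ ≃ₗ[W₁] A₁ ⊗[W] A₁ᵐᵒᵖ :=
    IsLocalization.moduleTensorEquiv S W₁ A₁ A₁ᵐᵒᵖ
  let e₂ : (A₁ →ₗ[W] A₁) ≃ₗ[W₁] (A₁ →ₗ[W₁] A₁) :=
    LinearMap.extendScalarsOfIsLocalizationEquiv S W₁
  have key : ∀ x, e₂ (AlgHom.mulLeftRight W A₁ (e₁ x)) = AlgHom.mulLeftRight W₁ A₁ x := by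
    intro x
    induction x with
    | zero => simp
    | add x y hx hy => simp only [map_add, hx, hy]
    | tmul a c =>
      ext y
      have : e₁ (a ⊗ₜ c) = a ⊗ₜ c := rfl
      rw [this]
      change AlgHom.mulLeftRight W A₁ (a ⊗ₜ c) y = _
      rw [AlgHom.mulLeftRight_apply, AlgHom.mulLeftRight_apply]
  have h1 : Function.Bijective fun x => e₂ (AlgHom.mulLeftRight W A₁ (e₁ x)) := by
    simp only [key]; exact h
  have h2 : ⇑(AlgHom.mulLeftRight W A₁) = e₂.symm ∘
      (fun x => e₂ (AlgHom.mulLeftRight W A₁ (e₁ x))) ∘ e₁.symm := by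
    ext1 x
    simp
  rw [h2]
  exact e₂.symm.bijective.comp (h1.comp e₁.symm.bijective)

instance isLocalizedModule_op {W A A' : Type*} [CommRing W] (S : Submonoid W) [Ring A] [Ring A']
    [Algebra W A] [Algebra W A'] (f : A →ₗ[W] A') [IsLocalizedModule S f] :
    IsLocalizedModule S ((MulOpposite.opLinearEquiv W).toLinearMap ∘ₗ f ∘ₗ
      (MulOpposite.opLinearEquiv W).symm.toLinearMap) :=
  inferInstance

include hs f in
/-- Being finitely generated projective, being faithful and bijectivity of `A ⊗ Aᵒᵖ → End A` can all be
checked on the localisations at elements that generate the unit ideal. -/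
theorem isAzumaya_of_localizationSpan (h : ∀ g, IsAzumaya (W' g) (A' g)) : IsAzumaya W A := by
  have hfp : Module.FinitePresentation W A :=
    Module.FinitePresentation.of_localizationSpan' (Rₚ := W') s hs (fun g => (f g).toLinearMap)
      fun g => Module.finitePresentation_of_projective _ _
  have hfl : Module.Flat W A := by
    refine Module.flat_of_isLocalized_span (R := W) (S := W) (M := A) s hs A' (fun g => (f g).toLinearMap) fun g => ?_
    have : Module.Flat W (W' g) := IsLocalization.flat _ (Submonoid.powers g.1)
    exact Module.Flat.trans W (W' g) (A' g)
  have hproj : Module.Projective W A := Module.Flat.projective_of_finitePresentation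
  have hfaith : FaithfulSMul W A := by
    rw [faithfulSMul_iff_algebraMap_injective]
    refine injective_of_isLocalized_span s hs W' (fun g => Algebra.linearMap W (W' g)) A'
      (fun g => (f g).toLinearMap) (Algebra.linearMap W A) fun g => ?_
    have h1 : IsLocalizedModule.map (Submonoid.powers g.1) (Algebra.linearMap W (W' g))
        (f g).toLinearMap (Algebra.linearMap W A) =
          (IsScalarTower.toAlgHom W (W' g) (A' g)).toLinearMap := by
      refine IsLocalizedModule.linearMap_ext (Submonoid.powers g.1) (Algebra.linearMap W (W' g))
        (f g).toLinearMap ?_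
      ext
      refine (IsLocalizedModule.map_apply (Submonoid.powers g.1) (Algebra.linearMap W (W' g))
        (f g).toLinearMap (Algebra.linearMap W A) 1).trans ?_
      simp
    rw [h1]
    exact (faithfulSMul_iff_algebraMap_injective _ _).1 (h g).toFaithfulSMul
  have hbij : Function.Bijective (AlgHom.mulLeftRight W A).toLinearMap := by
    refine bijective_of_isLocalized_span s hs (fun g => A' g ⊗[W] (A' g)ᵐᵒᵖ)
      (fun g => TensorProduct.map (f g).toLinearMap
        ((MulOpposite.opLinearEquiv W).toLinearMap ∘ₗ (f g).toLinearMap ∘ₗ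
          (MulOpposite.opLinearEquiv W).symm.toLinearMap))
      (fun g => A' g →ₗ[W] A' g)
      (fun g => IsLocalizedModule.map (Submonoid.powers g.1) (f g).toLinearMap
        (f g).toLinearMap) _ fun g => ?_
    have h1 : IsLocalizedModule.map (Submonoid.powers g.1)
        (TensorProduct.map (f g).toLinearMap
        ((MulOpposite.opLinearEquiv W).toLinearMap ∘ₗ (f g).toLinearMap ∘ₗ
          (MulOpposite.opLinearEquiv W).symm.toLinearMap))
        (IsLocalizedModule.map (Submonoid.powers g.1) (f g).toLinearMap (f g).toLinearMap)
        (AlgHom.mulLeftRight W A).toLinearMap = (AlgHom.mulLeftRight W (A' g)).toLinearMap := by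
      refine IsLocalizedModule.linearMap_ext (Submonoid.powers g.1)
        (TensorProduct.map (f g).toLinearMap
        ((MulOpposite.opLinearEquiv W).toLinearMap ∘ₗ (f g).toLinearMap ∘ₗ
          (MulOpposite.opLinearEquiv W).symm.toLinearMap))
        (IsLocalizedModule.map (Submonoid.powers g.1) (f g).toLinearMap (f g).toLinearMap) ?_
      rw [IsLocalizedModule.map_comp]
      refine TensorProduct.ext' fun a c => ?_
      refine IsLocalizedModule.linearMap_ext (Submonoid.powers g.1) (f g).toLinearMap
        (f g).toLinearMap ?_
      ext x
      refine (IsLocalizedModule.map_apply (Submonoid.powers g.1) (f g).toLinearMap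
        (f g).toLinearMap (AlgHom.mulLeftRight W A (a ⊗ₜ c)) x).trans ?_
      simp
    rw [h1]
    exact mulLeftRight_bijective_restrictScalars (Submonoid.powers g.1) (h g).bij
  exact { bij := hbij }

include hs f in
theorem rankAtStalk_eq_of_localizationSpan [Module.Finite W A] [Module.Flat W A] (N : ℕ)
    (h : ∀ (g : s) (p : PrimeSpectrum (W' g)), Module.rankAtStalk (A' g) p = N)
    (p : PrimeSpectrum W) : Module.rankAtStalk A p = N := by
  obtain ⟨g, hgs, hgp⟩ : ∃ g ∈ s, g ∉ p.asIdeal := by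
    by_contra! hc
    exact p.2.ne_top (top_le_iff.1 (hs ▸ Ideal.span_le.2 hc))
  have := ‹∀ g : s, IsLocalization.Away g.val (W' g)› ⟨g, hgs⟩
  have hloc : IsLocalizedModule.Away g (f ⟨g, hgs⟩).toLinearMap :=
    ‹∀ g : s, IsLocalizedModule.Away g.val (f g).toLinearMap› ⟨g, hgs⟩
  have : IsLocalization.Away g (W' ⟨g, hgs⟩) := this
  have hp : p ∈ Set.range (PrimeSpectrum.comap (algebraMap W (W' ⟨g, hgs⟩))) := by
    rw [PrimeSpectrum.localization_away_comap_range (W' ⟨g, hgs⟩) g]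
    exact hgp
  obtain ⟨q, rfl⟩ := hp
  have hb : IsBaseChange (W' ⟨g, hgs⟩) (f ⟨g, hgs⟩).toLinearMap :=
    (isLocalizedModule_iff_isBaseChange (Submonoid.powers g) _ _).1 hloc
  rw [← Module.rankAtStalk_isBaseChange hb q, h]

end Local

/-! ### Sections of a sheafification over a basis on which the presheaf is a sheaf -/

section Sheafify

variable {X : TopCat.{u}} (P : (Opens X)ᵒᵖ ⥤ RingCat.{u})

theorem toSheafify_map_apply {V D : Opens X} (h : V ≤ D) (s : P.obj (op D)) :
    ((toSheafify (Opens.grothendieckTopology X) P).app (op V)).hom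
        ((P.map (homOfLE h).op).hom s) =
      ((sheafify (Opens.grothendieckTopology X) P).map (homOfLE h).op).hom
        (((toSheafify (Opens.grothendieckTopology X) P).app (op D)).hom s) :=
  NatTrans.naturality_apply (toSheafify (Opens.grothendieckTopology X) P) (homOfLE h).op s

theorem sheaf_ext (F : TopCat.Sheaf RingCat.{u} X) {D : Opens X} (s t : F.obj.obj (op D))
    (h : ∀ x ∈ D, ∃ (V : Opens X) (hV : V ≤ D), x ∈ V ∧
      (F.obj.map (homOfLE hV).op).hom s = (F.obj.map (homOfLE hV).op).hom t) : s = t := by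
  choose! V hV hxV hst using h
  refine F.eq_of_locally_eq' (fun x : D => V x) D (fun x => homOfLE (hV x x.2)) ?_ s t
    fun x => hst x x.2
  intro x hx
  exact Opens.mem_iSup.2 ⟨⟨x, hx⟩, hxV x hx⟩

theorem exists_locally_eq_of_toSheafify_eq {D : Opens X} (s t : P.obj (op D))
    (h : ((toSheafify (Opens.grothendieckTopology X) P).app (op D)).hom s =
      ((toSheafify (Opens.grothendieckTopology X) P).app (op D)).hom t) (x : X) (hx : x ∈ D) :
    ∃ (V : Opens X) (hV : V ≤ D), x ∈ V ∧
      (P.map (homOfLE hV).op).hom s = (P.map (homOfLE hV).op).hom t := by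
  obtain ⟨V, f, hf, hxV⟩ := Presheaf.equalizerSieve_mem (Opens.grothendieckTopology X)
    (toSheafify (Opens.grothendieckTopology X) P) s t h x hx
  exact ⟨V, f.le, hxV, hf⟩

theorem exists_locally_eq_toSheafify {D : Opens X}
    (a : (sheafify (Opens.grothendieckTopology X) P).obj (op D)) (x : X) (hx : x ∈ D) :
    ∃ (V : Opens X) (hV : V ≤ D) (s : P.obj (op V)), x ∈ V ∧
      ((toSheafify (Opens.grothendieckTopology X) P).app (op V)).hom s =
        ((sheafify (Opens.grothendieckTopology X) P).map (homOfLE hV).op).hom a := by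
  obtain ⟨V, f, ⟨s, hs⟩, hxV⟩ := Presheaf.imageSieve_mem (Opens.grothendieckTopology X)
    (toSheafify (Opens.grothendieckTopology X) P) a x hx
  exact ⟨V, f.le, s, hxV, hs⟩

variable {C : Type*} [Category C] {FC : C → C → Type*} {CC : C → Type u}
  [∀ X Y, FunLike (FC X Y) (CC X) (CC Y)] [ConcreteCategory C FC] [Limits.HasLimitsOfSize.{u, u} C]
  [(forget C).ReflectsIsomorphisms] [Limits.PreservesLimitsOfSize.{u, u} (forget C)]

/-- A presheaf of rings which agrees with a product of sheaves on a basis of open subsets has the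
same sections over the members of the basis as its sheafification. -/
theorem toSheafify_bijective_of_basis {ι : Type*} (F : ι → TopCat.Sheaf C X)
    (𝔅 : Opens X → Prop)
    (h𝔅 : ∀ D, 𝔅 D → ∀ V ≤ D, ∀ x ∈ V, ∃ W, 𝔅 W ∧ x ∈ W ∧ W ≤ V)
    (β : ∀ D, 𝔅 D → P.obj (op D) → ∀ i, ToType ((F i).obj.obj (op D)))
    (hβ : ∀ D hD, Function.Bijective (β D hD))
    (hβ' : ∀ D V (hD : 𝔅 D) (hV : 𝔅 V) (h : V ≤ D) (s : P.obj (op D)) i,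
      β V hV ((P.map (homOfLE h).op).hom s) i = (F i).obj.map (homOfLE h).op (β D hD s i))
    (D : Opens X) (hD : 𝔅 D) :
    Function.Bijective ((toSheafify (Opens.grothendieckTopology X) P).app (op D)).hom := by
  have hcomp : ∀ {D V W : Opens X} (h : V ≤ D) (h' : W ≤ V) (s : P.obj (op D)),
      (P.map (homOfLE h').op).hom ((P.map (homOfLE h).op).hom s) =
        (P.map (homOfLE (h'.trans h)).op).hom s := by
    intro D V W h h' s
    rw [← RingHom.comp_apply, ← RingCat.hom_comp, ← P.map_comp]
    rfl
  have hinj : ∀ D, 𝔅 D → Function.Injective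
      ((toSheafify (Opens.grothendieckTopology X) P).app (op D)).hom := by
    intro D hD s t hst
    apply (hβ D hD).1
    ext i
    have h1 : ∀ x : D, ∃ (V : Opens X) (hV : V ≤ D), x.1 ∈ V ∧ 𝔅 V ∧
        (P.map (homOfLE hV).op).hom s = (P.map (homOfLE hV).op).hom t := by
      intro x
      obtain ⟨V, hV, hxV, h⟩ := exists_locally_eq_of_toSheafify_eq P s t hst x.1 x.2
      obtain ⟨W, hW, hxW, hWV⟩ := h𝔅 D hD V hV x.1 hxV
      refine ⟨W, hWV.trans hV, hxW, hW, ?_⟩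
      rw [← hcomp hV hWV, ← hcomp hV hWV, h]
    choose V hV hxV hVB h1 using h1
    refine (F i).eq_of_locally_eq' V D (fun x => homOfLE (hV x)) ?_ _ _ fun x => ?_
    · intro x hx
      exact Opens.mem_iSup.2 ⟨⟨x, hx⟩, hxV ⟨x, hx⟩⟩
    · rw [← hβ' D (V x) hD (hVB x) (hV x), ← hβ' D (V x) hD (hVB x) (hV x), h1]
  refine ⟨hinj D hD, fun a => ?_⟩
  have h1 : ∀ x : D, ∃ (V : Opens X) (hV : V ≤ D) (s : P.obj (op V)), x.1 ∈ V ∧ 𝔅 V ∧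
      ((toSheafify (Opens.grothendieckTopology X) P).app (op V)).hom s =
        ((sheafify (Opens.grothendieckTopology X) P).map (homOfLE hV).op).hom a := by
    intro x
    obtain ⟨V, hV, s, hxV, h⟩ := exists_locally_eq_toSheafify P a x.1 x.2
    obtain ⟨W, hW, hxW, hWV⟩ := h𝔅 D hD V hV x.1 hxV
    refine ⟨W, hWV.trans hV, (P.map (homOfLE hWV).op).hom s, hxW, hW, ?_⟩
    rw [toSheafify_map_apply, h, ← RingHom.comp_apply, ← RingCat.hom_comp, ← Functor.map_comp]
    rfl
  choose V hV s hxV hVB hs using h1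
  have hcov : D ≤ iSup V := fun x hx => Opens.mem_iSup.2 ⟨⟨x, hx⟩, hxV ⟨x, hx⟩⟩
  -- the local sections agree on overlaps
  have hcompat : ∀ x y (W : Opens X) (h₁ : W ≤ V x) (h₂ : W ≤ V y), 𝔅 W →
      (P.map (homOfLE h₁).op).hom (s x) = (P.map (homOfLE h₂).op).hom (s y) := by
    intro x y W h₁ h₂ hW
    apply hinj W hW
    rw [toSheafify_map_apply, toSheafify_map_apply, hs, hs, ← RingHom.comp_apply,
      ← RingCat.hom_comp, ← Functor.map_comp, ← RingHom.comp_apply, ← RingCat.hom_comp,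
      ← Functor.map_comp]
    rfl
  have hglue : ∀ i, ∃ t : ToType ((F i).obj.obj (op D)),
      ∀ x, (F i).obj.map (homOfLE (hV x)).op t = β (V x) (hVB x) (s x) i := by
    intro i
    refine ((F i).existsUnique_gluing' V D (fun x => homOfLE (hV x)) hcov
      (fun x => β (V x) (hVB x) (s x) i) fun x y => ?_).exists
    have h2 : ∀ z : ↥(V x ⊓ V y), ∃ W : Opens X, 𝔅 W ∧ z.1 ∈ W ∧ W ≤ V x ⊓ V y := fun z =>
      h𝔅 (V x) (hVB x) _ inf_le_left z.1 z.2
    choose W hW hzW hWV using h2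
    refine (F i).eq_of_locally_eq' W (V x ⊓ V y) (fun z => homOfLE (hWV z)) ?_ _ _ fun z => ?_
    · intro z hz
      exact Opens.mem_iSup.2 ⟨⟨z, hz⟩, hzW ⟨z, hz⟩⟩
    · rw [← ConcreteCategory.comp_apply, ← ConcreteCategory.comp_apply, ← Functor.map_comp,
        ← Functor.map_comp]
      have e₁ := hβ' (V x) (W z) (hVB x) (hW z) ((hWV z).trans inf_le_left) (s x) i
      have e₂ := hβ' (V y) (W z) (hVB y) (hW z) ((hWV z).trans inf_le_right) (s y) i
      exact e₁.symm.trans ((congrArg (fun w => β (W z) (hW z) w i)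
        (hcompat x y (W z) _ _ (hW z))).trans e₂)
  choose t ht using hglue
  obtain ⟨s₀, hs₀⟩ := (hβ D hD).2 t
  refine ⟨s₀, ?_⟩
  have h3 : ∀ x, (P.map (homOfLE (hV x)).op).hom s₀ = s x := by
    intro x
    apply (hβ (V x) (hVB x)).1
    ext i
    rw [hβ' D (V x) hD (hVB x) (hV x), hs₀, ht]
  refine sheaf_ext ((presheafToSheaf (Opens.grothendieckTopology X) RingCat.{u}).obj P) _ _
    fun x hx => ⟨V ⟨x, hx⟩, hV _, hxV ⟨x, hx⟩, ?_⟩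
  rw [← hs]
  refine Eq.trans ?_ (congrArg _ (h3 ⟨x, hx⟩))
  exact (toSheafify_map_apply P (hV ⟨x, hx⟩) s₀).symm

end Sheafify

/-! ### The sheaf of even Clifford algebras over an open subset with frames -/

/-- `2` is invertible in a `ℚ`-algebra. -/
abbrev invertibleTwoOfRat (R : Type*) [CommRing R] [Algebra ℚ R] : Invertible (2 : R) :=
  (Invertible.map (algebraMap ℚ R) 2).copy _ (map_ofNat _ 2).symm

theorem EvenClifford.repr_map {R E L R' E' L' : Type u} [CommRing R] [AddCommGroup E] [Module R E]
    [AddCommGroup L] [Module R L] (b : E →ₗ[R] E →ₗ[R] L →ₗ[R] R) [CommRing R'] [AddCommGroup E']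
    [Module R' E'] [AddCommGroup L'] [Module R' L'] [Invertible (2 : R)] [Invertible (2 : R')]
    (b' : E' →ₗ[R'] E' →ₗ[R'] L' →ₗ[R'] R') (f : R →+* R')
    (fE : E →ₛₗ[f] E') (fL : L →ₛₗ[f] L')
    (h : ∀ v w l, b' (fE v) (fE w) (fL l) = f (b v w l)) {n : ℕ} (e : Module.Basis (Fin n) R E)
    (l : Module.Basis (Fin 1) R L) (e' : Module.Basis (Fin n) R' E')
    (l' : Module.Basis (Fin 1) R' L') (he : ∀ i, fE (e i) = e' i) (hl : fL (l 0) = l' 0)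
    (x : EvenClifford b) (ε : EvenBool n) :
    (evenBasis b' l' e').repr (map b b' f fE fL h x) ε = f ((evenBasis b l e).repr x ε) := by
  have h1 : map b b' f fE fL h x =
      ∑ ε, f ((evenBasis b l e).repr x ε) • evenBasis b' l' e' ε := by
    conv_lhs => rw [← (evenBasis b l e).sum_repr x, map_sum]
    refine Finset.sum_congr rfl fun ε _ => ?_
    rw [map_smul_eq, map_evenBasis b b' f fE fL h e l e' l' he hl]
  rw [h1, Module.Basis.repr_sum_self]

section DetCoord

variable {R E L : Type u} [CommRing R] [AddCommGroup E] [Module R E] [AddCommGroup L] [Module R L]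
  (l : Module.Basis (Fin 1) R L) {n : ℕ} (e : Module.Basis (Fin n) R E) (m : ℕ)

/-- The coordinate on the free module `det E ⊗ L ^ m` of rank one. -/
def EvenClifford.detCoord : (⋀[R]^n E) ⊗[R] (⨂[R] _ : Fin m, L) →ₗ[R] R :=
  LinearMap.mul' R R ∘ₗ TensorProduct.map (exteriorPower.alternatingMapLinearEquiv e.det)
    (PiTensorProduct.lift ((MultilinearMap.mkPiAlgebra R (Fin m) R).compLinearMap
      fun _ => (EvenClifford.lineEquiv l).toLinearMap))

theorem EvenClifford.detCoord_tmul (v : Fin n → E) (t : Fin m → L) :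
    detCoord l e m (exteriorPower.ιMulti R n v ⊗ₜ PiTensorProduct.tprod R t) =
      e.det v * ∏ i, lineEquiv l (t i) := by
  simp [detCoord]

theorem EvenClifford.detCoord_bijective : Function.Bijective (detCoord l e m) := by
  let T := exteriorPower.ιMulti R n e ⊗ₜ[R] PiTensorProduct.tprod R (fun _ : Fin m => l 0)
  have h1 : detCoord l e m T = 1 := by
    rw [detCoord_tmul]; simp [e.det_self]
  have h2 : LinearMap.toSpanSingleton R _ T ∘ₗ detCoord l e m = LinearMap.id := by
    have hv : LinearMap.toSpanSingleton R _ (exteriorPower.ιMulti R n e) ∘ₗ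
        exteriorPower.alternatingMapLinearEquiv e.det = LinearMap.id := by
      apply exteriorPower.linearMap_ext
      ext v
      simp [← AlternatingMap.eq_basis_det_smul e (exteriorPower.ιMulti R n) v]
    have ht : LinearMap.toSpanSingleton R _ (PiTensorProduct.tprod R fun _ : Fin m => l 0) ∘ₗ
        PiTensorProduct.lift ((MultilinearMap.mkPiAlgebra R (Fin m) R).compLinearMap
          fun _ => (EvenClifford.lineEquiv l).toLinearMap) = LinearMap.id := by
      ext t
      simp only [LinearMap.compMultilinearMap_apply, LinearMap.comp_apply,
        PiTensorProduct.lift.tprod, LinearMap.id_apply, LinearMap.toSpanSingleton_apply,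
        MultilinearMap.compLinearMap_apply, MultilinearMap.mkPiAlgebra_apply]
      rw [← MultilinearMap.map_smul_univ]
      congr 1
      ext i
      apply (lineEquiv l).injective
      simp
    refine TensorProduct.ext' fun x y => ?_
    have hx := LinearMap.congr_fun hv x
    have hy := LinearMap.congr_fun ht y
    simp only [LinearMap.comp_apply, LinearMap.toSpanSingleton_apply, LinearMap.id_apply]
      at hx hy ⊢
    conv_rhs => rw [← hx, ← hy, TensorProduct.smul_tmul_smul]
    rfl
  refine ⟨fun q q' h => ?_, fun r => ⟨r • T, by rw [map_smul, h1, smul_eq_mul, mul_one]⟩⟩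
  have e₁ := LinearMap.congr_fun h2 q
  have e₂ := LinearMap.congr_fun h2 q'
  simp only [LinearMap.comp_apply, LinearMap.id_apply] at e₁ e₂
  rw [← e₁, h, e₂]

end DetCoord

section Frames

variable {S : Scheme.{u}}

theorem IsFrame.mono {E : S.Modules} {U V : S.Opens} {n : ℕ} {e : Fin n → Γ(E, U)}
    (he : IsFrame E U e) (h : V ≤ U) :
    IsFrame E V fun i => E.presheaf.map (homOfLE h).op (e i) := by
  intro W hW
  have h1 : ∀ i, E.presheaf.map (homOfLE hW).op (E.presheaf.map (homOfLE h).op (e i)) =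
      E.presheaf.map (homOfLE (hW.trans h)).op (e i) := by
    intro i
    rw [← ConcreteCategory.comp_apply, ← Functor.map_comp]
    rfl
  simp only [h1]
  exact he W (hW.trans h)

/-- The basis of the module of sections given by a frame. -/
def IsFrame.basis {E : S.Modules} {U : S.Opens} {n : ℕ} {e : Fin n → Γ(E, U)}
    (he : IsFrame E U e) : Module.Basis (Fin n) Γ(S, U) Γ(E, U) :=
  Module.Basis.mk (v := e)
    (by
      have h := (he U le_rfl).1
      have h1 : ∀ i, E.presheaf.map (homOfLE le_rfl).op (e i) = e i := by
        intro i
        have : (homOfLE (le_refl U)).op = 𝟙 (op U) := rfl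
        rw [this, E.presheaf.map_id]; rfl
      simpa only [h1] using h)
    (by
      have h := (he U le_rfl).2
      have h1 : ∀ i, E.presheaf.map (homOfLE le_rfl).op (e i) = e i := by
        intro i
        have : (homOfLE (le_refl U)).op = 𝟙 (op U) := rfl
        rw [this, E.presheaf.map_id]; rfl
      simpa only [h1] using h.ge)

@[simp]
theorem IsFrame.basis_apply {E : S.Modules} {U : S.Opens} {n : ℕ} {e : Fin n → Γ(E, U)}
    (he : IsFrame E U e) (i : Fin n) : he.basis i = e i := by
  simp [IsFrame.basis]

/-- A basis of the sections over an open subset which has a frame is a frame. -/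
theorem IsFrame.of_basis {E : S.Modules} {U : S.Opens} {n : ℕ} {e : Fin n → Γ(E, U)}
    (he : IsFrame E U e) (f : Module.Basis (Fin n) Γ(S, U) Γ(E, U)) : IsFrame E U f := by
  intro V hV
  have key : Submodule.span Γ(S, V)
      (Set.range fun i => (E.presheaf.map (homOfLE hV).op (f i) : Γ(E, V))) = ⊤ := by
    rw [eq_top_iff, ← (he V hV).2, Submodule.span_le]
    rintro _ ⟨i, rfl⟩
    have h1 := congrArg (resSemilinear E (homOfLE hV)) (f.sum_repr (e i))
    rw [map_sum] at h1
    change _ = E.presheaf.map (homOfLE hV).op (e i) at h1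
    simp only [← h1, SetLike.mem_coe]
    refine Submodule.sum_mem _ fun j _ => ?_
    rw [LinearMap.map_smulₛₗ]
    exact Submodule.smul_mem _ _ (Submodule.subset_span ⟨j, rfl⟩)
  refine ⟨linearIndependent_of_span_eq_top_of_card_eq (he.mono hV).basis _ key (by simp), key⟩

variable (E L : S.Modules)

/-- Frames of a vector bundle of rank `n` and of a line bundle over an open subset. -/
structure Framing (n : ℕ) (U : S.Opens) where
  /-- the frame of the vector bundle -/
  e : Fin n → Γ(E, U)
  /-- the frame of the line bundle -/
  l : Fin 1 → Γ(L, U)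
  he : IsFrame E U e
  hl : IsFrame L U l

namespace Framing

variable {E L} {n : ℕ} {U : S.Opens} (F : Framing E L n U)

/-- Restriction of frames to a smaller open subset. -/
@[simps]
def restrict {V : S.Opens} (h : V ≤ U) : Framing E L n V where
  e i := E.presheaf.map (homOfLE h).op (F.e i)
  l i := L.presheaf.map (homOfLE h).op (F.l i)
  he := F.he.mono h
  hl := F.hl.mono h

theorem restrict_restrict {V W : S.Opens} (h : V ≤ U) (h' : W ≤ V) :
    (F.restrict h).restrict h' = F.restrict (h'.trans h) := by
  have hE (j : Fin n) : E.presheaf.map (homOfLE h').op (E.presheaf.map (homOfLE h).op (F.e j)) =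
      E.presheaf.map (homOfLE (h'.trans h)).op (F.e j) := by
    rw [← ConcreteCategory.comp_apply, ← Functor.map_comp]; rfl
  have hL (j : Fin 1) : L.presheaf.map (homOfLE h').op (L.presheaf.map (homOfLE h).op (F.l j)) =
      L.presheaf.map (homOfLE (h'.trans h)).op (F.l j) := by
    rw [← ConcreteCategory.comp_apply, ← Functor.map_comp]; rfl
  simp only [restrict, hE, hL]

/-- The basis of the sections of the vector bundle. -/
abbrev be : Module.Basis (Fin n) Γ(S, U) Γ(E, U) := F.he.basis

/-- The basis of the sections of the line bundle. -/
abbrev bl : Module.Basis (Fin 1) Γ(S, U) Γ(L, U) := F.hl.basis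

theorem exists_mem (hE : IsVectorBundle E n) (hL : IsVectorBundle L 1) (x : S) :
    ∃ (U : S.Opens), x ∈ U ∧ Nonempty (Framing E L n U) := by
  obtain ⟨U, hxU, e, he⟩ := hE x
  obtain ⟨V, hxV, l, hl⟩ := hL x
  exact ⟨U ⊓ V, ⟨hxU, hxV⟩, ⟨⟨_, _, he.mono inf_le_left, hl.mono inf_le_right⟩⟩⟩

end Framing

end Frames

namespace LineValuedForm

variable {S : Scheme.{u}} {E L : S.Modules} (σ : LineValuedForm E L)

/-- A form which vanishes nowhere lives on a bundle of positive rank. -/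
theorem IsEmbedding.rank_pos {m : ℕ} {σ : LineValuedForm E L} (hσ : σ.IsEmbedding)
    (hE : IsVectorBundle E (2 * m)) (x : S) : 0 < m := by
  rcases Nat.eq_zero_or_pos m with rfl | h
  · exfalso
    obtain ⟨U, v, w, l, hx⟩ := hσ x
    obtain ⟨V, hxV, e, he⟩ := hE x
    have hxU : x ∈ U := S.basicOpen_le _ hx
    let W := U ⊓ V
    have hs : Subsingleton Γ(E, W) :=
      have : IsEmpty (Fin (2 * 0)) := Fin.isEmpty
      (he.mono (inf_le_right : W ≤ V)).basis.equivFun.toEquiv.subsingleton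
    have h0 := σ.map_res (homOfLE (inf_le_left : W ≤ U)) v w l
    rw [Subsingleton.elim (E.presheaf.map (homOfLE (inf_le_left : W ≤ U)).op v) 0, map_zero] at h0
    have h1 : x ∈ S.basicOpen (S.presheaf.map (homOfLE (inf_le_left : W ≤ U)).op
        (σ.form U v w l)) := by
      rw [Scheme.basicOpen_res]
      exact ⟨⟨hxU, hxV⟩, hx⟩
    rw [← h0] at h1
    simp at h1
  · exact h

section Sections

theorem toSheaf_algebraMap {U : S.Opens} (r : Γ(S, U)) :
    σ.toSheaf U (algebraMap Γ(S, U) _ r) = algebraMap Γ(S, U) (σ.evenCliffordSheaf.sec U) r := rfl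

theorem toSheaf_smul {U : S.Opens} (r : Γ(S, U)) (x : EvenClifford (σ.form U)) :
    σ.toSheaf U (r • x) = r • σ.toSheaf U x := by
  rw [Algebra.smul_def, map_mul, toSheaf_algebraMap, Algebra.smul_def]

theorem res_toSheaf {U V : S.Opens} (h : V ≤ U) (x : EvenClifford (σ.form U)) :
    σ.evenCliffordSheaf.res h (σ.toSheaf U x) = σ.toSheaf V (σ.cliffordRes (homOfLE h) x) :=
  (toSheafify_map_apply σ.cliffordPresheaf h x).symm

theorem _root_.AlgSheaf.res_algebraMap {X : Scheme.{u}} (A : AlgSheaf X) {U V : X.Opens}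
    (h : V ≤ U) (r : Γ(X, U)) :
    A.res h (algebraMap Γ(X, U) _ r) = algebraMap Γ(X, V) _ (X.presheaf.map (homOfLE h).op r) :=
  (NatTrans.naturality_apply A.unit.hom (homOfLE h).op r).symm

theorem _root_.AlgSheaf.res_smul {X : Scheme.{u}} (A : AlgSheaf X) {U V : X.Opens}
    (h : V ≤ U) (r : Γ(X, U)) (a : A.sec U) :
    A.res h (r • a) = X.presheaf.map (homOfLE h).op r • A.res h a := by
  rw [Algebra.smul_def, map_mul, A.res_algebraMap, Algebra.smul_def]

theorem _root_.AlgSheaf.res_res {X : Scheme.{u}} (A : AlgSheaf X) {U V W : X.Opens}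
    (h : V ≤ U) (h' : W ≤ V) (a : A.sec U) : A.res h' (A.res h a) = A.res (h'.trans h) a := by
  exact (congrArg (fun f => f.hom a) (A.carrier.obj.map_comp (homOfLE h).op (homOfLE h').op)).symm

theorem _root_.AlgSheaf.ext_of_res {X : Scheme.{u}} (A : AlgSheaf X) {U : X.Opens} {a b : A.sec U}
    (h : ∀ x ∈ U, ∃ (V : X.Opens) (hV : V ≤ U), x ∈ V ∧ A.res hV a = A.res hV b) : a = b :=
  sheaf_ext A.carrier a b h

theorem cliffordRes_antisymm {U V : S.Opens} (i : U ⟶ V) {m : ℕ} (v : Fin (2 * m) → Γ(E, V))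
    (t : Fin m → Γ(L, V)) : σ.cliffordRes i (EvenClifford.antisymm _ v t) =
      EvenClifford.antisymm _ (fun j => E.presheaf.map i.op (v j))
        fun j => L.presheaf.map i.op (t j) :=
  EvenClifford.map_antisymm _ _ _ _ _ _ _ _

theorem res_mem_adjoin {m : ℕ} {U V : S.Opens} (h : V ≤ U) {z : σ.evenCliffordSheaf.sec U}
    (hz : z ∈ Algebra.adjoin Γ(S, U)
      (Set.range fun p : (Fin (2 * m) → Γ(E, U)) × (Fin m → Γ(L, U)) =>
        σ.toSheaf U (EvenClifford.antisymm (σ.form U) p.1 p.2))) :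
    σ.evenCliffordSheaf.res h z ∈ Algebra.adjoin Γ(S, V)
      (Set.range fun p : (Fin (2 * m) → Γ(E, V)) × (Fin m → Γ(L, V)) =>
        σ.toSheaf V (EvenClifford.antisymm (σ.form V) p.1 p.2)) := by
  induction hz using Algebra.adjoin_induction with
  | mem z hz =>
    obtain ⟨p, rfl⟩ := hz
    simp only [res_toSheaf, cliffordRes_antisymm]
    exact Algebra.subset_adjoin ⟨(_, _), rfl⟩
  | algebraMap r =>
    rw [AlgSheaf.res_algebraMap]
    exact Subalgebra.algebraMap_mem _ _
  | add x y _ _ hx hy => rw [map_add]; exact add_mem hx hy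
  | mul x y _ _ hx hy => rw [map_mul]; exact mul_mem hx hy

theorem centralPart_res {m : ℕ} {U V : S.Opens} (h : V ≤ U) {z : σ.evenCliffordSheaf.sec U}
    (hz : z ∈ σ.centralPart m U) : σ.evenCliffordSheaf.res h z ∈ σ.centralPart m V := by
  intro x hx
  obtain ⟨W, hW, hxW, hz⟩ := hz x (h hx)
  refine ⟨W ⊓ V, inf_le_right, ⟨hxW, hx⟩, ?_⟩
  have := σ.res_mem_adjoin (inf_le_left : W ⊓ V ≤ W) hz
  rwa [AlgSheaf.res_res] at this ⊢

end Sections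

section Framed

variable [∀ U : S.Opens, Algebra ℚ Γ(S, U)] {U : S.Opens}

attribute [local instance] invertibleTwoOfRat

/-- Over an open subset with frames the presheaf of even Clifford algebras is already free on the
products of an even number of members of the frame, so that it agrees with its
sheafification. -/
theorem toSheaf_bijective {n : ℕ} (F : Framing E L n U) : Function.Bijective (σ.toSheaf U) := by
  refine toSheafify_bijective_of_basis σ.cliffordPresheaf (fun _ : EvenBool n => S.sheaf)
    (fun V => V ≤ U) (fun D hD V hV x hx => ⟨V, hV.trans hD, hx, le_rfl⟩)
    (fun D hD s => (EvenClifford.evenBasis (σ.form D) (F.restrict hD).bl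
      (F.restrict hD).be).equivFun s)
    (fun D hD => LinearEquiv.bijective _) ?_ U le_rfl
  intro D V hD hV h s i
  have hE (j : Fin n) : E.presheaf.map (homOfLE h).op (E.presheaf.map (homOfLE hD).op (F.e j)) =
      E.presheaf.map (homOfLE hV).op (F.e j) := by
    rw [← ConcreteCategory.comp_apply, ← Functor.map_comp]; rfl
  have hL : L.presheaf.map (homOfLE h).op (L.presheaf.map (homOfLE hD).op (F.l 0)) =
      L.presheaf.map (homOfLE hV).op (F.l 0) := by
    rw [← ConcreteCategory.comp_apply, ← Functor.map_comp]; rfl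
  refine EvenClifford.repr_map (σ.form D) (σ.form V) (S.presheaf.map (homOfLE h).op).hom
    (resSemilinear E (homOfLE h)) (resSemilinear L (homOfLE h)) (σ.map_res (homOfLE h)) _ _ _ _
    (fun j => ?_) ?_ s i
  · rw [IsFrame.basis_apply, IsFrame.basis_apply]
    exact hE j
  · rw [IsFrame.basis_apply, IsFrame.basis_apply]
    exact hL

variable {m : ℕ} (F : Framing E L (2 * m) U)

/-- The antisymmetrised product of the members of a frame. -/
abbrev frameOmega : EvenClifford (σ.form U) := EvenClifford.omega (σ.form U) F.bl F.be

/-- The signed discriminant of the form in a frame. -/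
abbrev frameDiscr : Γ(S, U) := EvenClifford.discr (σ.form U) F.bl F.be

omit [∀ U : S.Opens, Algebra ℚ Γ(S, U)] in
theorem cliffordRes_frameOmega {V : S.Opens} (h : V ≤ U) :
    σ.cliffordRes (homOfLE h) (σ.frameOmega F) = σ.frameOmega (F.restrict h) := by
  refine (σ.cliffordRes_antisymm _ _ _).trans ?_
  change _ = EvenClifford.antisymm _ (F.restrict h).be _
  rw [funext (F.restrict h).he.basis_apply]
  simp only [IsFrame.basis_apply]
  rfl

theorem mem_adjoin_iff (hm : 0 < m) (z : σ.evenCliffordSheaf.sec U) :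
    z ∈ Algebra.adjoin Γ(S, U)
      (Set.range fun p : (Fin (2 * m) → Γ(E, U)) × (Fin m → Γ(L, U)) =>
        σ.toSheaf U (EvenClifford.antisymm (σ.form U) p.1 p.2)) ↔
    ∃ r s : Γ(S, U), z = algebraMap Γ(S, U) _ r + s • σ.toSheaf U (σ.frameOmega F) := by
  let f : EvenClifford (σ.form U) →ₐ[Γ(S, U)] σ.evenCliffordSheaf.sec U :=
    { σ.toSheaf U with commutes' := fun r => σ.toSheaf_algebraMap r }
  have h1 : (Set.range fun p : (Fin (2 * m) → Γ(E, U)) × (Fin m → Γ(L, U)) =>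
        σ.toSheaf U (EvenClifford.antisymm (σ.form U) p.1 p.2)) =
      f '' Set.range fun p : (Fin (2 * m) → Γ(E, U)) × (Fin m → Γ(L, U)) =>
        EvenClifford.antisymm (σ.form U) p.1 p.2 := by
    rw [← Set.range_comp]; rfl
  rw [h1, ← AlgHom.map_adjoin, Subalgebra.mem_map]
  constructor
  · rintro ⟨y, hy, rfl⟩
    obtain ⟨r, s, rfl⟩ := (EvenClifford.mem_adjoin_antisymm_iff _ F.bl F.be (σ.symm U) hm y).1 hy
    exact ⟨r, s, by rw [map_add, map_smul, AlgHom.commutes]; rfl⟩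
  · rintro ⟨r, s, rfl⟩
    exact ⟨_, (EvenClifford.mem_adjoin_antisymm_iff _ F.bl F.be (σ.symm U) hm _).2 ⟨r, s, rfl⟩,
      by rw [map_add, map_smul, AlgHom.commutes]; rfl⟩

theorem algebraMap_add_smul_injective (hm : 0 < m) :
    Function.Injective fun q : Γ(S, U) × Γ(S, U) =>
      algebraMap Γ(S, U) (σ.evenCliffordSheaf.sec U) q.1 +
        q.2 • σ.toSheaf U (σ.frameOmega F) := by
  have h := (σ.toSheaf_bijective F).1.comp
    (EvenClifford.add_smul_omega_injective (σ.form U) F.bl F.be hm)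
  convert h using 1
  ext q
  simp only [Function.comp_apply, map_add, toSheaf_smul, toSheaf_algebraMap]

omit [∀ U : S.Opens, Algebra ℚ Γ(S, U)] in
theorem res_algebraMap_add_smul {V : S.Opens} (h : V ≤ U) (r s : Γ(S, U)) :
    σ.evenCliffordSheaf.res h (algebraMap Γ(S, U) _ r + s • σ.toSheaf U (σ.frameOmega F)) =
      algebraMap Γ(S, V) _ (S.presheaf.map (homOfLE h).op r) +
        S.presheaf.map (homOfLE h).op s • σ.toSheaf V (σ.frameOmega (F.restrict h)) := by
  rw [map_add, AlgSheaf.res_algebraMap, AlgSheaf.res_smul, res_toSheaf, cliffordRes_frameOmega]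

/-- Over an open subset with frames, the subsheaf `𝓩` has the basis `1`, `ω`. -/
theorem mem_centralPart_iff (hm : 0 < m) (z : σ.evenCliffordSheaf.sec U) :
    z ∈ σ.centralPart m U ↔
    ∃ r s : Γ(S, U), z = algebraMap Γ(S, U) _ r + s • σ.toSheaf U (σ.frameOmega F) := by
  constructor
  · intro hz
    have h1 : ∀ x : U, ∃ (V : S.Opens) (h : V ≤ U) (r s : Γ(S, V)), x.1 ∈ V ∧
        σ.evenCliffordSheaf.res h z = algebraMap Γ(S, V) _ r +
          s • σ.toSheaf V (σ.frameOmega (F.restrict h)) := by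
      intro x
      obtain ⟨V, h, hxV, hV⟩ := hz x.1 x.2
      obtain ⟨r, s, hrs⟩ := (σ.mem_adjoin_iff (F.restrict h) hm _).1 hV
      exact ⟨V, h, r, s, hxV, hrs⟩
    choose V h r s hxV hrs using h1
    have hcov : U ≤ iSup V := fun x hx => Opens.mem_iSup.2 ⟨⟨x, hx⟩, hxV ⟨x, hx⟩⟩
    have hcompat : ∀ x y,
        S.presheaf.map (homOfLE (inf_le_left : V x ⊓ V y ≤ V x)).op (r x) =
          S.presheaf.map (homOfLE (inf_le_right : V x ⊓ V y ≤ V y)).op (r y) ∧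
        S.presheaf.map (homOfLE (inf_le_left : V x ⊓ V y ≤ V x)).op (s x) =
          S.presheaf.map (homOfLE (inf_le_right : V x ⊓ V y ≤ V y)).op (s y) := by
      intro x y
      have e₁ := congrArg (σ.evenCliffordSheaf.res (inf_le_left : V x ⊓ V y ≤ V x)) (hrs x)
      have e₂ := congrArg (σ.evenCliffordSheaf.res (inf_le_right : V x ⊓ V y ≤ V y)) (hrs y)
      rw [AlgSheaf.res_res, res_algebraMap_add_smul] at e₁ e₂
      have hF : (F.restrict (h x)).restrict (inf_le_left : V x ⊓ V y ≤ V x) =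
          (F.restrict (h y)).restrict (inf_le_right : V x ⊓ V y ≤ V y) := by
        rw [Framing.restrict_restrict, Framing.restrict_restrict]
      rw [hF] at e₁
      have := σ.algebraMap_add_smul_injective ((F.restrict (h y)).restrict
        (inf_le_right : V x ⊓ V y ≤ V y)) hm (a₁ := (_, _)) (a₂ := (_, _)) (e₁.symm.trans e₂)
      exact ⟨congrArg Prod.fst this, congrArg Prod.snd this⟩
    obtain ⟨r₀, hr₀⟩ : ∃ r₀ : Γ(S, U), ∀ x, S.presheaf.map (homOfLE (h x)).op r₀ = r x :=
      (S.sheaf.existsUnique_gluing' V U (fun x => homOfLE (h x)) hcov r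
        fun x y => (hcompat x y).1).exists
    obtain ⟨s₀, hs₀⟩ : ∃ s₀ : Γ(S, U), ∀ x, S.presheaf.map (homOfLE (h x)).op s₀ = s x :=
      (S.sheaf.existsUnique_gluing' V U (fun x => homOfLE (h x)) hcov s
        fun x y => (hcompat x y).2).exists
    refine ⟨r₀, s₀, AlgSheaf.ext_of_res _ fun x hx => ⟨V ⟨x, hx⟩, h _, hxV ⟨x, hx⟩, ?_⟩⟩
    rw [hrs, res_algebraMap_add_smul, hr₀, hs₀]
  · intro hz x hx
    refine ⟨U, le_rfl, hx, ?_⟩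
    have : σ.evenCliffordSheaf.res (le_refl U) z = z := by
      have h := congrArg (fun f => f.hom z) (σ.evenCliffordSheaf.carrier.obj.map_id (op U))
      exact h
    rw [this, σ.mem_adjoin_iff F hm]
    exact hz

include F in
theorem commute_of_mem_centralPart_of_framing (hm : 0 < m) {z : σ.evenCliffordSheaf.sec U}
    (hz : z ∈ σ.centralPart m U) (a : σ.evenCliffordSheaf.sec U) : Commute z a := by
  obtain ⟨r, s, rfl⟩ := (σ.mem_centralPart_iff F hm z).1 hz
  obtain ⟨y, rfl⟩ := (σ.toSheaf_bijective F).2 a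
  refine Commute.add_left (Algebra.commutes r _) (Commute.smul_left ?_ s)
  exact (EvenClifford.commute_omega (σ.form U) (σ.symm U) F.bl F.be hm y).symm.map (σ.toSheaf U)

/-- `𝓩` is central. Commutation can be tested on restrictions to open subsets with frames, where `𝓩` is
spanned by `1` and `ω`. -/
theorem commute_of_mem_centralPart (hE : IsVectorBundle E (2 * m)) (hL : IsVectorBundle L 1)
    (hσ : σ.IsEmbedding) {z : σ.evenCliffordSheaf.sec U}
    (hz : z ∈ σ.centralPart m U) (a : σ.evenCliffordSheaf.sec U) : Commute z a := by
  refine AlgSheaf.ext_of_res _ fun x hx => ?_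
  obtain ⟨V, hxV, ⟨F⟩⟩ := Framing.exists_mem hE hL x
  refine ⟨U ⊓ V, inf_le_left, ⟨hx, hxV⟩, ?_⟩
  rw [map_mul, map_mul]
  exact σ.commute_of_mem_centralPart_of_framing (F.restrict (inf_le_right : U ⊓ V ≤ V))
    (hσ.rank_pos hE x) (σ.centralPart_res _ hz) _

/-- The map `det E ⊗ L ^ m → 𝓑₀` over an open subset with frames. -/
def antisymmMap (F : Framing E L (2 * m) U) :
    (⋀[Γ(S, U)]^(2 * m) Γ(E, U)) ⊗[Γ(S, U)] (⨂[Γ(S, U)] _ : Fin m, Γ(L, U))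
      →ₗ[Γ(S, U)] σ.evenCliffordSheaf.sec U :=
  LinearMap.toSpanSingleton _ _ (σ.toSheaf U (σ.frameOmega F)) ∘ₗ
    (EvenClifford.detCoord F.bl F.be m)

omit [∀ U : S.Opens, Algebra ℚ Γ(S, U)] in
theorem antisymmMap_apply (q) : σ.antisymmMap F q =
    EvenClifford.detCoord F.bl F.be m q • σ.toSheaf U (σ.frameOmega F) := rfl

omit [∀ U : S.Opens, Algebra ℚ Γ(S, U)] in
theorem antisymmMap_tmul (v : Fin (2 * m) → Γ(E, U)) (t : Fin m → Γ(L, U)) :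
    σ.antisymmMap F (exteriorPower.ιMulti Γ(S, U) (2 * m) v ⊗ₜ
        PiTensorProduct.tprod Γ(S, U) t) =
      σ.toSheaf U (EvenClifford.antisymm (σ.form U) v t) := by
  rw [EvenClifford.antisymm_eq_smul_omega _ F.bl F.be, toSheaf_smul]
  rw [antisymmMap_apply, EvenClifford.detCoord_tmul]

theorem subsingleton_sec_bot {X : Scheme.{u}} (A : AlgSheaf X) : Subsingleton (A.sec ⊥) :=
  ⟨fun _ _ => AlgSheaf.ext_of_res _ fun _ hx => hx.elim⟩

/-- `𝓩` is the direct sum of `𝒪_S` and `det E ⊗ L ^ m`. -/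
theorem antisymmMap_bijective (hE : IsVectorBundle E (2 * m)) (hσ : σ.IsEmbedding) :
    Function.Injective (fun q : Γ(S, U) × _ =>
      algebraMap Γ(S, U) _ q.1 + σ.antisymmMap F q.2) ∧
    Set.range (fun q : Γ(S, U) × _ => algebraMap Γ(S, U) _ q.1 + σ.antisymmMap F q.2) =
      σ.centralPart m U := by
  rcases Nat.eq_zero_or_pos m with hm | hm
  · have hU : U = ⊥ := by
      rw [eq_bot_iff]
      intro x _
      exact absurd hm (hσ.rank_pos hE x).ne'
    subst hU
    have := subsingleton_sec_bot σ.evenCliffordSheaf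
    have h1 : Subsingleton Γ(S, ⊥) := inferInstance
    have h2 : ∀ (M : Type u) [AddCommGroup M] [Module Γ(S, ⊥) M], Subsingleton M :=
      fun M _ _ => Module.subsingleton Γ(S, ⊥) M
    refine ⟨?_, ?_⟩
    · have := h2 ((⋀[Γ(S, ⊥)]^(2 * m) Γ(E, ⊥)) ⊗[Γ(S, ⊥)] (⨂[Γ(S, ⊥)] _ : Fin m, Γ(L, ⊥)))
      exact Function.injective_of_subsingleton _
    · ext z
      refine ⟨fun _ x hx => hx.elim, fun _ => ⟨0, Subsingleton.elim _ _⟩⟩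
  have hd := EvenClifford.detCoord_bijective F.bl F.be m
  constructor
  · intro q q' h
    have := σ.algebraMap_add_smul_injective F hm (a₁ := (q.1, _)) (a₂ := (q'.1, _)) h
    exact Prod.ext (Prod.ext_iff.1 this).1 (hd.1 (Prod.ext_iff.1 this).2)
  · ext z
    rw [σ.mem_centralPart_iff F hm]
    constructor
    · rintro ⟨q, rfl⟩
      exact ⟨_, _, rfl⟩
    · rintro ⟨r, s, rfl⟩
      obtain ⟨q, rfl⟩ := hd.2 s
      exact ⟨(r, q), rfl⟩

end Framed

end LineValuedForm

/-! ### Quasi-coherence and localization of sections -/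

namespace AlgebraicGeometry.Scheme.Modules

variable {X : Scheme.{u}} (M : X.Modules)

/-- The sections of `M` over `B` are the localization of the sections over `A` at `f`. -/
def IsLocalizingAt {U : X.Opens} (f : Γ(X, U)) {A B : X.Opens} (hA : A ≤ U) (hB : B ≤ A) : Prop :=
  (∀ s : Γ(M, B), ∃ (n : ℕ) (t : Γ(M, A)),
    M.presheaf.map (homOfLE hB).op t = X.presheaf.map (homOfLE (hB.trans hA)).op f ^ n • s) ∧
  ∀ t : Γ(M, A), M.presheaf.map (homOfLE hB).op t = 0 →
    ∃ n : ℕ, X.presheaf.map (homOfLE hA).op f ^ n • t = 0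

/-- The sections of `M` over the basic open subsets of `U` are localizations of the sections over
`U`. -/
def IsLocalizingOn (U : X.Opens) : Prop :=
  ∀ f : Γ(X, U), M.IsLocalizingAt f le_rfl (X.basicOpen_le f)

theorem appIso_inv_fromSpec {U : X.Opens} (hU : IsAffineOpen U) (V : (Spec Γ(X, U)).Opens)
    (hV : hU.fromSpec ''ᵁ V ≤ U) (r : Γ(X, U)) :
    (hU.fromSpec.appIso V).inv ((Spec Γ(X, U)).presheaf.map V.leTop.op
      ((Scheme.ΓSpecIso Γ(X, U)).inv r)) = X.presheaf.map (homOfLE hV).op r := by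
  have h : (Scheme.ΓSpecIso Γ(X, U)).inv ≫ (Spec Γ(X, U)).presheaf.map V.leTop.op =
      X.presheaf.map (homOfLE hV).op ≫ (hU.fromSpec.appIso V).hom := by
    rw [Scheme.Hom.appIso_hom', Scheme.Hom.map_appLE, Scheme.Hom.appLE, hU.fromSpec_app_self,
      Category.assoc, ← Functor.map_comp]
    rfl
  exact congrArg (fun g => g.hom r) ((Iso.comp_inv_eq _).2 h)

theorem smul_restrict_fromSpec {U : X.Opens} (hU : IsAffineOpen U) (V : (Spec Γ(X, U)).Opens)
    (hV : hU.fromSpec ''ᵁ V ≤ U) (r : Γ(X, U)) (x : Γ(M.restrict hU.fromSpec, V)) :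
    (r • x : Γ(M.restrict hU.fromSpec, V)) =
      (X.presheaf.map (homOfLE hV).op r • (show Γ(M, hU.fromSpec ''ᵁ V) from x) :
        Γ(M, hU.fromSpec ''ᵁ V)) := by
  rw [← appIso_inv_fromSpec hU V hV r]
  rfl

theorem isLocalizing_restrict_iff {U : X.Opens} (hU : IsAffineOpen U) :
    IsLocalizing (modulesSpecToSheaf.obj (M.restrict hU.fromSpec)) ↔ M.IsLocalizingOn U := by
  have key : ∀ (f : Γ(X, U)) (A B : X.Opens) (hA : A ≤ U) (hB : B ≤ A) (_ : A = U)
      (_ : B = X.basicOpen f),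
      M.IsLocalizingAt f hA hB ↔ M.IsLocalizingAt f le_rfl (X.basicOpen_le f) := by
    intro f A B hA hB h₁ h₂
    subst h₁ h₂
    rfl
  refine forall_congr' fun f => ?_
  have hA : hU.fromSpec ''ᵁ ⊤ = U := by
    rw [Scheme.Hom.image_top_eq_opensRange, hU.opensRange_fromSpec]
  have hB : hU.fromSpec ''ᵁ (PrimeSpectrum.basicOpen f) = X.basicOpen f :=
    hU.fromSpec_image_basicOpen f
  rw [← key f _ _ hA.le (Scheme.Hom.image_mono _ le_top) hA hB]
  have hBU := hB.le.trans (X.basicOpen_le f)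
  let N := M.restrict hU.fromSpec
  have hpow : ∀ (V : (Spec Γ(X, U)).Opens) (hV : hU.fromSpec ''ᵁ V ≤ U) (n : ℕ) (x : Γ(N, V)),
      (f ^ n • x : Γ(N, V)) = (X.presheaf.map (homOfLE hV).op f ^ n •
        (show Γ(M, hU.fromSpec ''ᵁ V) from x) : Γ(M, hU.fromSpec ''ᵁ V)) := by
    intro V hV n x
    rw [← map_pow]
    exact M.smul_restrict_fromSpec hU V hV (f ^ n) x
  constructor
  · intro h
    constructor
    · intro s
      obtain ⟨⟨t, ⟨_, n, rfl⟩⟩, ht⟩ := h.surj s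
      exact ⟨n, t, ht.symm.trans (hpow _ hBU n s)⟩
    · intro t ht
      obtain ⟨⟨_, n, rfl⟩, hn⟩ := h.exists_of_eq (x₁ := t) (x₂ := 0) (ht.trans (map_zero _).symm)
      exact ⟨n, (hpow ⊤ hA.le n t).symm.trans (hn.trans (smul_zero _))⟩
  · intro h
    refine ⟨?_, ?_, ?_⟩
    · rintro ⟨_, n, rfl⟩
      rw [map_pow]
      exact (N.isUnit_algebraMap_end_of_le_basicOpen f le_rfl).pow n
    · intro s
      obtain ⟨n, t, ht⟩ := h.1 s
      exact ⟨⟨t, ⟨_, n, rfl⟩⟩, (hpow _ hBU n s).trans ht.symm⟩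
    · intro t t' htt
      obtain ⟨n, hn⟩ := h.2 (t - t') ((map_sub _ _ _).trans (sub_eq_zero.2 htt))
      refine ⟨⟨_, n, rfl⟩, ?_⟩
      refine sub_eq_zero.1 ((smul_sub _ _ _).symm.trans ?_)
      exact (hpow ⊤ hA.le n (t - t')).trans hn

/-- Over an affine open subset a quasi-coherent module is the sheaf associated with its module of
sections, so restriction to basic open subsets is localisation. -/
theorem isLocalizingOn_of_isQuasicoherent [M.IsQuasicoherent] {U : X.Opens}
    (hU : IsAffineOpen U) : M.IsLocalizingOn U := by
  rw [← isLocalizing_restrict_iff M hU, ← isIso_fromTildeΓ_iff_isLocalizing]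
  infer_instance

/-- Transport of a presentation along an isomorphism. -/
def presentationOfIso {M N : X.Modules} (e : M ≅ N) (P : SheafOfModules.Presentation.{u, u, u} M) :
    SheafOfModules.Presentation.{u, u, u} N :=
  have : @IsIso (SheafOfModules.{u} X.ringCatSheaf) _ M N e.hom :=
    (inferInstance : IsIso e.hom)
  @SheafOfModules.Presentation.ofIsIso _ _ _ _ _ _ M N e.hom this P

theorem nonempty_presentation_of_isLocalizingOn {U : X.Opens} (hU : IsAffineOpen U)
    (h : M.IsLocalizingOn U) :
    Nonempty (SheafOfModules.Presentation.{u, u, u} (SheafOfModules.over M U)) := by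
  rw [← isLocalizing_restrict_iff M hU, ← isIso_fromTildeΓ_iff_isLocalizing] at h
  let N := M.restrict hU.fromSpec
  have : IsIso N.fromTildeΓ := h
  let P₁ : SheafOfModules.Presentation.{u, u, u} N := presentationOfIso (asIso N.fromTildeΓ)
    (presentationTilde _ .univ (by simp) _ (Submodule.span_eq _))
  let P₂ : SheafOfModules.Presentation.{u, u, u} (N.restrict hU.isoSpec.hom) :=
    presentationRestrict hU.isoSpec.hom P₁
  let e : N.restrict hU.isoSpec.hom ≅ M.restrict U.ι :=
    ((restrictFunctorComp _ _).symm ≪≫ restrictFunctorCongr hU.isoSpec_hom_fromSpec).app M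
  let P₃ : SheafOfModules.Presentation.{u, u, u} (M.restrict U.ι) := presentationOfIso e P₂
  let ψ : (overEquiv U).inverse.obj (M.restrict U.ι) ≅ SheafOfModules.over M U :=
    (overEquiv U).inverse.mapIso ((overFunctorEquiv U).symm.app M) ≪≫
      ((overEquiv U).unitIso.symm.app (SheafOfModules.over M U))
  let F : SheafOfModules.{u} U.toScheme.ringCatSheaf ⥤ SheafOfModules.{u} (X.ringCatSheaf.over U) :=
    (overEquiv U).inverse
  have : Limits.PreservesColimitsOfSize.{u, u} F :=
    (overEquiv U).symm.toAdjunction.leftAdjoint_preservesColimits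
  exact ⟨SheafOfModules.Presentation.ofIsIso.{u, u, u} ψ.hom (P₃.map F
    (Opens.sheafOfModulesEquivOverInverseUnit U X.ringCatSheaf).symm)⟩

/-- If restriction to basic open subsets is localisation on an affine neighbourhood of each point, the
module is there associated with its module of sections and has a presentation. -/
theorem isQuasicoherent_of_isLocalizingOn
    (h : ∀ x : X, ∃ U : X.Opens, x ∈ U ∧ IsAffineOpen U ∧ M.IsLocalizingOn U) :
    M.IsQuasicoherent := by
  choose U hxU hU h using h
  refine SheafOfModules.QuasicoherentData.isQuasicoherent.{u, u, u, u} (R := X.ringCatSheaf) (M := M)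
    { I := X
      X := U
      coversTop := by
        rw [Opens.coversTop_iff]
        exact eq_top_iff.2 fun x _ => Opens.mem_iSup.2 ⟨x, hxU x⟩
      presentation i := (M.nonempty_presentation_of_isLocalizingOn (hU i) (h i)).some }

end AlgebraicGeometry.Scheme.Modules

/-! ### The quasi-coherent subalgebra of central sections -/

theorem AlgSheaf.isLocalizingOn_iff {X : Scheme.{u}} (A : AlgSheaf X) (U : X.Opens) :
    A.toModules.IsLocalizingOn U ↔ ∀ f : Γ(X, U),
      (∀ s : A.sec (X.basicOpen f), ∃ (n : ℕ) (t : A.sec U), A.res (X.basicOpen_le f) t =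
        X.presheaf.map (homOfLE (X.basicOpen_le f)).op f ^ n • s) ∧
      ∀ t : A.sec U, A.res (X.basicOpen_le f) t = 0 → ∃ n : ℕ, f ^ n • t = 0 := by
  have : ∀ f : Γ(X, U), X.presheaf.map (homOfLE (le_refl U)).op f = f := by
    intro f
    have : (homOfLE (le_refl U)).op = 𝟙 (op U) := rfl
    rw [this, X.presheaf.map_id]; rfl
  refine forall_congr' fun f => and_congr Iff.rfl ?_
  simp only [this]
  rfl

theorem AlgSheaf.res_self {X : Scheme.{u}} (A : AlgSheaf X) {U : X.Opens} (a : A.sec U) :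
    A.res (le_refl U) a = a :=
  congrArg (fun f => f.hom a) (A.carrier.obj.map_id (op U))

namespace LineValuedForm

variable {S : Scheme.{u}} {E L : S.Modules} (σ : LineValuedForm E L) (m : ℕ)

/-- The central sections over `U`, as a subring. -/
def centralSubring (U : S.Opens) : Subring (σ.evenCliffordSheaf.sec U) where
  carrier := σ.centralPart m U
  mul_mem' {a b} ha hb x hx := by
    obtain ⟨V, hV, hxV, ha⟩ := ha x hx
    obtain ⟨W, hW, hxW, hb⟩ := hb x hx
    refine ⟨V ⊓ W, inf_le_left.trans hV, ⟨hxV, hxW⟩, ?_⟩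
    have h₁ := σ.res_mem_adjoin (inf_le_left : V ⊓ W ≤ V) ha
    have h₂ := σ.res_mem_adjoin (inf_le_right : V ⊓ W ≤ W) hb
    rw [AlgSheaf.res_res] at h₁ h₂
    rw [map_mul]
    exact mul_mem h₁ h₂
  add_mem' {a b} ha hb x hx := by
    obtain ⟨V, hV, hxV, ha⟩ := ha x hx
    obtain ⟨W, hW, hxW, hb⟩ := hb x hx
    refine ⟨V ⊓ W, inf_le_left.trans hV, ⟨hxV, hxW⟩, ?_⟩
    have h₁ := σ.res_mem_adjoin (inf_le_left : V ⊓ W ≤ V) ha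
    have h₂ := σ.res_mem_adjoin (inf_le_right : V ⊓ W ≤ W) hb
    rw [AlgSheaf.res_res] at h₁ h₂
    rw [map_add]
    exact add_mem h₁ h₂
  one_mem' x hx := ⟨U, le_rfl, hx, by rw [map_one]; exact one_mem _⟩
  zero_mem' x hx := ⟨U, le_rfl, hx, by rw [map_zero]; exact zero_mem _⟩
  neg_mem' {a} ha x hx := by
    obtain ⟨V, hV, hxV, ha⟩ := ha x hx
    exact ⟨V, hV, hxV, by rw [map_neg]; exact neg_mem ha⟩

theorem algebraMap_mem_centralPart {U : S.Opens} (r : Γ(S, U)) :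
    algebraMap Γ(S, U) (σ.evenCliffordSheaf.sec U) r ∈ σ.centralPart m U := fun x hx =>
  ⟨U, le_rfl, hx, by rw [AlgSheaf.res_self]; exact Subalgebra.algebraMap_mem _ r⟩

theorem mem_centralPart_of_locally {U : S.Opens} {z : σ.evenCliffordSheaf.sec U}
    (h : ∀ x ∈ U, ∃ (V : S.Opens) (hV : V ≤ U), x ∈ V ∧
      σ.evenCliffordSheaf.res hV z ∈ σ.centralPart m V) : z ∈ σ.centralPart m U := by
  intro x hx
  obtain ⟨V, hV, hxV, h⟩ := h x hx
  obtain ⟨W, hW, hxW, h⟩ := h x hxV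
  exact ⟨W, hW.trans hV, hxW, by rwa [AlgSheaf.res_res] at h⟩

/-- Restriction of central sections. -/
def centralRes {U V : S.Opens} (h : V ≤ U) : σ.centralSubring m U →+* σ.centralSubring m V :=
  (σ.evenCliffordSheaf.res h).restrict _ _ fun _ hz => σ.centralPart_res h hz

/-- The presheaf of central sections. -/
def centralPresheaf : S.Opensᵒᵖ ⥤ RingCat.{u} where
  obj U := RingCat.of (σ.centralSubring m U.unop)
  map i := RingCat.ofHom (σ.centralRes m i.unop.le)
  map_id U := by
    refine RingCat.hom_ext (RingHom.ext fun z => ?_)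
    exact Subtype.ext (AlgSheaf.res_self σ.evenCliffordSheaf z.1)
  map_comp i j := by
    refine RingCat.hom_ext (RingHom.ext fun z => ?_)
    exact Subtype.ext (AlgSheaf.res_res σ.evenCliffordSheaf i.unop.le j.unop.le z.1).symm

theorem isSheaf_centralPresheaf :
    Presheaf.IsSheaf (Opens.grothendieckTopology S) (σ.centralPresheaf m) := by
  refine (TopCat.Presheaf.isSheaf_iff_isSheaf_comp (forget RingCat.{u})
    (σ.centralPresheaf m)).2 ?_
  refine TopCat.Presheaf.isSheaf_of_isSheafUniqueGluing_types _ ?_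
  intro ι U s hs
  let F := σ.evenCliffordSheaf.carrier
  obtain ⟨t, ht, htu⟩ := TopCat.Sheaf.existsUnique_gluing F U (fun i => (s i).1) fun i j => by
    exact congrArg Subtype.val (hs i j)
  have hmem : t ∈ σ.centralPart m (iSup U) := by
    refine σ.mem_centralPart_of_locally m fun x hx => ?_
    obtain ⟨i, hi⟩ := Opens.mem_iSup.1 hx
    exact ⟨U i, le_iSup U i, hi, by
      have := ht i
      change σ.evenCliffordSheaf.res (le_iSup U i) t = (s i).1 at this
      rw [this]
      exact (s i).2⟩
  refine ⟨⟨t, hmem⟩, fun i => Subtype.ext (ht i), fun t' ht' => Subtype.ext (htu t'.1 fun i => ?_)⟩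
  exact congrArg Subtype.val (ht' i)

/-- The sheaf of algebras `𝓩`. -/
def centralSheaf : AlgSheaf S where
  carrier := ⟨σ.centralPresheaf m, σ.isSheaf_centralPresheaf m⟩
  unit := ⟨{
    app U := RingCat.ofHom ((algebraMap Γ(S, U.unop) (σ.evenCliffordSheaf.sec U.unop)).codRestrict
      (σ.centralSubring m U.unop) (σ.algebraMap_mem_centralPart m))
    naturality U V i := by
      ext r
      exact Subtype.ext (AlgSheaf.res_algebraMap _ i.unop.le r).symm }⟩
  central U r a := Subtype.ext (Algebra.commutes r a.1)

section Framed

variable [∀ U : S.Opens, Algebra ℚ Γ(S, U)] {U : S.Opens} {m}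

theorem isLocalizingOn_centralSheaf_of_framing (F : Framing E L (2 * m) U) (hm : 0 < m)
    (hU : IsAffineOpen U) : (σ.centralSheaf m).toModules.IsLocalizingOn U := by
  rw [AlgSheaf.isLocalizingOn_iff]
  intro f
  have := hU.isLocalization_basicOpen f
  let hle := S.basicOpen_le f
  let ρ := S.presheaf.map (homOfLE hle).op
  have hsurj : ∀ r : Γ(S, S.basicOpen f), ∃ (n : ℕ) (t : Γ(S, U)), ρ t = ρ f ^ n * r := by
    intro r
    obtain ⟨⟨t, ⟨_, n, rfl⟩⟩, ht⟩ := IsLocalization.surj (Submonoid.powers f) r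
    refine ⟨n, t, ?_⟩
    rw [mul_comm, ← map_pow]
    exact ht.symm
  have hinj : ∀ t : Γ(S, U), ρ t = 0 → ∃ n : ℕ, f ^ n * t = 0 := by
    intro t ht
    obtain ⟨⟨_, n, rfl⟩, hn⟩ :=
      (IsLocalization.map_eq_zero_iff (Submonoid.powers f) Γ(S, S.basicOpen f) t).1 ht
    exact ⟨n, hn⟩
  constructor
  · intro z
    obtain ⟨r, s, hz⟩ := (σ.mem_centralPart_iff (F.restrict hle) hm z.1).1 z.2
    obtain ⟨a, r₀, hr⟩ := hsurj r
    obtain ⟨b, s₀, hs⟩ := hsurj s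
    refine ⟨a + b, ⟨algebraMap Γ(S, U) _ (f ^ b * r₀) + (f ^ a * s₀) •
      σ.toSheaf U (σ.frameOmega F), (σ.mem_centralPart_iff F hm _).2 ⟨_, _, rfl⟩⟩, ?_⟩
    refine Subtype.ext ((σ.res_algebraMap_add_smul F hle _ _).trans ?_)
    have h1 : ρ (f ^ b * r₀) = ρ f ^ (a + b) * r := by rw [map_mul, hr, map_pow]; ring
    have h2 : ρ (f ^ a * s₀) = ρ f ^ (a + b) * s := by rw [map_mul, hs, map_pow]; ring
    change algebraMap _ _ (ρ _) + ρ _ • _ = ρ f ^ (a + b) • z.1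
    rw [h1, h2, hz, smul_add, smul_smul, map_mul]
    congr 1
  · intro z hz
    obtain ⟨r, s, hrs⟩ := (σ.mem_centralPart_iff F hm z.1).1 z.2
    have h0 : σ.evenCliffordSheaf.res hle z.1 = 0 := congrArg Subtype.val hz
    rw [hrs, σ.res_algebraMap_add_smul F hle] at h0
    have h1 := σ.algebraMap_add_smul_injective (F.restrict hle) hm (a₁ := (ρ r, ρ s))
      (a₂ := (0, 0)) (h0.trans (by simp))
    obtain ⟨a, ha⟩ := hinj r (Prod.ext_iff.1 h1).1
    obtain ⟨b, hb⟩ := hinj s (Prod.ext_iff.1 h1).2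
    refine ⟨a + b, Subtype.ext ?_⟩
    change f ^ (a + b) • z.1 = 0
    rw [hrs, smul_add, smul_smul, Algebra.smul_def, ← map_mul, pow_add,
      show f ^ a * f ^ b * r = f ^ b * (f ^ a * r) by ring, ha,
      show f ^ a * f ^ b * s = f ^ a * (f ^ b * s) by ring, hb]
    simp

theorem isLocalizingOn_centralSheaf (hE : IsVectorBundle E (2 * m)) (hL : IsVectorBundle L 1)
    (hσ : σ.IsEmbedding) (hU : IsAffineOpen U) :
    (σ.centralSheaf m).toModules.IsLocalizingOn U := by
  have : (σ.centralSheaf m).toModules.IsQuasicoherent := by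
    refine Scheme.Modules.isQuasicoherent_of_isLocalizingOn _ fun x => ?_
    obtain ⟨V, hxV, ⟨F⟩⟩ := Framing.exists_mem hE hL x
    obtain ⟨W, hW, hxW, hWV⟩ := Opens.isBasis_iff_nbhd.1 S.isBasis_affineOpens hxV
    exact ⟨W, hxW, hW, σ.isLocalizingOn_centralSheaf_of_framing (F.restrict hWV)
      (hσ.rank_pos hE x) hW⟩
  exact Scheme.Modules.isLocalizingOn_of_isQuasicoherent _ hU

end Framed

section Cover

variable {m : ℕ} (hcomm : ∀ (U : S.Opens), ∀ z ∈ σ.centralPart m U, ∀ a, Commute z a)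
include hcomm

/-- The ring of central sections is commutative. -/
abbrev centralCommRing (U : S.Opens) : CommRing (σ.centralSubring m U) where
  mul_comm x y := Subtype.ext (hcomm U x.1 x.2 y.1)

/-- The presheaf of commutative rings `𝓩`. -/
def centralCommPresheaf : S.Opensᵒᵖ ⥤ CommRingCat.{u} where
  obj U := letI := σ.centralCommRing hcomm U.unop; CommRingCat.of (σ.centralSubring m U.unop)
  map {U V} i := letI := σ.centralCommRing hcomm U.unop; letI := σ.centralCommRing hcomm V.unop
    CommRingCat.ofHom (σ.centralRes m i.unop.le)
  map_id U := by
    refine CommRingCat.hom_ext (RingHom.ext fun z => ?_)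
    exact Subtype.ext (AlgSheaf.res_self σ.evenCliffordSheaf z.1)
  map_comp i j := by
    refine CommRingCat.hom_ext (RingHom.ext fun z => ?_)
    exact Subtype.ext (AlgSheaf.res_res σ.evenCliffordSheaf i.unop.le j.unop.le z.1).symm

/-- The structure morphism of `𝓩`. -/
def centralCommUnit : S.presheaf ⟶ σ.centralCommPresheaf hcomm where
  app U := letI := σ.centralCommRing hcomm U.unop
    CommRingCat.ofHom ((algebraMap Γ(S, U.unop) (σ.evenCliffordSheaf.sec U.unop)).codRestrict
      (σ.centralSubring m U.unop) (σ.algebraMap_mem_centralPart m))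
  naturality U V i := by
    refine CommRingCat.hom_ext (RingHom.ext fun r => ?_)
    exact Subtype.ext (AlgSheaf.res_algebraMap _ i.unop.le r).symm

open Scheme.AffineZariskiSite in
/-- Over affine open subsets, restriction of `𝓩` to a basic open subset is localisation; this is what
allows the spectra of the algebras of sections to be glued. -/
theorem coequifibered_centralCommUnit
    (hloc : ∀ U : S.Opens, IsAffineOpen U → (σ.centralSheaf m).toModules.IsLocalizingOn U) :
    ((toOpensFunctor S).op.whiskerLeft (σ.centralCommUnit hcomm)).Coequifibered := by
  refine coequifibered_iff_forall_isLocalizationAway.mpr fun U f => ?_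
  let : CommRing (σ.centralSubring m U.1) := σ.centralCommRing hcomm U.1
  let : CommRing (σ.centralSubring m (S.basicOpen f)) := σ.centralCommRing hcomm _
  let : Algebra (σ.centralSubring m U.1) (σ.centralSubring m (S.basicOpen f)) :=
    (σ.centralRes m (S.basicOpen_le f)).toAlgebra
  let g : σ.centralSubring m U.1 := ⟨algebraMap _ _ f, σ.algebraMap_mem_centralPart m f⟩
  have hres : ∀ x : σ.centralSubring m U.1,
    algebraMap _ (σ.centralSubring m (S.basicOpen f)) x = σ.centralRes m (S.basicOpen_le f) x :=
    fun _ => rfl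
  change IsLocalization.Away g (σ.centralSubring m (S.basicOpen f))
  have h := (AlgSheaf.isLocalizingOn_iff _ _).1 (hloc U.1 U.2) f
  have hpow : ∀ (n : ℕ) (z : σ.centralSubring m U.1), (g ^ n * z).1 = f ^ n • z.1 := by
    intro n z
    rw [Algebra.smul_def, map_pow]; rfl
  have hg : algebraMap _ (σ.centralSubring m (S.basicOpen f)) g =
      ⟨algebraMap _ _ (S.presheaf.map (homOfLE (S.basicOpen_le f)).op f),
        σ.algebraMap_mem_centralPart m _⟩ :=
    Subtype.ext (AlgSheaf.res_algebraMap _ (S.basicOpen_le f) f)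
  have hpow' : ∀ (n : ℕ) (z : σ.centralSubring m (S.basicOpen f)),
      (algebraMap _ (σ.centralSubring m (S.basicOpen f)) g ^ n * z).1 =
        S.presheaf.map (homOfLE (S.basicOpen_le f)).op f ^ n • z.1 := by
    intro n z
    rw [Algebra.smul_def, map_pow, hg]; rfl
  refine { map_units := ?_, surj := ?_, exists_of_eq := ?_ }
  · rintro ⟨_, n, rfl⟩
    rw [map_pow]
    refine IsUnit.pow n ?_
    have hu : IsUnit (S.presheaf.map (homOfLE (S.basicOpen_le f)).op f) :=
      RingedSpace.isUnit_res_basicOpen _ f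
    have := hu.map ((algebraMap Γ(S, S.basicOpen f)
      (σ.evenCliffordSheaf.sec (S.basicOpen f))).codRestrict
        (σ.centralSubring m (S.basicOpen f)) (σ.algebraMap_mem_centralPart m))
    rw [hg]
    exact this
  · intro z
    obtain ⟨n, t, ht⟩ := h.1 z
    refine ⟨⟨t, ⟨_, n, rfl⟩⟩, ?_⟩
    rw [map_pow, mul_comm]
    refine Subtype.ext ((hpow' n z).trans ?_)
    exact (congrArg Subtype.val ht).symm
  · intro x y hxy
    obtain ⟨n, hn⟩ := h.2 (x - y) ((map_sub _ _ _).trans (sub_eq_zero.2 hxy))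
    refine ⟨⟨_, n, rfl⟩, ?_⟩
    refine sub_eq_zero.1 ((mul_sub _ _ _).symm.trans ?_)
    exact Subtype.ext ((hpow n (x - y)).trans (congrArg Subtype.val hn))

end Cover

end LineValuedForm

/-! ### The relative spectrum of the central subalgebra -/

section RelativeSpec

open Scheme.AffineZariskiSite

theorem appLE_comp_appLE_of_eq {X Y Z : Scheme.{u}} {f : X ⟶ Y} {g : Y ⟶ Z} {h : X ⟶ Z}
    (hfg : f ≫ g = h) (U : Z.Opens) (V : Y.Opens) (W : X.Opens) (e₁ : V ≤ g ⁻¹ᵁ U)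
    (e₂ : W ≤ f ⁻¹ᵁ V) (e₃ : W ≤ h ⁻¹ᵁ U) :
    g.appLE U V e₁ ≫ f.appLE V W e₂ = h.appLE U W e₃ := by
  subst hfg
  exact Scheme.Hom.appLE_comp_appLE _ _ _ _ _ _ _

theorem isAffineOpen_toOpens {S : Scheme.{u}} (U : S.AffineZariskiSite) :
    IsAffineOpen U.toOpens := U.2

variable {S : Scheme.{u}} {𝒵 : S.Opensᵒᵖ ⥤ CommRingCat.{u}} {α : S.presheaf ⟶ 𝒵}
  (H : ((toOpensFunctor S).op.whiskerLeft α).Coequifibered)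

/-- The gluing datum of the relative spectrum. -/
def relativeSpecData : (directedCover S).RelativeGluingData := relativeGluingData H

instance : ((relativeSpecData H).functor ⋙ Scheme.forget).IsLocallyDirected :=
  Scheme.Cover.RelativeGluingData.instIsLocallyDirectedI₀CompFunctorForgetOfIsThin ..

instance {U V : (directedCover S).I₀} (h : U ⟶ V) :
    IsOpenImmersion ((relativeSpecData H).functor.map h) :=
  Scheme.Cover.RelativeGluingData.instIsOpenImmersionMapI₀Functor ..

/-- The relative spectrum of a quasi-coherent algebra. -/
def relativeSpec : Scheme.{u} := (relativeSpecData H).glued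

/-- The projection of the relative spectrum. -/
def relativeSpecProj : relativeSpec H ⟶ S := (relativeSpecData H).toBase

/-- The charts of the relative spectrum. -/
def relativeSpecι (U : S.AffineZariskiSite) : Spec (𝒵.obj (op U.toOpens)) ⟶ relativeSpec H :=
  (relativeSpecData H).cover.f U

instance (U : S.AffineZariskiSite) : IsOpenImmersion (relativeSpecι H U) :=
  (relativeSpecData H).cover.map_prop U

theorem relativeSpecι_proj (U : S.AffineZariskiSite) :
    relativeSpecι H U ≫ relativeSpecProj H = Spec.map (α.app (op U.toOpens)) ≫ (isAffineOpen_toOpens U).fromSpec :=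
  (Limits.colimit.ι_desc _ _).trans (Category.assoc _ _ _)

theorem relativeSpecι_map {U V : S.AffineZariskiSite} (h : V ≤ U) :
    Spec.map (𝒵.map (homOfLE (toOpens_mono h)).op) ≫ relativeSpecι H U = relativeSpecι H V :=
  Limits.colimit.w (relativeSpecData H).functor (homOfLE h)

theorem relativeSpecProj_preimage (U : S.AffineZariskiSite) :
    relativeSpecProj H ⁻¹ᵁ U.toOpens = (relativeSpecι H U).opensRange := by
  have := (relativeSpecData H).toBase_preimage_eq_opensRange_ι U
  have h : ((directedCover S).f U).opensRange = U.toOpens := U.toOpens.opensRange_ι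
  rw [h] at this
  exact this

theorem isAffineHom_relativeSpecProj : IsAffineHom (relativeSpecProj H) where
  isAffine_preimage U hU := by
    let V : S.AffineZariskiSite := ⟨U, hU⟩
    exact (relativeSpecProj_preimage H V).symm ▸ isAffineOpen_opensRange (relativeSpecι H V)

theorem top_le_preimage (U : S.AffineZariskiSite) :
    ⊤ ≤ relativeSpecι H U ⁻¹ᵁ (relativeSpecProj H ⁻¹ᵁ U.toOpens) := by
  rw [relativeSpecProj_preimage]
  intro x _
  exact ⟨x, rfl⟩

/-- The sections of the structure sheaf of the relative spectrum over the preimage of an affine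
open subset. -/
def relativeSpecΓ (U : S.AffineZariskiSite) :
    Γ(relativeSpec H, relativeSpecProj H ⁻¹ᵁ U.toOpens) ⟶ 𝒵.obj (op U.toOpens) :=
  (relativeSpecι H U).appLE _ ⊤ (top_le_preimage H U) ≫ (Scheme.ΓSpecIso _).hom

instance (U : S.AffineZariskiSite) : IsIso (relativeSpecΓ H U) := by
  have : IsIso ((relativeSpecι H U).app (relativeSpecProj H ⁻¹ᵁ U.toOpens)) :=
    (relativeSpecι H U).isIso_app _ (relativeSpecProj_preimage H U).le
  have h : relativeSpecι H U ⁻¹ᵁ (relativeSpecProj H ⁻¹ᵁ U.toOpens) = ⊤ :=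
    top_le_iff.1 (top_le_preimage H U)
  have : IsIso (homOfLE (top_le_preimage H U)) :=
    ⟨homOfLE h.le, Subsingleton.elim _ _, Subsingleton.elim _ _⟩
  unfold relativeSpecΓ Scheme.Hom.appLE
  infer_instance

theorem app_relativeSpecΓ (U : S.AffineZariskiSite) :
    (relativeSpecProj H).app U.toOpens ≫ relativeSpecΓ H U = α.app (op U.toOpens) := by
  have e₁ : ⊤ ≤ (isAffineOpen_toOpens U).fromSpec ⁻¹ᵁ U.toOpens := by
    rw [(isAffineOpen_toOpens U).fromSpec_preimage_self]
  have h1 : (isAffineOpen_toOpens U).fromSpec.appLE U.toOpens ⊤ e₁ =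
      (Scheme.ΓSpecIso Γ(S, U.toOpens)).inv := by
    rw [Scheme.Hom.appLE, (isAffineOpen_toOpens U).fromSpec_app_self, Category.assoc,
      ← Functor.map_comp]
    exact (congrArg _ ((Spec Γ(S, U.toOpens)).presheaf.map_id _)).trans (Category.comp_id _)
  have h2 := appLE_comp_appLE_of_eq (relativeSpecι_proj H U) U.toOpens _ ⊤ le_rfl
    (top_le_preimage H U) (le_top.trans (Scheme.Hom.preimage_mono
      (Spec.map (α.app (op U.toOpens))) e₁))
  have h3 := appLE_comp_appLE_of_eq (f := Spec.map (α.app (op U.toOpens)))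
    (g := (isAffineOpen_toOpens U).fromSpec) rfl U.toOpens ⊤ ⊤ e₁ le_top
    (le_top.trans (Scheme.Hom.preimage_mono _ e₁))
  have h4 : (Spec.map (α.app (op U.toOpens))).appLE ⊤ ⊤ le_top ≫ (Scheme.ΓSpecIso _).hom =
      (Scheme.ΓSpecIso _).hom ≫ α.app (op U.toOpens) := by
    rw [← Scheme.ΓSpecIso_naturality, Scheme.Hom.appTop, Scheme.Hom.app_eq_appLE]
    rfl
  have h5 : (relativeSpecProj H).app U.toOpens =
    (relativeSpecProj H).appLE U.toOpens _ le_rfl := Scheme.Hom.app_eq_appLE _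
  rw [h5]
  refine (Category.assoc _ _ _).symm.trans ((congrArg (· ≫ (Scheme.ΓSpecIso _).hom)
    (h2.trans h3.symm)).trans ?_)
  refine (Category.assoc _ _ _).trans ((congrArg _ h4).trans ?_)
  rw [h1, Iso.inv_hom_id_assoc]

theorem relativeSpecΓ_map {U V : S.AffineZariskiSite} (h : V ≤ U) :
    (relativeSpec H).presheaf.map (homOfLE ((relativeSpecProj H).preimage_mono
      (toOpens_mono h))).op ≫ relativeSpecΓ H V =
    relativeSpecΓ H U ≫ 𝒵.map (homOfLE (toOpens_mono h)).op := by
  have h4 : (Spec.map (𝒵.map (homOfLE (toOpens_mono h)).op)).appLE ⊤ ⊤ le_top ≫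
      (Scheme.ΓSpecIso _).hom =
      (Scheme.ΓSpecIso _).hom ≫ 𝒵.map (homOfLE (toOpens_mono h)).op := by
    rw [← Scheme.ΓSpecIso_naturality, Scheme.Hom.appTop, Scheme.Hom.app_eq_appLE]
    rfl
  have h2 := appLE_comp_appLE_of_eq (relativeSpecι_map H h) (relativeSpecProj H ⁻¹ᵁ U.toOpens) ⊤ ⊤
    (top_le_preimage H U) le_top ((top_le_preimage H V).trans (Scheme.Hom.preimage_mono _
      (Scheme.Hom.preimage_mono _ (toOpens_mono h))))
  refine Eq.trans ?_ (congrArg _ h4 |>.trans (Category.assoc _ _ _).symm)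
  refine Eq.trans ?_ ((congrArg (· ≫ (Scheme.ΓSpecIso _).hom) h2.symm).trans
    (Category.assoc _ _ _))
  exact Scheme.Hom.map_appLE_assoc _ _ _ _

end RelativeSpec

namespace LineValuedForm

variable {S : Scheme.{u}} {E L : S.Modules} (σ : LineValuedForm E L) (m : ℕ)

/-- An affine morphism `φ : S̃ ⟶ S` with an identification of `φ_* 𝒪_S̃` with the subalgebra `𝓩` of
`𝓑₀`. -/
structure CentralCover where
  /-- the scheme `S̃` -/
  cover : Scheme.{u}
  /-- the projection `φ` -/
  proj : cover ⟶ S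
  isAffineHom : IsAffineHom proj
  /-- the embedding of `φ_* 𝒪_S̃` into `𝓑₀` -/
  hom (U : S.Opens) : Γ(cover, proj ⁻¹ᵁ U) →+* σ.evenCliffordSheaf.sec U
  hom_res {U V : S.Opens} (h : V ≤ U) (r : Γ(cover, proj ⁻¹ᵁ U)) :
    hom V (cover.presheaf.map (homOfLE (proj.preimage_mono h)).op r) =
      σ.evenCliffordSheaf.res h (hom U r)
  hom_app {U : S.Opens} (r : Γ(S, U)) : hom U (proj.app U r) = algebraMap Γ(S, U) _ r
  injective (U : S.Opens) : Function.Injective (hom U)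
  range_eq (U : S.Opens) : Set.range (hom U) = σ.centralPart m U

/-- The covering underlying a central reduction. -/
def CentralReduction.toCentralCover {σ : LineValuedForm E L} {m : ℕ} (C : σ.CentralReduction m) :
    σ.CentralCover m where
  cover := C.cover
  proj := C.proj
  isAffineHom := C.isAffineHom
  hom U := (C.iso.app U).comp (algebraMap Γ(C.cover, C.proj ⁻¹ᵁ U) (C.alg.sec (C.proj ⁻¹ᵁ U)))
  hom_res {U V} h r := by
    have h1 := AlgSheaf.res_algebraMap C.alg (C.proj.preimage_mono h) r
    refine (congrArg (C.iso.app V) h1.symm).trans ?_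
    exact NatTrans.naturality_apply C.iso.ringIso.hom.hom (homOfLE h).op _
  hom_app {U} r := by
    have h := congrArg (fun f => (f.hom.app (op U)).hom r) C.iso.unit_comp
    exact h
  injective := C.injective
  range_eq := C.range_eq

variable {m} in
open Scheme.AffineZariskiSite in
/-- The relative spectrum of `𝓩`. Its functions over preimages of affine open subsets are sections of
`𝓩`; since affine open subsets form a basis and all presheaves involved are sheaves, this
identification extends to all open subsets. -/
theorem nonempty_centralCover (hcomm : ∀ (U : S.Opens), ∀ z ∈ σ.centralPart m U, ∀ a, Commute z a)
    (hloc : ∀ U : S.Opens, IsAffineOpen U → (σ.centralSheaf m).toModules.IsLocalizingOn U) :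
    Nonempty (σ.CentralCover m) := by
  let H := σ.coequifibered_centralCommUnit hcomm hloc
  let X := relativeSpec H
  let φ : X ⟶ S := relativeSpecProj H
  let ℱ : S.Opensᵒᵖ ⥤ RingCat.{u} := (Opens.map φ.base).op ⋙ X.ringCatSheaf.obj
  let β : (toOpensFunctor S).op ⋙ ℱ ⟶ (toOpensFunctor S).op ⋙ σ.evenCliffordSheaf.carrier.obj :=
    { app U := RingCat.ofHom ((σ.centralSubring m U.unop.toOpens).subtype.comp
        (relativeSpecΓ H U.unop).hom)
      naturality U V i := by
        refine RingCat.hom_ext (RingHom.ext fun r => ?_)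
        exact congrArg (fun f => (f.hom r : σ.centralSubring m V.unop.toOpens).1)
          (relativeSpecΓ_map H i.unop.le) }
  let γ : ℱ ⟶ σ.evenCliffordSheaf.carrier.obj :=
    Functor.IsCoverDense.restrictHomEquivHom (G := toOpensFunctor S) β
  have hγ : Functor.whiskerLeft (toOpensFunctor S).op γ = β :=
    Functor.IsCoverDense.restrictHomEquivHom.left_inv β
  have hγU (U : S.AffineZariskiSite) (r : Γ(X, φ ⁻¹ᵁ U.toOpens)) :
      (γ.app (op U.toOpens)).hom r =
        (show σ.centralSubring m U.toOpens from (relativeSpecΓ H U).hom r).1 :=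
    congrArg (fun f => (f.app (op U)).hom r) hγ
  have hres {U V : S.Opens} (h : V ≤ U) (r : Γ(X, φ ⁻¹ᵁ U)) :
      (γ.app (op V)).hom (X.presheaf.map (homOfLE (φ.preimage_mono h)).op r) =
        σ.evenCliffordSheaf.res h ((γ.app (op U)).hom r) :=
    NatTrans.naturality_apply γ (homOfLE h).op r
  have hbij (U : S.AffineZariskiSite) : Function.Bijective (relativeSpecΓ H U).hom :=
    ConcreteCategory.bijective_of_isIso (relativeSpecΓ H U)
  have hinjU (U : S.AffineZariskiSite) : Function.Injective (γ.app (op U.toOpens)).hom := by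
    intro r r' h
    exact (hbij U).1 (Subtype.ext ((hγU U r).symm.trans (h.trans (hγU U r'))))
  have hcov (U : S.Opens) (x : U) : ∃ V : S.AffineZariskiSite, x.1 ∈ V.toOpens ∧
      V.toOpens ≤ U := by
    obtain ⟨W, hW, hxW, hWU⟩ := Opens.isBasis_iff_nbhd.1 S.isBasis_affineOpens x.2
    exact ⟨⟨W, hW⟩, hxW, hWU⟩
  have hinj (U : S.Opens) : Function.Injective (γ.app (op U)).hom := by
    intro r r' h
    choose V hxV hVU using hcov U
    refine X.sheaf.eq_of_locally_eq' (fun x : U => φ ⁻¹ᵁ (V x).toOpens) (φ ⁻¹ᵁ U)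
      (fun x => homOfLE (φ.preimage_mono (hVU x))) ?_ _ _ fun x => ?_
    · intro y hy
      exact Opens.mem_iSup.2 ⟨⟨φ y, hy⟩, hxV ⟨φ y, hy⟩⟩
    · refine hinjU (V x) ((hres (hVU x) r).trans (Eq.trans ?_ (hres (hVU x) r').symm))
      exact congrArg _ h
  refine ⟨⟨X, φ, isAffineHom_relativeSpecProj H, fun U => (γ.app (op U)).hom, hres, ?_, hinj, ?_⟩⟩
  · intro U r
    refine AlgSheaf.ext_of_res _ fun x hx => ?_
    obtain ⟨V, hxV, hVU⟩ := hcov U ⟨x, hx⟩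
    refine ⟨V.toOpens, hVU, hxV, ?_⟩
    rw [AlgSheaf.res_algebraMap]
    have h1 : X.presheaf.map (homOfLE (φ.preimage_mono hVU)).op (φ.app U r) =
        φ.app V.toOpens (S.presheaf.map (homOfLE hVU).op r) :=
      (congrArg (fun f => f.hom r) (φ.naturality (homOfLE hVU).op)).symm
    have h2 := congrArg (fun f => f.hom (S.presheaf.map (homOfLE hVU).op r))
      (app_relativeSpecΓ H V)
    refine (hres hVU _).symm.trans ((congrArg _ h1).trans ((hγU V _).trans ?_))
    exact congrArg (fun z : σ.centralSubring m V.toOpens => z.1) h2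
  · intro U
    apply Set.Subset.antisymm
    · rintro _ ⟨r, rfl⟩
      refine σ.mem_centralPart_of_locally m fun x hx => ?_
      obtain ⟨V, hxV, hVU⟩ := hcov U ⟨x, hx⟩
      refine ⟨V.toOpens, hVU, hxV, ?_⟩
      have h1 := (hres hVU r).symm.trans (hγU V _)
      exact h1 ▸ Subtype.property _
    · intro z hz
      choose V hxV hVU using hcov U
      have h1 (x : U) : ∃ r : Γ(X, φ ⁻¹ᵁ (V x).toOpens),
          (γ.app (op (V x).toOpens)).hom r = σ.evenCliffordSheaf.res (hVU x) z := by
        obtain ⟨r, hr⟩ := (hbij (V x)).2 (⟨_, σ.centralPart_res (hVU x) hz⟩ :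
          σ.centralSubring m (V x).toOpens)
        exact ⟨r, (hγU _ r).trans (congrArg (fun z : σ.centralSubring m (V x).toOpens => z.1) hr)⟩
      choose r hr using h1
      obtain ⟨t, ht⟩ : ∃ t : Γ(X, φ ⁻¹ᵁ U), ∀ x : U,
          X.presheaf.map (homOfLE (φ.preimage_mono (hVU x))).op t = r x := by
        refine (X.sheaf.existsUnique_gluing' (fun x : U => φ ⁻¹ᵁ (V x).toOpens) (φ ⁻¹ᵁ U)
          (fun x => homOfLE (φ.preimage_mono (hVU x))) ?_ r fun x y => ?_).exists
        · intro y hy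
          exact Opens.mem_iSup.2 ⟨⟨φ y, hy⟩, hxV ⟨φ y, hy⟩⟩
        · apply hinj ((V x).toOpens ⊓ (V y).toOpens)
          refine (hres inf_le_left (r x)).trans (Eq.trans ?_ (hres inf_le_right (r y)).symm)
          rw [hr, hr, AlgSheaf.res_res, AlgSheaf.res_res]
      refine ⟨t, AlgSheaf.ext_of_res _ fun x hx => ⟨(V ⟨x, hx⟩).toOpens, hVU _, hxV ⟨x, hx⟩, ?_⟩⟩
      rw [← hr ⟨x, hx⟩, ← ht ⟨x, hx⟩]
      exact (hres (hVU ⟨x, hx⟩) t).symm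

end LineValuedForm

/-! ### The double covering and its ramification -/

section Local

instance isZariskiLocalAtTarget_isFinite :
    IsZariskiLocalAtTarget (@IsFinite : MorphismProperty Scheme.{u}) :=
  have : HasAffineProperty (@IsFinite : MorphismProperty Scheme.{u})
      (affineAnd RingHom.Finite) :=
    (HasAffineProperty.affineAnd_iff (P := @IsFinite) RingHom.finite_respectsIso
      RingHom.finite_localizationPreserves.away RingHom.finite_ofLocalizationSpan).2
      fun f => by simp [isFinite_iff]
  HasAffineProperty.instIsZariskiLocalAtTarget (P := @IsFinite)
    (Q := affineAnd RingHom.Finite)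

instance isZariskiLocalAtTarget_flat :
    IsZariskiLocalAtTarget (@Flat : MorphismProperty Scheme.{u}) :=
  HasRingHomProperty.instIsZariskiLocalAtTarget (P := @Flat)

instance isZariskiLocalAtTarget_etale :
    IsZariskiLocalAtTarget (@Etale : MorphismProperty Scheme.{u}) :=
  HasRingHomProperty.instIsZariskiLocalAtTarget (P := @Etale)

instance isZariskiLocalAtTarget_locallyOfFinitePresentation :
    IsZariskiLocalAtTarget (@LocallyOfFinitePresentation : MorphismProperty Scheme.{u}) :=
  HasRingHomProperty.instIsZariskiLocalAtTarget (P := @LocallyOfFinitePresentation)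

end Local

section Affine

/-- The spectrum takes isomorphic ring homomorphisms to isomorphic morphisms. -/
def specArrowIso {A B A' B' : CommRingCat.{u}} {f : A ⟶ B} {g : A' ⟶ B'}
    (e : Arrow.mk f ≅ Arrow.mk g) : Arrow.mk (Spec.map f) ≅ Arrow.mk (Spec.map g) :=
  Arrow.isoMk (Scheme.Spec.mapIso (Arrow.rightFunc.mapIso e).symm.op)
    (Scheme.Spec.mapIso (Arrow.leftFunc.mapIso e).symm.op)
    ((Spec.map_comp _ _).symm.trans ((congrArg Spec.map (Arrow.w e.inv)).symm.trans
      (Spec.map_comp _ _)))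

variable {X Y : Scheme.{u}} (f : X ⟶ Y) [IsAffineHom f]

/-- An affine morphism is, over an affine open subset, the spectrum of its map on sections. -/
def morphismRestrictIsoSpec {U : Y.Opens} (hU : IsAffineOpen U) :
    Arrow.mk (f ∣_ U) ≅ Arrow.mk (Spec.map (f.app U)) :=
  have : IsAffine U := hU
  have : IsAffine (f ⁻¹ᵁ U) := hU.preimage f
  arrowIsoSpecΓOfIsAffine (f ∣_ U) ≪≫
    eqToIso (by rw [Scheme.Hom.resLE_eq_morphismRestrict]) ≪≫
    specArrowIso (arrowResLEAppIso f U (f ⁻¹ᵁ U) le_rfl) ≪≫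
    eqToIso (by rw [Scheme.Hom.app_eq_appLE])

omit [IsAffineHom f] in
theorem morphismRestrict_iff_of_iSup_eq (P : MorphismProperty Scheme.{u})
    [IsZariskiLocalAtTarget P] {ι : Type*} (V : Y.Opens) (U : ι → Y.Opens) (hU : iSup U = V) :
    P (f ∣_ V) ↔ ∀ i, P (f ∣_ U i) := by
  have hUV (i : ι) : U i ≤ V := hU ▸ le_iSup U i
  have h : ⨆ i, V.ι ⁻¹ᵁ U i = ⊤ := by
    rw [← Scheme.Hom.preimage_iSup, hU]
    exact V.ι_preimage_self
  rw [IsZariskiLocalAtTarget.iff_of_iSup_eq_top (P := P) _ h]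
  refine forall_congr' fun i => ?_
  have h1 : V.ι ''ᵁ V.ι ⁻¹ᵁ U i = U i := by
    rw [Scheme.Hom.image_preimage_eq_opensRange_inf, Scheme.Opens.opensRange_ι,
      inf_eq_right.2 (hUV i)]
  exact P.arrow_mk_iso_iff (morphismRestrictRestrict f V (V.ι ⁻¹ᵁ U i) ≪≫ morphismRestrictEq f h1)

omit [IsAffineHom f] in
theorem finrank_eq_of_app [Flat f] [IsFinite f] {n : ℕ} (y : Y) {U : Y.Opens}
    (hU : IsAffineOpen U) (hy : y ∈ U)
    (h : ∀ p : PrimeSpectrum Γ(Y, U), (Spec.map (f.app U)).finrank p = n) :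
    f.finrank y = n := by
  let e := morphismRestrictIsoSpec f hU
  have h1 := (isPullback_morphismRestrict f U).flip
  have h2 := Scheme.Hom.finrank_of_isPullback _ _ _ _ h1 ⟨y, hy⟩
  have hflat : MorphismProperty.RespectsIso (@Flat : MorphismProperty Scheme.{u}) :=
    MorphismProperty.IsLocalAtTarget.toRespects (P := @Flat) Scheme.zariskiPrecoverage
  have hfin : MorphismProperty.RespectsIso (@IsFinite : MorphismProperty Scheme.{u}) :=
    MorphismProperty.IsLocalAtTarget.toRespects (P := @IsFinite) Scheme.zariskiPrecoverage
  have : Flat (Spec.map (f.app U)) :=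
    (MorphismProperty.arrow_mk_iso_iff (P := @Flat) e).1 inferInstance
  have : IsFinite (Spec.map (f.app U)) :=
    (MorphismProperty.arrow_mk_iso_iff (P := @IsFinite) e).1 inferInstance
  have h3 : IsPullback e.hom.left (f ∣_ U) (Spec.map (f.app U)) e.hom.right :=
    IsPullback.of_horiz_isIso ⟨Arrow.w e.hom⟩
  have h5 := Scheme.Hom.finrank_of_isPullback _ _ _ _ h3 ⟨y, hy⟩
  exact h2.symm.trans (h5.trans (h _))

end Affine

namespace EvenClifford

variable {R E L : Type u} [CommRing R] [AddCommGroup E] [Module R E] [AddCommGroup L] [Module R L]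

/-- A minor of maximal size is a multiple of the discriminant. -/
theorem det_minor (b : E →ₗ[R] E →ₗ[R] L →ₗ[R] R) (l : Module.Basis (Fin 1) R L) {n : ℕ}
    (e : Module.Basis (Fin n) R E) (v w : Fin n → E) (t : Fin n → L) :
    (Matrix.of fun i j => b (v i) (w j) (t i)).det =
      (gram b l e).det * (e.det v * e.det w * ∏ i, lineEquiv l (t i)) := by
  have h : (Matrix.of fun i j => b (v i) (w j) (t i)) =
      Matrix.diagonal (fun i => lineEquiv l (t i)) *
        ((e.toMatrix v).transpose * gram b l e * e.toMatrix w) := by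
    ext i j
    have ht : t i = lineEquiv l (t i) • l 0 := by
      rw [← lineEquiv_symm_one, ← map_smul, smul_eq_mul, mul_one, LinearEquiv.symm_apply_apply]
    rw [Matrix.diagonal_mul]
    conv_lhs => rw [Matrix.of_apply, ht, ← e.sum_repr (v i), ← e.sum_repr (w j)]
    simp only [map_sum, map_smul, LinearMap.sum_apply, LinearMap.smul_apply, smul_eq_mul,
      Matrix.mul_apply, Matrix.transpose_apply, Module.Basis.toMatrix_apply, gram, Matrix.of_apply,
      Finset.sum_mul, Finset.mul_sum]
    exact Finset.sum_congr rfl fun x _ => Finset.sum_congr rfl fun y _ => by ring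
  rw [h, Matrix.det_mul, Matrix.det_mul, Matrix.det_mul, Matrix.det_transpose, Matrix.det_diagonal,
    Module.Basis.det_apply, Module.Basis.det_apply]
  ring

theorem isUnit_discr_iff [Algebra ℚ R] {m : ℕ} (b : E →ₗ[R] E →ₗ[R] L →ₗ[R] R)
    (l : Module.Basis (Fin 1) R L) (e : Module.Basis (Fin (2 * m)) R E) :
    IsUnit (discr b l e) ↔ IsUnit (gram b l e).det := by
  have h1 : IsUnit (squareSign (2 * m) : R) :=
    IsUnit.of_mul_eq_one (squareSign (2 * m) : R) (by
      rw [← Int.cast_mul, squareSign_mul_self, Int.cast_one])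
  have h2 : IsUnit ((squareSign (2 * m) : R) * ((2 * m).factorial : R) ^ 2) :=
    h1.mul ((isUnit_natCast_factorial R _).pow 2)
  rw [discr, IsUnit.mul_iff]
  exact ⟨fun h => h.2, fun h => ⟨h2, h⟩⟩

end EvenClifford

namespace LineValuedForm

variable {S : Scheme.{u}} {E L : S.Modules} (σ : LineValuedForm E L) {m : ℕ} {U : S.Opens}

theorem det_minor_restrict {n : ℕ} {V : S.Opens} (h : V ≤ U) (v w : Fin n → Γ(E, U))
    (t : Fin n → Γ(L, U)) :
    (Matrix.of fun i j => σ.form V (E.presheaf.map (homOfLE h).op (v i))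
      (E.presheaf.map (homOfLE h).op (w j)) (L.presheaf.map (homOfLE h).op (t i))).det =
      S.presheaf.map (homOfLE h).op (Matrix.of fun i j => σ.form U (v i) (w j) (t i)).det := by
  refine Eq.trans ?_ ((S.presheaf.map (homOfLE h).op).hom.map_det _).symm
  congr 1
  ext i j
  exact σ.map_res (homOfLE h) (v i) (w j) (t i)

/-- Over an open subset with frames every maximal minor of the form is a multiple of the determinant of
the Gram matrix, so `S₁` is the zero locus of the discriminant. -/
theorem le_degeneracyCompl_iff [∀ U : S.Opens, Algebra ℚ Γ(S, U)] (F : Framing E L (2 * m) U) :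
    U ≤ σ.degeneracyCompl (2 * m) 1 ↔ IsUnit (σ.frameDiscr F) := by
  rw [EvenClifford.isUnit_discr_iff]
  constructor
  · intro h
    refine RingedSpace.isUnit_of_isUnit_germ S.toRingedSpace U _ fun x hx => ?_
    have hx' := h hx
    simp only [degeneracyCompl, Opens.mem_iSup] at hx'
    obtain ⟨W, v, w, t, hx'⟩ := hx'
    have hxW : x ∈ W := S.basicOpen_le _ hx'
    let D := W ⊓ U
    have h1 : x ∈ S.basicOpen (S.presheaf.map (homOfLE (inf_le_left : D ≤ W)).op
        (Matrix.of fun i j => σ.form W (v i) (w j) (t i)).det) := by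
      rw [Scheme.basicOpen_res]
      exact ⟨⟨hxW, hx⟩, hx'⟩
    rw [← σ.det_minor_restrict] at h1
    have h2 := EvenClifford.det_minor (n := 2 * m) (σ.form D) (F.restrict inf_le_right).bl
      (F.restrict inf_le_right).be (fun i => E.presheaf.map (homOfLE (inf_le_left : D ≤ W)).op (v i))
      (fun i => E.presheaf.map (homOfLE (inf_le_left : D ≤ W)).op (w i))
      (fun i => L.presheaf.map (homOfLE (inf_le_left : D ≤ W)).op (t i))
    have h3 := (congrArg S.basicOpen h2) ▸ h1
    rw [Scheme.basicOpen_mul] at h3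
    have h4 : EvenClifford.gram (σ.form D) (F.restrict (inf_le_right : D ≤ U)).bl
          (F.restrict (inf_le_right : D ≤ U)).be =
        Matrix.of fun i j => σ.form D (E.presheaf.map (homOfLE inf_le_right).op (F.be i))
          (E.presheaf.map (homOfLE inf_le_right).op (F.be j))
          (L.presheaf.map (homOfLE inf_le_right).op (F.bl 0)) := by
      ext i j
      simp [EvenClifford.gram]
    have h5 := h3.1
    rw [h4, σ.det_minor_restrict inf_le_right F.be F.be fun _ => F.bl 0, Scheme.basicOpen_res] at h5
    exact (S.mem_basicOpen _ x hx).1 h5.2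
  · intro h x hx
    simp only [degeneracyCompl, Opens.mem_iSup]
    refine ⟨U, F.be, F.be, fun _ => F.bl 0, ?_⟩
    exact (Scheme.basicOpen_of_isUnit S h).symm ▸ hx

namespace CentralCover

variable {σ} (K : σ.CentralCover m)

section Framed

variable [∀ U : S.Opens, Algebra ℚ Γ(S, U)] (F : Framing E L (2 * m) U) (hm : 0 < m)
include hm

attribute [local instance] invertibleTwoOfRat

/-- Over an open subset with frames the covering is given by adjoining a square root of the
discriminant. -/
theorem exists_equiv : letI := (K.proj.app U).hom.toAlgebra
    Nonempty (QuadraticAlgebra Γ(S, U) (σ.frameDiscr F) 0 ≃ₐ[Γ(S, U)]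
      Γ(K.cover, K.proj ⁻¹ᵁ U)) := by
  let := (K.proj.app U).hom.toAlgebra
  have hmem : σ.toSheaf U (σ.frameOmega F) ∈ Set.range (K.hom U) := by
    rw [K.range_eq, σ.mem_centralPart_iff F hm]
    exact ⟨0, 1, by rw [map_zero, zero_add, one_smul]⟩
  obtain ⟨w, hw⟩ := hmem
  have happ (r : Γ(S, U)) : K.hom U (algebraMap _ _ r) = algebraMap _ _ r := K.hom_app r
  have hq (q : Γ(S, U) × Γ(S, U)) : K.hom U (algebraMap _ _ q.1 + q.2 • w) =
      algebraMap Γ(S, U) _ q.1 + q.2 • σ.toSheaf U (σ.frameOmega F) := by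
    rw [map_add, Algebra.smul_def, map_mul, happ, happ, hw, ← Algebra.smul_def]
  refine ⟨QuadraticAlgebra.equivOfBijective _ w (K.injective U ?_) ⟨?_, ?_⟩⟩
  · rw [map_mul, hw, happ, ← map_mul,
      EvenClifford.omega_mul_self (σ.form U) (σ.symm U) F.bl F.be hm]
    rfl
  · intro q q' h
    exact σ.algebraMap_add_smul_injective F hm
      ((hq q).symm.trans ((congrArg (K.hom U) h).trans (hq q')))
  · intro z
    have hz : K.hom U z ∈ σ.centralPart m U := K.range_eq U ▸ ⟨z, rfl⟩
    obtain ⟨r, s, hrs⟩ := (σ.mem_centralPart_iff F hm _).1 hz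
    exact ⟨(r, s), K.injective U ((hq (r, s)).trans hrs.symm)⟩

/-- Over an open subset with frames the covering has functions `R[ω] / (ω² - d)`, which is free of rank
`2` over `R` and étale exactly when `d` is a unit, `2` being invertible. -/
theorem app_properties : (K.proj.app U).hom.Finite ∧ (K.proj.app U).hom.Flat ∧
    (K.proj.app U).hom.FinitePresentation ∧
    ((K.proj.app U).hom.Etale ↔ IsUnit (σ.frameDiscr F)) ∧
    ∀ p : PrimeSpectrum Γ(S, U), (Spec.map (K.proj.app U)).finrank p = 2 := by
  obtain ⟨e⟩ := K.exists_equiv F hm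
  let := (K.proj.app U).hom.toAlgebra
  let Q := QuadraticAlgebra Γ(S, U) (σ.frameDiscr F) 0
  have h1 : Module.Finite Γ(S, U) Γ(K.cover, K.proj ⁻¹ᵁ U) := Module.Finite.equiv e.toLinearEquiv
  have h2 : Module.Free Γ(S, U) Γ(K.cover, K.proj ⁻¹ᵁ U) := Module.Free.of_equiv e.toLinearEquiv
  have h3 : Module.Flat Γ(S, U) Γ(K.cover, K.proj ⁻¹ᵁ U) := inferInstance
  have : Module.FinitePresentation Γ(S, U) Γ(K.cover, K.proj ⁻¹ᵁ U) :=
    Module.finitePresentation_of_projective _ _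
  have h4 : Algebra.FinitePresentation Γ(S, U) Γ(K.cover, K.proj ⁻¹ᵁ U) := inferInstance
  refine ⟨h1, h3, h4, ?_, fun p => ?_⟩
  · rw [← QuadraticAlgebra.etale_iff _ (isUnit_of_invertible (2 : Γ(S, U)))]
    exact ⟨fun h => have : Algebra.Etale _ _ := h; Algebra.Etale.of_equiv e.symm,
      fun h => Algebra.Etale.of_equiv e⟩
  · have := Scheme.Hom.finrank_SpecMap_algebraMap Γ(S, U) Γ(K.cover, K.proj ⁻¹ᵁ U) p
    refine this.trans ?_
    have : Nontrivial Γ(S, U) := p.nontrivial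
    rw [Module.rankAtStalk_eq_finrank_of_free, ← e.toLinearEquiv.finrank_eq,
      QuadraticAlgebra.finrank_eq_two]
    rfl

end Framed

variable (hE : IsVectorBundle E (2 * m))
  (hL : IsVectorBundle L 1)
include hE hL

/-- An affine morphism has a property which is local on the target as soon as the maps on sections
over affine open subsets with frames have it. -/
theorem restrict_of_app (P : MorphismProperty Scheme.{u}) [IsZariskiLocalAtTarget P] (V : S.Opens) :
    P (K.proj ∣_ V) ↔ ∀ U : S.Opens, IsAffineOpen U → U ≤ V → (U : Set S).Nonempty →
      Framing E L (2 * m) U → P (Spec.map (K.proj.app U)) := by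
  have := K.isAffineHom
  let ι := {U : S.Opens // IsAffineOpen U ∧ U ≤ V ∧ (U : Set S).Nonempty ∧
    Nonempty (Framing E L (2 * m) U)}
  have hι : ⨆ U : ι, U.1 = V := by
    refine le_antisymm (iSup_le fun U => U.2.2.1) fun x hx => ?_
    obtain ⟨W, hxW, ⟨F⟩⟩ := Framing.exists_mem hE hL x
    obtain ⟨U, hU, hxU, hUW⟩ := Opens.isBasis_iff_nbhd.1 S.isBasis_affineOpens
      (show x ∈ V ⊓ W from ⟨hx, hxW⟩)
    exact Opens.mem_iSup.2 ⟨⟨U, hU, hUW.trans inf_le_left, ⟨x, hxU⟩,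
      ⟨F.restrict (hUW.trans inf_le_right)⟩⟩, hxU⟩
  rw [morphismRestrict_iff_of_iSup_eq K.proj P V _ hι]
  constructor
  · intro h U hU hUV hne F
    exact (P.arrow_mk_iso_iff (morphismRestrictIsoSpec K.proj hU)).1 (h ⟨U, hU, hUV, hne, ⟨F⟩⟩)
  · rintro h ⟨U, hU, hUV, hne, ⟨F⟩⟩
    exact (P.arrow_mk_iso_iff (morphismRestrictIsoSpec K.proj hU)).2 (h U hU hUV hne F)

theorem of_app (P : MorphismProperty Scheme.{u}) [IsZariskiLocalAtTarget P]
    (h : ∀ U : S.Opens, IsAffineOpen U → (U : Set S).Nonempty →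
      Framing E L (2 * m) U → P (Spec.map (K.proj.app U))) : P K.proj := by
  refine (IsZariskiLocalAtTarget.iff_of_iSup_eq_top (P := P) (fun _ : Unit => ⊤)
    (by simp)).2 fun _ => ?_
  exact (K.restrict_of_app hE hL P ⊤).2 fun U hU _ hne F => h U hU hne F

variable [∀ U : S.Opens, Algebra ℚ Γ(S, U)] (hσ : σ.IsEmbedding)
include hσ

theorem isFinite : IsFinite K.proj := by
  refine K.of_app hE hL @IsFinite fun U hU hne F => (IsFinite.SpecMap_iff _).2 ?_
  obtain ⟨x, -⟩ := hne
  exact (K.app_properties F (hσ.rank_pos hE x)).1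

theorem flat : Flat K.proj := by
  refine K.of_app hE hL @Flat fun U hU hne F => Flat.SpecMap_iff.2 ?_
  obtain ⟨x, -⟩ := hne
  exact (K.app_properties F (hσ.rank_pos hE x)).2.1

theorem locallyOfFinitePresentation : LocallyOfFinitePresentation K.proj := by
  refine K.of_app hE hL @LocallyOfFinitePresentation fun U hU hne F =>
    (LocallyOfFinitePresentation.SpecMap_iff _).2 ?_
  obtain ⟨x, -⟩ := hne
  exact (K.app_properties F (hσ.rank_pos hE x)).2.2.1

theorem finrank_eq_two (s : S) : K.proj.finrank s = 2 := by
  have := K.isFinite hE hL hσ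
  have := K.flat hE hL hσ
  obtain ⟨W, hsW, ⟨F⟩⟩ := Framing.exists_mem hE hL s
  obtain ⟨U, hU, hsU, hUW⟩ := Opens.isBasis_iff_nbhd.1 S.isBasis_affineOpens hsW
  exact finrank_eq_of_app K.proj s hU hsU
    (K.app_properties (F.restrict hUW) (hσ.rank_pos hE s)).2.2.2.2

theorem etale_restrict_iff (V : S.Opens) :
    Etale (K.proj ∣_ V) ↔ V ≤ σ.degeneracyCompl (2 * m) 1 := by
  refine (K.restrict_of_app hE hL @Etale V).trans ?_
  constructor
  · intro h x hx
    obtain ⟨W, hxW, ⟨F⟩⟩ := Framing.exists_mem hE hL x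
    obtain ⟨U, hU, hxU, hUW⟩ := Opens.isBasis_iff_nbhd.1 S.isBasis_affineOpens
      (show x ∈ V ⊓ W from ⟨hx, hxW⟩)
    let F' := F.restrict (hUW.trans inf_le_right)
    have h1 := h U hU (hUW.trans inf_le_left) ⟨x, hxU⟩ F'
    have h2 := (HasRingHomProperty.Spec_iff (P := @Etale)).1 h1
    exact (σ.le_degeneracyCompl_iff F').2
      ((K.app_properties F' (hσ.rank_pos hE x)).2.2.2.1.1 h2) hxU
  · rintro h U hU hUV ⟨x, -⟩ F
    refine (HasRingHomProperty.Spec_iff (P := @Etale)).2 ?_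
    exact (K.app_properties F (hσ.rank_pos hE x)).2.2.2.1.2
      ((σ.le_degeneracyCompl_iff F).1 (hUV.trans h))

end CentralCover

end LineValuedForm

/-! ### Extension of scalars along central homomorphisms -/

/-- If the scalars of a module `M` free over `R` extend to a ring `A`, then a base change of `M`
along `R → R'` is a base change along `A → A'`, for any `A'` spanned by `A` over `R'`. -/
theorem isBaseChange_of_basis {R R' A A' M M' : Type u} [CommRing R] [CommRing R'] [CommRing A]
    [CommRing A'] [AddCommGroup M] [AddCommGroup M'] [Algebra R A] [Algebra R' A'] [Algebra A A']
    [Module R M] [Module A M] [IsScalarTower R A M] [Module R' M'] [Module A' M']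
    [IsScalarTower R' A' M'] [Module A M'] [IsScalarTower A A' M'] (ρ : R →+* R')
    (hρ : ∀ r, algebraMap R' A' (ρ r) = algebraMap A A' (algebraMap R A r))
    (hA : Submodule.span R' (Set.range (algebraMap A A')) = ⊤) (f : M →ₗ[A] M') {κ : Type*}
    (b : Module.Basis κ R M) (b' : Module.Basis κ R' M') (hb : ∀ k, f (b k) = b' k) :
    IsBaseChange A' f := by
  refine IsBaseChange.of_lift_unique _ fun Q _ _ _ _ g => ?_
  let : Module R' Q := Module.compHom Q (algebraMap R' A')
  have : IsScalarTower R' A' Q := ⟨fun r a q => by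
    rw [Algebra.smul_def, mul_smul]; rfl⟩
  have hfs (r : R) (x : M) : f (r • x) = ρ r • f x := by
    rw [← algebraMap_smul A r x, map_smul, ← algebraMap_smul A' (algebraMap R A r), ← hρ,
      algebraMap_smul]
  have hgs (r : R) (x : M) : g (r • x) = ρ r • g x := by
    rw [← algebraMap_smul A r x, map_smul, ← algebraMap_smul A' (algebraMap R A r), ← hρ,
      algebraMap_smul]
  let θ : M' →ₗ[R'] Q := b'.constr R' fun k => g (b k)
  have hθ (x : M) : θ (f x) = g x := by
    have hx : x ∈ Submodule.span R (Set.range b) := b.span_eq ▸ Submodule.mem_top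
    induction hx using Submodule.span_induction with
    | zero => simp
    | add x y _ _ hx hy => simp [hx, hy]
    | smul r x _ hx => rw [hfs, hgs, map_smul, hx]
    | mem x hx => obtain ⟨k, rfl⟩ := hx; rw [hb]; simp [θ]
  have hθA (a : A') (y : M') : θ (a • y) = a • θ y := by
    have ha : a ∈ Submodule.span R' (Set.range (algebraMap A A')) := hA ▸ Submodule.mem_top
    induction ha using Submodule.span_induction with
    | zero => simp
    | add a a' _ _ h h' => rw [add_smul, map_add, h, h', add_smul]
    | smul r a _ h => rw [smul_assoc, map_smul, h, smul_assoc]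
    | mem a ha =>
      obtain ⟨a, rfl⟩ := ha
      have hy : y ∈ Submodule.span R' (Set.range b') := b'.span_eq ▸ Submodule.mem_top
      induction hy using Submodule.span_induction with
      | zero => simp
      | add x y _ _ hx hy => simp only [smul_add, map_add, hx, hy]
      | smul r y _ hy =>
        have h1 : algebraMap A A' a • r • y = r • algebraMap A A' a • y := by
          rw [← algebraMap_smul A' r y, smul_comm, algebraMap_smul]
        rw [h1, map_smul, hy, map_smul, ← algebraMap_smul A' r, ← algebraMap_smul A' r, smul_comm]
      | mem y hy =>
        obtain ⟨k, rfl⟩ := hy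
        rw [← hb, algebraMap_smul, ← map_smul, hθ, hθ, map_smul, algebraMap_smul]
  refine ⟨⟨θ.toAddHom, hθA⟩, LinearMap.ext hθ, fun h hh => LinearMap.ext fun y => ?_⟩
  change h y = θ y
  have hy : y ∈ Submodule.span R' (Set.range b') := b'.span_eq ▸ Submodule.mem_top
  induction hy using Submodule.span_induction with
  | zero => simp
  | add x y _ _ hx hy => simp only [map_add, hx, hy]
  | smul r y _ hy => rw [θ.map_smul, ← algebraMap_smul A' r y, h.map_smul, hy, algebraMap_smul]
  | mem y hy => obtain ⟨k, rfl⟩ := hy; rw [← hb, hθ, ← hh]; rfl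

theorem IsBaseChange.isLocalizedModule_tensor {A₀ A B C M : Type u} [CommRing A₀] [CommRing A]
    [CommRing C] [AddCommGroup B] [AddCommGroup M] [Algebra A₀ A] [Algebra A₀ C] [Algebra A C]
    [IsScalarTower A₀ A C] [Module A₀ M] [Module A₀ B] [Module A B] [IsScalarTower A₀ A B] (s : A₀)
    [IsLocalization.Away s C] {β : M →ₗ[A₀] B} (h : IsBaseChange A β) :
    IsLocalizedModule.Away s ((TensorProduct.mk A C B 1).restrictScalars A₀ ∘ₗ β) := by
  rw [IsLocalizedModule.Away, isLocalizedModule_iff_isBaseChange (.powers s) C]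
  exact h.comp (TensorProduct.isBaseChange A B C)

section CentralTensor

variable {A B C : Type u} [CommRing A] [Ring B] [CommRing C] (f : A →+* B) (g : A →+* C)
  (hf : ∀ a b, f a * b = b * f a)

/-- The tensor product `C ⊗ B` over `A`, for a commutative ring `C` and a central
homomorphism from `A` to a ring `B`. -/
def CentralTensor : Type u :=
  @TensorProduct A _ C B _ _ g.toAlgebra.toModule (f.toAlgebra' hf).toModule

namespace CentralTensor

instance : Ring (CentralTensor f g hf) :=
  @Algebra.TensorProduct.instRing A C B _ _ g.toAlgebra _ (f.toAlgebra' hf)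

/-- The homomorphism from the commutative factor. -/
def inl : C →+* CentralTensor f g hf :=
  @Algebra.TensorProduct.includeLeftRingHom A C B _ _ g.toAlgebra _ (f.toAlgebra' hf)

/-- The homomorphism from the noncommutative factor. -/
def inr : B →+* CentralTensor f g hf :=
  letI := g.toAlgebra
  letI := f.toAlgebra' hf
  (Algebra.TensorProduct.includeRight : B →ₐ[A] C ⊗[A] B).toRingHom

theorem inr_apply (a : A) : inr f g hf (f a) = inl f g hf (g a) := by
  let := g.toAlgebra
  let := f.toAlgebra' hf
  exact (Algebra.TensorProduct.tmul_one_eq_one_tmul (R := A) (A := C) (B := B) a).symm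

theorem induction_on {p : CentralTensor f g hf → Prop} (x : CentralTensor f g hf)
    (hadd : ∀ x y, p x → p y → p (x + y)) (hmul : ∀ c b, p (inl f g hf c * inr f g hf b)) :
    p x := by
  let := g.toAlgebra
  let := f.toAlgebra' hf
  have hmul' (c : C) (b : B) : p (c ⊗ₜ[A] b) := by
    have h : (c ⊗ₜ[A] b) = (c ⊗ₜ[A] (1 : B)) * ((1 : C) ⊗ₜ[A] b) := by
      rw [Algebra.TensorProduct.tmul_mul_tmul, mul_one, one_mul]
    exact h ▸ hmul c b
  refine TensorProduct.induction_on (motive := p) x ?_ hmul' hadd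
  have := hmul' 0 0
  rwa [TensorProduct.zero_tmul] at this

theorem commute_inl (c : C) (x : CentralTensor f g hf) : Commute (inl f g hf c) x := by
  let := g.toAlgebra
  let := f.toAlgebra' hf
  exact Algebra.commutes (R := C) (A := C ⊗[A] B) c x

variable {f g hf} in
theorem ringHom_ext {T : Type*} [Ring T] {φ ψ : CentralTensor f g hf →+* T}
    (hl : ∀ c, φ (inl f g hf c) = ψ (inl f g hf c)) (hr : ∀ b, φ (inr f g hf b) = ψ (inr f g hf b)) :
    φ = ψ := by
  ext x
  induction x using induction_on with
  | hadd x y hx hy => rw [map_add, map_add, hx, hy]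
  | hmul c b => rw [map_mul, map_mul, hl, hr]

/-- The universal property of the tensor product. -/
def lift {T : Type*} [Ring T] (γ : C →+* T) (β : B →+* T) (hγ : ∀ c t, γ c * t = t * γ c)
    (h : ∀ a, β (f a) = γ (g a)) : CentralTensor f g hf →+* T :=
  letI := g.toAlgebra
  letI := f.toAlgebra' hf
  letI : Algebra C T := γ.toAlgebra' hγ
  letI : Algebra A T := (γ.comp g).toAlgebra' fun a => hγ (g a)
  haveI : IsScalarTower A C T := .of_algebraMap_eq fun _ => rfl
  (Algebra.TensorProduct.lift (R := A) (S := C) (A := C) (B := B) (C := T) (Algebra.ofId C T)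
    { β with commutes' := h } fun c _ => hγ c _).toRingHom

theorem lift_inl {T : Type*} [Ring T] (γ : C →+* T) (β : B →+* T)
    (hγ : ∀ c t, γ c * t = t * γ c) (h : ∀ a, β (f a) = γ (g a)) (c : C) :
    lift f g hf γ β hγ h (inl f g hf c) = γ c := by
  let := g.toAlgebra
  let := f.toAlgebra' hf
  let : Algebra C T := γ.toAlgebra' hγ
  let : Algebra A T := (γ.comp g).toAlgebra' fun a => hγ (g a)
  have : IsScalarTower A C T := .of_algebraMap_eq fun _ => rfl
  exact (Algebra.TensorProduct.lift_tmul (R := A) (S := C) (A := C) (B := B) (C := T) _ _ _ c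
    1).trans (by rw [map_one, mul_one]; rfl)

theorem lift_inr {T : Type*} [Ring T] (γ : C →+* T) (β : B →+* T)
    (hγ : ∀ c t, γ c * t = t * γ c) (h : ∀ a, β (f a) = γ (g a)) (b : B) :
    lift f g hf γ β hγ h (inr f g hf b) = β b := by
  let := g.toAlgebra
  let := f.toAlgebra' hf
  let : Algebra C T := γ.toAlgebra' hγ
  let : Algebra A T := (γ.comp g).toAlgebra' fun a => hγ (g a)
  have : IsScalarTower A C T := .of_algebraMap_eq fun _ => rfl
  exact (Algebra.TensorProduct.lift_tmul (R := A) (S := C) (A := C) (B := B) (C := T) _ _ _ 1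
    b).trans (by rw [map_one, one_mul]; rfl)

/-- If `B` is a base change of a module `M` over `A₀`, and `C` is the localization of `A₀` at an
element, then the tensor product is the localization of `M` at this element. -/
theorem isLocalizedModule {A₀ M : Type u} [CommRing A₀] [AddCommGroup M] [Module A₀ M]
    (ρ : A₀ →+* A) (γ : A₀ →+* C) (hγ : ∀ a, g (ρ a) = γ a) (s : A₀)
    (hs : letI := γ.toAlgebra; IsLocalization.Away s C) (β : M →+ B)
    (hβ : ∀ a x, β (a • x) = f (ρ a) * β x)
    (hbase : letI := ρ.toAlgebra; letI := (f.toAlgebra' hf).toModule; letI := Module.compHom B ρ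
      ∀ _ : IsScalarTower A₀ A B, IsBaseChange A ({ β with map_smul' := hβ } : M →ₗ[A₀] B))
    (mod : Module A₀ (CentralTensor f g hf)) (hmod : ∀ a t, a • t = inl f g hf (γ a) * t)
    (θ : M →ₗ[A₀] CentralTensor f g hf) (hθ : ∀ x, θ x = inr f g hf (β x)) :
    IsLocalizedModule.Away s θ := by
  let : Algebra A C := g.toAlgebra
  let : Algebra A B := f.toAlgebra' hf
  let : Algebra A₀ A := ρ.toAlgebra
  let : Algebra A₀ C := γ.toAlgebra
  let : Module A₀ B := Module.compHom B ρ
  have hAB : IsScalarTower A₀ A B := ⟨fun a b c => by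
    refine Eq.trans ?_ (mul_assoc (f (ρ a)) (f b) c)
    exact congrArg (· * c) (map_mul f (ρ a) b)⟩
  have : IsScalarTower A₀ A C := .of_algebraMap_eq fun a => (hγ a).symm
  have h := IsBaseChange.isLocalizedModule_tensor (C := C) s (hbase hAB)
  have hmod' : mod = (inferInstance : Module A₀ (C ⊗[A] B)) := by
    refine Module.ext' _ _ fun a t => (hmod a t).trans ?_
    refine (Algebra.smul_def (R := C) (A := C ⊗[A] B) (γ a) t).symm.trans ?_
    exact algebraMap_smul (M := C ⊗[A] B) C a t
  subst hmod'
  have key : ∀ (N : Type u) (i : AddCommGroup N) (j : Module A₀ N) (θ θ' : M →ₗ[A₀] N),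
      (∀ x, θ x = θ' x) → IsLocalizedModule.Away s θ' → IsLocalizedModule.Away s θ := by
    intro N i j θ θ' e h'
    exact LinearMap.ext e ▸ h'
  exact key _ _ _ _ _ hθ h

end CentralTensor

end CentralTensor

/-! ### Sheafification of presheaves which localize on an affine open subset -/

section Localization

variable {X : Scheme.{u}} (P : X.Opensᵒᵖ ⥤ RingCat.{u}) (α : X.ringCatSheaf.obj ⟶ P)

/-- The homomorphism of a presheaf of algebras. -/
def presheafUnit (U : X.Opens) : Γ(X, U) →+* P.obj (op U) := (α.app (op U)).hom

theorem presheafUnit_res {U V : X.Opens} (h : V ≤ U) (r : Γ(X, U)) :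
    (P.map (homOfLE h).op).hom (presheafUnit P α U r) =
      presheafUnit P α V (X.presheaf.map (homOfLE h).op r) :=
  (NatTrans.naturality_apply α (homOfLE h).op r).symm

theorem isUnit_presheafUnit_basicOpen {U : X.Opens} (f : Γ(X, U)) {V : X.Opens}
    (hV : V ≤ X.basicOpen f) :
    IsUnit (presheafUnit P α V (X.presheaf.map (homOfLE (hV.trans (X.basicOpen_le f))).op f)) := by
  refine IsUnit.map _ ?_
  have h : IsUnit (X.presheaf.map (homOfLE (X.basicOpen_le f)).op f) :=
    RingedSpace.isUnit_res_basicOpen _ f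
  have h' := h.map (X.presheaf.map (homOfLE hV).op).hom
  have e : (X.presheaf.map (homOfLE hV).op).hom (X.presheaf.map (homOfLE (X.basicOpen_le f)).op f) =
      X.presheaf.map (homOfLE (hV.trans (X.basicOpen_le f))).op f :=
    (congrArg (fun g : Γ(X, U) ⟶ Γ(X, V) => g.hom f) (X.presheaf.map_comp
      (homOfLE (X.basicOpen_le f)).op (homOfLE hV).op)).symm
  exact e ▸ h'

variable {U : X.Opens} {M : Type u} [AddCommGroup M] [Module Γ(X, U) M]
  (θ : ∀ D ≤ U, M →+ P.obj (op D))
  (hθ : ∀ D h a x, θ D h (a • x) =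
    presheafUnit P α D (X.presheaf.map (homOfLE h).op a) * θ D h x)

/-- The sections of a presheaf of algebras over `D ≤ U`, as a module over the functions on `U`. -/
abbrev presheafModule (D : X.Opens) (h : D ≤ U) : Module Γ(X, U) (P.obj (op D)) :=
  Module.compHom _ ((presheafUnit P α D).comp (X.presheaf.map (homOfLE h).op).hom)

include hθ in
theorem isLocalizedModule_presheaf (f : Γ(X, U))
    (hsurj : ∀ t : P.obj (op (X.basicOpen f)), ∃ (n : ℕ) (x : M),
      presheafUnit P α _ (X.presheaf.map (homOfLE (X.basicOpen_le f)).op f) ^ n * t =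
        θ _ (X.basicOpen_le f) x)
    (hinj : ∀ x, θ _ (X.basicOpen_le f) x = 0 → ∃ n : ℕ, f ^ n • x = 0) :
    letI := presheafModule P α (X.basicOpen f) (X.basicOpen_le f)
    IsLocalizedModule.Away f ({ θ _ (X.basicOpen_le f) with map_smul' := hθ _ _ } :
      M →ₗ[Γ(X, U)] P.obj (op (X.basicOpen f))) := by
  let := presheafModule P α (X.basicOpen f) (X.basicOpen_le f)
  have hpow (n : ℕ) (t : P.obj (op (X.basicOpen f))) : f ^ n • t =
      presheafUnit P α _ (X.presheaf.map (homOfLE (X.basicOpen_le f)).op f) ^ n * t := by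
    rw [← map_pow, ← map_pow]; rfl
  refine ⟨?_, ?_, ?_⟩
  · rintro ⟨_, n, rfl⟩
    rw [Module.End.isUnit_iff]
    have hu := (isUnit_presheafUnit_basicOpen P α f le_rfl).pow n
    constructor
    · intro s t h
      exact hu.mul_left_cancel ((hpow n s).symm.trans (h.trans (hpow n t)))
    · intro t
      obtain ⟨v, hv⟩ := hu
      refine ⟨↑v⁻¹ * t, (hpow n _).trans ?_⟩
      rw [← hv]
      exact v.mul_inv_cancel_left t
  · intro t
    obtain ⟨n, x, h⟩ := hsurj t
    exact ⟨⟨x, ⟨_, n, rfl⟩⟩, (hpow n t).trans h⟩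
  · intro x y h
    obtain ⟨n, h⟩ := hinj (x - y) ((map_sub _ _ _).trans (sub_eq_zero.2 h))
    exact ⟨⟨_, n, rfl⟩, sub_eq_zero.1 ((smul_sub _ _ _).symm.trans h)⟩

variable (hU : IsAffineOpen U)

variable (M) in
/-- The quasi-coherent sheaf on an affine open subset attached to a module, pushed forward. -/
def moduleSheaf : TopCat.Sheaf (Type u) X :=
  (TopCat.Sheaf.pushforward (Type u) hU.fromSpec.base).obj (structureSheafInType Γ(X, U) M)

variable (M) in
/-- The sections given by the elements of a module. -/
def toModuleSheaf (D : X.Opens) :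
    M →ₗ[Γ(X, U)] (structureSheafInType Γ(X, U) M).obj.obj (op (hU.fromSpec ⁻¹ᵁ D)) :=
  StructureSheaf.toOpenₗ Γ(X, U) M (hU.fromSpec ⁻¹ᵁ D)

instance (f : Γ(X, U)) : IsLocalizedModule.Away f (toModuleSheaf M hU (X.basicOpen f)) := by
  unfold toModuleSheaf
  rw [hU.fromSpec_preimage_basicOpen]
  infer_instance

include hU hθ in
/-- A presheaf of algebras which localizes on an affine open subset `U` has the same
sections over the basic open subsets of `U` as its sheafification. -/
theorem toSheafify_bijective_of_localization
    (hres : ∀ D h V (hV : V ≤ D) x, (P.map (homOfLE hV).op).hom (θ D h x) = θ V (hV.trans h) x)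
    (hsurj : ∀ f (t : P.obj (op (X.basicOpen f))), ∃ (n : ℕ) (x : M),
      presheafUnit P α _ (X.presheaf.map (homOfLE (X.basicOpen_le f)).op f) ^ n * t =
        θ _ (X.basicOpen_le f) x)
    (hinj : ∀ f x, θ _ (X.basicOpen_le f) x = 0 → ∃ n : ℕ, f ^ n • x = 0) (f : Γ(X, U)) :
    Function.Bijective ((toSheafify (Opens.grothendieckTopology X) P).app
      (op (X.basicOpen f))).hom := by
  have h1 : ∀ (D : X.Opens) (h : D ≤ U), (∃ f : Γ(X, U), D = X.basicOpen f) →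
      letI := presheafModule P α D h
      ∃ e : P.obj (op D) ≃ₗ[Γ(X, U)]
        (structureSheafInType Γ(X, U) M).obj.obj (op (hU.fromSpec ⁻¹ᵁ D)),
        ∀ x, e (θ D h x) = toModuleSheaf M hU D x := by
    rintro _ _ ⟨f, rfl⟩
    let := presheafModule P α (X.basicOpen f) (X.basicOpen_le f)
    let θ' : M →ₗ[Γ(X, U)] P.obj (op (X.basicOpen f)) :=
      { θ _ (X.basicOpen_le f) with map_smul' := hθ _ _ }
    have : IsLocalizedModule.Away f θ' := isLocalizedModule_presheaf P α θ hθ f (hsurj f) (hinj f)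
    exact ⟨IsLocalizedModule.linearEquiv (.powers f) θ' (toModuleSheaf M hU (X.basicOpen f)),
      IsLocalizedModule.linearEquiv_apply (.powers f) θ' (toModuleSheaf M hU (X.basicOpen f))⟩
  have hle (D : X.Opens) (hD : ∃ f : Γ(X, U), D = X.basicOpen f) : D ≤ U := by
    obtain ⟨f, rfl⟩ := hD
    exact X.basicOpen_le f
  choose e he using h1
  refine toSheafify_bijective_of_basis P (fun _ : Unit => moduleSheaf M hU)
    (fun D => ∃ f : Γ(X, U), D = X.basicOpen f) ?_
    (fun D hD t _ => (e D (hle D hD) hD).toFun t) ?_ ?_ _ ⟨f, rfl⟩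
  · rintro D hD V hV x hx
    obtain ⟨g, hg, hxg⟩ := hU.exists_basicOpen_le ⟨x, hx⟩ (hle D hD (hV hx))
    exact ⟨_, ⟨g, rfl⟩, hxg, hg⟩
  · intro D hD
    let := presheafModule P α D (hle D hD)
    exact ((Equiv.funUnique Unit _).symm.bijective).comp (e D (hle D hD) hD).bijective
  · intro D V hD hV h t _
    have hDU := hle D hD
    let := presheafModule P α D hDU
    let := presheafModule P α V (h.trans hDU)
    let r : (structureSheafInType Γ(X, U) M).obj.obj (op (hU.fromSpec ⁻¹ᵁ D)) →ₗ[Γ(X, U)]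
        (structureSheafInType Γ(X, U) M).obj.obj (op (hU.fromSpec ⁻¹ᵁ V)) :=
      ((structurePresheafInModuleCat Γ(X, U) M).map
        (homOfLE (hU.fromSpec.preimage_mono h)).op).hom
    have hr (x : M) : r (toModuleSheaf M hU D x) = toModuleSheaf M hU V x := rfl
    change e V _ hV _ = r (e D hDU hD t)
    obtain ⟨f, rfl⟩ := hD
    obtain ⟨n, x, hx⟩ := hsurj f t
    -- both sides agree after multiplication by a power of `f`, which is invertible over `V`
    let eV := e V (h.trans hDU) hV
    obtain ⟨y, hy⟩ := eV.surjective (r (e _ hDU ⟨f, rfl⟩ t))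
    have hinv (a b : P.obj (op V)) (hab : f ^ n • a = f ^ n • b) : a = b := by
      have hu := (isUnit_presheafUnit_basicOpen P α f h).pow n
      have hpow (t : P.obj (op V)) : f ^ n • t =
          presheafUnit P α _ (X.presheaf.map (homOfLE (h.trans hDU)).op f) ^ n * t := by
        rw [← map_pow, ← map_pow]; rfl
      exact hu.mul_left_cancel ((hpow a).symm.trans (hab.trans (hpow b)))
    have h2 : f ^ n • y = θ V (h.trans hDU) x := by
      apply eV.injective
      refine (map_smul eV _ _).trans ?_
      rw [hy, ← map_smul, ← map_smul, he _ _ hV, ← hr]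
      refine congrArg r ((congrArg (e _ hDU ⟨f, rfl⟩) ?_).trans (he _ hDU _ x))
      refine Eq.trans ?_ hx
      rw [← map_pow, ← map_pow]; rfl
    have h3 : f ^ n • (P.map (homOfLE h).op).hom t = θ V (h.trans hDU) x := by
      rw [← hres _ hDU V h, ← hx, map_mul, map_pow, presheafUnit_res, ← map_pow, ← map_pow,
        ← map_pow]
      change presheafUnit P α V _ * _ = _
      congr 2
      exact congrArg (fun g : Γ(X, U) ⟶ Γ(X, V) => g.hom (f ^ n)) (X.presheaf.map_comp
        (homOfLE (X.basicOpen_le f)).op (homOfLE h).op)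
    exact (congrArg eV (hinv _ _ (h3.trans h2.symm))).trans hy

end Localization

/-! ### The sheaf of algebras on the double covering -/

namespace AlgSheaf

variable {X : Scheme.{u}} (P : X.Opensᵒᵖ ⥤ RingCat.{u}) (α : X.ringCatSheaf.obj ⟶ P)
  (hα : ∀ (U : X.Opens) (r : Γ(X, U)) (a : P.obj (op U)),
    presheafUnit P α U r * a = a * presheafUnit P α U r)

/-- The sheaf of algebras associated with a presheaf of algebras. -/
def ofPresheaf : AlgSheaf X where
  carrier := (presheafToSheaf (Opens.grothendieckTopology X) RingCat.{u}).obj P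
  unit := ⟨α ≫ toSheafify _ _⟩
  central U r a := by
    refine sheaf_ext _ _ _ fun x hx => ?_
    obtain ⟨V, hV, s, hxV, hs⟩ := exists_locally_eq_toSheafify P a x hx
    refine ⟨V, hV, hxV, ?_⟩
    let η := ((toSheafify (Opens.grothendieckTopology X) P).app (op V)).hom
    have h1 := (toSheafify_map_apply P hV (presheafUnit P α U r)).symm.trans
      (congrArg η (presheafUnit_res P α hV r))
    refine (map_mul _ _ _).trans (Eq.trans ?_ (map_mul _ _ _).symm)
    refine (congrArg₂ (· * ·) h1 hs.symm).trans (Eq.trans ?_ (congrArg₂ (· * ·) hs.symm h1).symm)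
    exact (map_mul η _ _).symm.trans ((congrArg η (hα V _ s)).trans (map_mul η _ _))

/-- The map from a presheaf of algebras to the associated sheaf. -/
def ofPresheafMap (U : X.Opens) : P.obj (op U) →+* (ofPresheaf P α hα).sec U :=
  ((toSheafify (Opens.grothendieckTopology X) P).app (op U)).hom

theorem ofPresheafMap_unit {U : X.Opens} (r : Γ(X, U)) :
    ofPresheafMap P α hα U (presheafUnit P α U r) = algebraMap _ _ r := rfl

theorem res_ofPresheafMap {U V : X.Opens} (h : V ≤ U) (s : P.obj (op U)) :
    (ofPresheaf P α hα).res h (ofPresheafMap P α hα U s) =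
      ofPresheafMap P α hα V ((P.map (homOfLE h).op).hom s) :=
  (toSheafify_map_apply P h s).symm

/- The maps `θ` from a fixed module `M` to the presheaf over open subsets of an affine `U` exhibit its
values on basic open subsets as localisations of `M`. In this case the associated sheaf is, over `U`,
the quasi-coherent module defined by `M`. -/
variable {U : X.Opens} (hU : IsAffineOpen U) {M : Type u} [AddCommGroup M] [Module Γ(X, U) M]
  (θ : ∀ D ≤ U, M →+ P.obj (op D))
  (hθ : ∀ D h a x, θ D h (a • x) =
    presheafUnit P α D (X.presheaf.map (homOfLE h).op a) * θ D h x)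
  (hres : ∀ D h V (hV : V ≤ D) x, (P.map (homOfLE hV).op).hom (θ D h x) = θ V (hV.trans h) x)
  (hsurj : ∀ f (t : P.obj (op (X.basicOpen f))), ∃ (n : ℕ) (x : M),
    presheafUnit P α _ (X.presheaf.map (homOfLE (X.basicOpen_le f)).op f) ^ n * t =
      θ _ (X.basicOpen_le f) x)
  (hinj : ∀ f x, θ _ (X.basicOpen_le f) x = 0 → ∃ n : ℕ, f ^ n • x = 0)
include hU hθ hres hsurj hinj

/-- The sections over `U` of the associated sheaf are `M`. -/
theorem ofPresheafMap_comp_bijective :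
    Function.Bijective fun x => ofPresheafMap P α hα U (θ U le_rfl x) := by
  have key (D : X.Opens) (hD : D ≤ U) (e : D = X.basicOpen (1 : Γ(X, U))) :
      Function.Bijective fun x => ofPresheafMap P α hα D (θ D hD x) := by
    subst e
    refine Function.Bijective.comp
      (toSheafify_bijective_of_localization P α θ hθ hU hres hsurj hinj 1) ⟨?_, fun t => ?_⟩
    · refine (injective_iff_map_eq_zero _).2 fun x hx => ?_
      obtain ⟨n, hn⟩ := hinj 1 x hx
      rwa [one_pow, one_smul] at hn
    · obtain ⟨n, x, hx⟩ := hsurj 1 t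
      rw [map_one, map_one, one_pow, one_mul] at hx
      exact ⟨x, hx.symm⟩
  exact key U le_rfl (Scheme.basicOpen_one X).symm

/-- Restriction of sections of the associated sheaf to basic open subsets is localisation. -/
theorem isLocalizingOn_ofPresheaf : (ofPresheaf P α hα).toModules.IsLocalizingOn U := by
  rw [isLocalizingOn_iff]
  intro f
  have hη := toSheafify_bijective_of_localization P α θ hθ hU hres hsurj hinj f
  constructor
  · intro s
    obtain ⟨t, rfl⟩ := hη.2 s
    obtain ⟨n, x, hx⟩ := hsurj f t
    refine ⟨n, ofPresheafMap P α hα U (θ U le_rfl x), ?_⟩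
    rw [res_ofPresheafMap, hres, ← hx, map_mul, map_pow, ofPresheafMap_unit, ← map_pow]
    exact (Algebra.smul_def (A := (ofPresheaf P α hα).sec (X.basicOpen f)) _ _).symm
  · intro t ht
    obtain ⟨x, rfl⟩ :=
      (ofPresheafMap_comp_bijective P α hα hU θ hθ hres hsurj hinj).2 t
    have h1 : ofPresheafMap P α hα _ (θ _ (X.basicOpen_le f) x) = 0 := by
      rw [← hres U le_rfl _ (X.basicOpen_le f), ← res_ofPresheafMap]
      exact ht
    obtain ⟨n, hn⟩ := hinj f x (hη.1 (h1.trans (map_zero _).symm))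
    refine ⟨n, ?_⟩
    have h2 := hθ U le_rfl (f ^ n) x
    rw [hn, map_zero] at h2
    have h3 : X.presheaf.map (homOfLE (le_refl U)).op (f ^ n) = f ^ n :=
      congrArg (fun g : Γ(X, U) ⟶ Γ(X, U) => g.hom (f ^ n)) (X.presheaf.map_id (op U))
    rw [h3] at h2
    have h4 := congrArg (ofPresheafMap P α hα U) h2
    rw [map_zero, map_mul, ofPresheafMap_unit, ← Algebra.smul_def] at h4
    exact h4.symm

end AlgSheaf

namespace LineValuedForm

variable {S : Scheme.{u}} {E L : S.Modules} {σ : LineValuedForm E L} {m : ℕ}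

namespace CentralCover

variable (K : σ.CentralCover m)
  (hcomm : ∀ (U : S.Opens), ∀ z ∈ σ.centralPart m U, ∀ a, Commute z a)
  (hopen : IsOpenMap K.proj)

/-- Restriction of functions on the covering. -/
abbrev coverRes {V W : K.cover.Opens} (h : V ≤ W) : Γ(K.cover, W) →+* Γ(K.cover, V) :=
  (K.cover.presheaf.map (homOfLE h).op).hom

theorem coverRes_coverRes {V W D : K.cover.Opens} (h : V ≤ W) (h' : D ≤ V) (r : Γ(K.cover, W)) :
    K.coverRes h' (K.coverRes h r) = K.coverRes (h'.trans h) r :=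
  (congrArg (fun g : Γ(K.cover, W) ⟶ Γ(K.cover, D) => g.hom r) (K.cover.presheaf.map_comp
    (homOfLE h).op (homOfLE h').op)).symm

include hcomm in
theorem hom_mul_comm (V : S.Opens) (a : Γ(K.cover, K.proj ⁻¹ᵁ V)) (b : σ.evenCliffordSheaf.sec V) :
    K.hom V a * b = b * K.hom V a :=
  hcomm V _ (K.range_eq V ▸ ⟨a, rfl⟩) b

/-- The image of an open subset of the covering. -/
def image (W : K.cover.Opens) : S.Opens := ⟨K.proj '' W, hopen _ W.2⟩

theorem le_preimage_image (W : K.cover.Opens) : W ≤ K.proj ⁻¹ᵁ K.image hopen W :=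
  fun x hx => ⟨x, hx, rfl⟩

theorem image_le {W : K.cover.Opens} {U : S.Opens} (h : W ≤ K.proj ⁻¹ᵁ U) :
    K.image hopen W ≤ U := by
  rintro _ ⟨x, hx, rfl⟩
  exact h hx

/-- The sections over `W` of the presheaf tensor product of the inverse image of `𝓑₀` with the
structure sheaf of the covering. -/
abbrev Tensor (W : K.cover.Opens) : Type u :=
  CentralTensor (K.hom (K.image hopen W)) (K.coverRes (K.le_preimage_image hopen W))
    (K.hom_mul_comm hcomm (K.image hopen W))

/-- Functions on the covering, as sections of the tensor product. -/
abbrev tensorInl (W : K.cover.Opens) : Γ(K.cover, W) →+* K.Tensor hcomm hopen W :=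
  CentralTensor.inl _ _ _

/-- Sections of the even Clifford algebra, as sections of the tensor product. -/
def tensorInr {W : K.cover.Opens} {U : S.Opens} (h : W ≤ K.proj ⁻¹ᵁ U) :
    σ.evenCliffordSheaf.sec U →+* K.Tensor hcomm hopen W :=
  (CentralTensor.inr _ _ _).comp (σ.evenCliffordSheaf.res (K.image_le hopen h))

theorem tensorInr_hom {W : K.cover.Opens} {U : S.Opens} (h : W ≤ K.proj ⁻¹ᵁ U)
    (a : Γ(K.cover, K.proj ⁻¹ᵁ U)) :
    K.tensorInr hcomm hopen h (K.hom U a) = K.tensorInl hcomm hopen W (K.coverRes h a) := by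
  have h1 : σ.evenCliffordSheaf.res (K.image_le hopen h) (K.hom U a) =
      K.hom _ (K.coverRes (K.proj.preimage_mono (K.image_le hopen h)) a) :=
    (K.hom_res (K.image_le hopen h) a).symm
  rw [tensorInr, RingHom.comp_apply, h1, CentralTensor.inr_apply, coverRes_coverRes]

/-- Restriction of sections of the tensor product. -/
def tensorRes {V W : K.cover.Opens} (h : V ≤ W) :
    K.Tensor hcomm hopen W →+* K.Tensor hcomm hopen V :=
  CentralTensor.lift _ _ _ ((K.tensorInl hcomm hopen V).comp (K.coverRes h))
    (K.tensorInr hcomm hopen (h.trans (K.le_preimage_image hopen W)))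
    (fun _ _ => CentralTensor.commute_inl _ _ _ _ _)
    (fun a => by rw [tensorInr_hom, RingHom.comp_apply, coverRes_coverRes])

theorem tensorRes_inl {V W : K.cover.Opens} (h : V ≤ W) (c : Γ(K.cover, W)) :
    K.tensorRes hcomm hopen h (K.tensorInl hcomm hopen W c) =
      K.tensorInl hcomm hopen V (K.coverRes h c) :=
  CentralTensor.lift_inl _ _ _ _ _ _ _ _

theorem tensorRes_inr' {V W : K.cover.Opens} (h : V ≤ W)
    (b : σ.evenCliffordSheaf.sec (K.image hopen W)) :
    K.tensorRes hcomm hopen h (CentralTensor.inr _ _ _ b) =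
      K.tensorInr hcomm hopen (h.trans (K.le_preimage_image hopen W)) b :=
  CentralTensor.lift_inr _ _ _ _ _ _ _ _

theorem tensorRes_inr {V W : K.cover.Opens} (h : V ≤ W) {U : S.Opens} (hW : W ≤ K.proj ⁻¹ᵁ U)
    (b : σ.evenCliffordSheaf.sec U) :
    K.tensorRes hcomm hopen h (K.tensorInr hcomm hopen hW b) =
      K.tensorInr hcomm hopen (h.trans hW) b := by
  rw [tensorInr, RingHom.comp_apply, tensorRes_inr', tensorInr, RingHom.comp_apply,
    AlgSheaf.res_res]
  rfl

theorem tensorInr_res {W : K.cover.Opens} {U V : S.Opens} (h : V ≤ U) (hW : W ≤ K.proj ⁻¹ᵁ V)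
    (b : σ.evenCliffordSheaf.sec U) :
    K.tensorInr hcomm hopen hW (σ.evenCliffordSheaf.res h b) =
      K.tensorInr hcomm hopen (hW.trans (K.proj.preimage_mono h)) b := by
  rw [tensorInr, RingHom.comp_apply, AlgSheaf.res_res]
  rfl

/-- The presheaf tensor product of the inverse image of `𝓑₀` with the structure sheaf of the
covering. -/
def tensorPresheaf : K.cover.Opensᵒᵖ ⥤ RingCat.{u} where
  obj W := RingCat.of (K.Tensor hcomm hopen W.unop)
  map i := RingCat.ofHom (K.tensorRes hcomm hopen i.unop.le)
  map_id W := by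
    refine RingCat.hom_ext (CentralTensor.ringHom_ext (fun c => ?_) fun b => ?_)
    · refine (K.tensorRes_inl hcomm hopen le_rfl c).trans (congrArg _ ?_)
      exact congrArg (fun g : Γ(K.cover, W.unop) ⟶ Γ(K.cover, W.unop) => g.hom c)
        (K.cover.presheaf.map_id W)
    · refine (K.tensorRes_inr' hcomm hopen le_rfl b).trans ?_
      rw [tensorInr, RingHom.comp_apply, AlgSheaf.res_self]
      rfl
  map_comp {W V D} i j := by
    refine RingCat.hom_ext (CentralTensor.ringHom_ext (fun c => ?_) fun b => ?_)
    · refine (K.tensorRes_inl hcomm hopen _ c).trans (Eq.trans ?_ (congrArg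
        (K.tensorRes hcomm hopen j.unop.le) (K.tensorRes_inl hcomm hopen i.unop.le c)).symm)
      refine Eq.trans ?_ (K.tensorRes_inl hcomm hopen j.unop.le _).symm
      rw [coverRes_coverRes]
    · refine (K.tensorRes_inr' hcomm hopen _ b).trans (Eq.trans ?_ (congrArg
        (K.tensorRes hcomm hopen j.unop.le) (K.tensorRes_inr' hcomm hopen i.unop.le b)).symm)
      exact (K.tensorRes_inr hcomm hopen j.unop.le _ b).symm

/-- The structure morphism of the tensor product. -/
def tensorUnit : K.cover.ringCatSheaf.obj ⟶ K.tensorPresheaf hcomm hopen where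
  app W := RingCat.ofHom (K.tensorInl hcomm hopen W.unop)
  naturality W V i := by
    refine RingCat.hom_ext (RingHom.ext fun c => ?_)
    exact (K.tensorRes_inl hcomm hopen i.unop.le c).symm

/-- The sheaf of algebras `𝓑̃₀` on the covering. -/
def coverAlg : AlgSheaf K.cover :=
  AlgSheaf.ofPresheaf (K.tensorPresheaf hcomm hopen) (K.tensorUnit hcomm hopen)
    fun _ r a => CentralTensor.commute_inl _ _ _ r a

end CentralCover

end LineValuedForm

namespace LineValuedForm

variable {S : Scheme.{u}} {E L : S.Modules} {σ : LineValuedForm E L} {m : ℕ}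
  [∀ U : S.Opens, Algebra ℚ Γ(S, U)]

attribute [local instance] invertibleTwoOfRat

variable (σ) in
/-- The even Clifford algebra over an open subset with frames, as the sections of `𝓑₀`. -/
def toSheafEquiv {U : S.Opens} {n : ℕ} (F : Framing E L n U) :
    EvenClifford (σ.form U) ≃ₐ[Γ(S, U)] σ.evenCliffordSheaf.sec U :=
  AlgEquiv.ofBijective { σ.toSheaf U with commutes' := fun r => σ.toSheaf_algebraMap r }
    (σ.toSheaf_bijective F)

variable (σ) in
/-- The basis of the sections of `𝓑₀` given by the products of an even number of members of a
frame. -/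
def sheafBasis {U : S.Opens} {n : ℕ} (F : Framing E L n U) :
    Module.Basis (EvenBool n) Γ(S, U) (σ.evenCliffordSheaf.sec U) :=
  (EvenClifford.evenBasis (σ.form U) F.bl F.be).map (σ.toSheafEquiv F).toLinearEquiv

theorem res_sheafBasis {U V : S.Opens} {n : ℕ} (F : Framing E L n U) (h : V ≤ U)
    (ε : EvenBool n) : σ.evenCliffordSheaf.res h (σ.sheafBasis F ε) =
      σ.sheafBasis (F.restrict h) ε := by
  rw [sheafBasis, sheafBasis, Module.Basis.map_apply, Module.Basis.map_apply]
  refine (σ.res_toSheaf h _).trans (congrArg (σ.toSheaf V) ?_)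
  refine EvenClifford.map_evenBasis (σ.form U) (σ.form V) (S.presheaf.map (homOfLE h).op).hom
    (resSemilinear E (homOfLE h)) (resSemilinear L (homOfLE h)) (σ.map_res (homOfLE h)) _ _ _ _
    (fun j => ?_) ?_ ε
  · rw [IsFrame.basis_apply, IsFrame.basis_apply]; rfl
  · rw [IsFrame.basis_apply, IsFrame.basis_apply]; rfl

namespace CentralCover

variable (K : σ.CentralCover m)
  (hcomm : ∀ (U : S.Opens), ∀ z ∈ σ.centralPart m U, ∀ a, Commute z a)
  (hopen : IsOpenMap K.proj)

/-- Sections of `𝓑₀` as a module over the functions on the covering. -/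
abbrev coverModule (U : S.Opens) :
    Module Γ(K.cover, K.proj ⁻¹ᵁ U) (σ.evenCliffordSheaf.sec U) :=
  ((K.hom U).toAlgebra' (K.hom_mul_comm hcomm U)).toModule

omit [∀ U : S.Opens, Algebra ℚ Γ(S, U)] in
theorem coverRes_app {U V : S.Opens} (h : V ≤ U) (r : Γ(S, U)) :
    K.coverRes (K.proj.preimage_mono h) (K.proj.app U r) =
      K.proj.app V (S.presheaf.map (homOfLE h).op r) :=
  (NatTrans.naturality_apply K.proj.c (homOfLE h).op r).symm

/-- Over open subsets with frames, the sections of `𝓑₀` over a smaller open subset are a base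
change along the functions on the covering. -/
theorem isBaseChange_res {U V : S.Opens} (h : V ≤ U) (F : Framing E L (2 * m) U) (hm : 0 < m)
    (hβ : ∀ (a : Γ(K.cover, K.proj ⁻¹ᵁ U)) (x : σ.evenCliffordSheaf.sec U),
      letI := K.coverModule hcomm U
      σ.evenCliffordSheaf.res h (a • x) =
        K.hom V (K.coverRes (K.proj.preimage_mono h) a) * σ.evenCliffordSheaf.res h x) :
    letI := K.coverModule hcomm U
    letI := (K.coverRes (K.proj.preimage_mono h)).toAlgebra
    letI := ((K.hom V).toAlgebra' (K.hom_mul_comm hcomm V)).toModule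
    letI := Module.compHom (σ.evenCliffordSheaf.sec V) (K.coverRes (K.proj.preimage_mono h))
    ∀ _ : IsScalarTower Γ(K.cover, K.proj ⁻¹ᵁ U) Γ(K.cover, K.proj ⁻¹ᵁ V)
      (σ.evenCliffordSheaf.sec V), IsBaseChange Γ(K.cover, K.proj ⁻¹ᵁ V)
        ({ (σ.evenCliffordSheaf.res h).toAddMonoidHom with map_smul' := hβ } :
          σ.evenCliffordSheaf.sec U →ₗ[Γ(K.cover, K.proj ⁻¹ᵁ U)] σ.evenCliffordSheaf.sec V) := by
  let := K.coverModule hcomm U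
  let := (K.coverRes (K.proj.preimage_mono h)).toAlgebra
  let := ((K.hom V).toAlgebra' (K.hom_mul_comm hcomm V)).toModule
  let := Module.compHom (σ.evenCliffordSheaf.sec V) (K.coverRes (K.proj.preimage_mono h))
  intro _
  let : Algebra Γ(S, U) Γ(K.cover, K.proj ⁻¹ᵁ U) := (K.proj.app U).hom.toAlgebra
  let : Algebra Γ(S, V) Γ(K.cover, K.proj ⁻¹ᵁ V) := (K.proj.app V).hom.toAlgebra
  have t1 : IsScalarTower Γ(S, U) Γ(K.cover, K.proj ⁻¹ᵁ U) (σ.evenCliffordSheaf.sec U) := by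
    refine ⟨fun r a x => ?_⟩
    change K.hom U (K.proj.app U r * a) * x = r • (K.hom U a * x)
    rw [map_mul, K.hom_app, mul_assoc, Algebra.smul_def]
  have t2 : IsScalarTower Γ(S, V) Γ(K.cover, K.proj ⁻¹ᵁ V) (σ.evenCliffordSheaf.sec V) := by
    refine ⟨fun r a x => ?_⟩
    change K.hom V (K.proj.app V r * a) * x = r • (K.hom V a * x)
    rw [map_mul, K.hom_app, mul_assoc, Algebra.smul_def]
  refine isBaseChange_of_basis (S.presheaf.map (homOfLE h).op).hom
    (fun r => (K.coverRes_app h r).symm) ?_ _ (σ.sheafBasis F) (σ.sheafBasis (F.restrict h))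
    (fun ε => res_sheafBasis F h ε)
  refine eq_top_iff.2 fun z _ => ?_
  have hz : K.hom V z ∈ σ.centralPart m V := K.range_eq V ▸ ⟨z, rfl⟩
  obtain ⟨r, s, hrs⟩ := (σ.mem_centralPart_iff (F.restrict h) hm _).1 hz
  have hmem : σ.toSheaf U (σ.frameOmega F) ∈ Set.range (K.hom U) := by
    rw [K.range_eq, σ.mem_centralPart_iff F hm]
    exact ⟨0, 1, by rw [map_zero, zero_add, one_smul]⟩
  obtain ⟨w, hw⟩ := hmem
  have hz' : z = r • algebraMap Γ(K.cover, K.proj ⁻¹ᵁ U) Γ(K.cover, K.proj ⁻¹ᵁ V) 1 +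
      s • algebraMap Γ(K.cover, K.proj ⁻¹ᵁ U) Γ(K.cover, K.proj ⁻¹ᵁ V) w := by
    refine K.injective V (hrs.trans ?_)
    have h1 : K.hom V (algebraMap Γ(K.cover, K.proj ⁻¹ᵁ U) Γ(K.cover, K.proj ⁻¹ᵁ V) w) =
        σ.toSheaf V (σ.frameOmega (F.restrict h)) := by
      refine (K.hom_res h w).trans ?_
      rw [hw, res_toSheaf, cliffordRes_frameOmega]
    have hs (r : Γ(S, V)) (y : Γ(K.cover, K.proj ⁻¹ᵁ V)) : K.hom V (r • y) = r • K.hom V y :=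
      (map_mul _ (K.proj.app V r) y).trans (by rw [K.hom_app, Algebra.smul_def])
    rw [map_add, hs, hs, h1, map_one, map_one, Algebra.algebraMap_eq_smul_one]
  rw [hz']
  exact add_mem (Submodule.smul_mem _ _ (Submodule.subset_span ⟨_, rfl⟩))
    (Submodule.smul_mem _ _ (Submodule.subset_span ⟨_, rfl⟩))

/-- The tensor product localizes over the inverse image of an affine open subset with frames. -/
theorem tensorInr_localizes {U : S.Opens} (hU : IsAffineOpen U) (F : Framing E L (2 * m) U)
    (hm : 0 < m) (f : Γ(K.cover, K.proj ⁻¹ᵁ U)) :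
    (∀ t : K.Tensor hcomm hopen (K.cover.basicOpen f), ∃ (n : ℕ) (x : σ.evenCliffordSheaf.sec U),
      K.tensorInl hcomm hopen _ (K.coverRes (K.cover.basicOpen_le f) f) ^ n * t =
        K.tensorInr hcomm hopen (K.cover.basicOpen_le f) x) ∧
    ∀ x : σ.evenCliffordSheaf.sec U, K.tensorInr hcomm hopen (K.cover.basicOpen_le f) x = 0 →
      ∃ n : ℕ, K.hom U f ^ n * x = 0 := by
  have := K.isAffineHom
  let hle := K.cover.basicOpen_le f
  let hD := K.image_le hopen hle
  let := K.coverModule hcomm U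
  let γ := K.coverRes hle
  let : Module Γ(K.cover, K.proj ⁻¹ᵁ U) (K.Tensor hcomm hopen (K.cover.basicOpen f)) :=
    Module.compHom _ ((K.tensorInl hcomm hopen (K.cover.basicOpen f)).comp γ)
  have hsm (a : Γ(K.cover, K.proj ⁻¹ᵁ U)) (t : K.Tensor hcomm hopen (K.cover.basicOpen f)) :
    a • t = K.tensorInl hcomm hopen _ (γ a) * t := rfl
  have hβ (a : Γ(K.cover, K.proj ⁻¹ᵁ U)) (x : σ.evenCliffordSheaf.sec U) :
      σ.evenCliffordSheaf.res hD (a • x) =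
        K.hom _ (K.coverRes (K.proj.preimage_mono hD) a) * σ.evenCliffordSheaf.res hD x := by
    refine (map_mul _ (K.hom U a) x).trans (congrArg (· * _) (K.hom_res hD a).symm)
  let θ : σ.evenCliffordSheaf.sec U →ₗ[Γ(K.cover, K.proj ⁻¹ᵁ U)]
      K.Tensor hcomm hopen (K.cover.basicOpen f) :=
    { (K.tensorInr hcomm hopen hle).toAddMonoidHom with
      map_smul' := fun a x => by
        refine (map_mul (K.tensorInr hcomm hopen hle) (K.hom U a) x).trans ?_
        exact congrArg (· * _) (K.tensorInr_hom hcomm hopen hle a) }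
  have h : IsLocalizedModule.Away f θ := by
    refine CentralTensor.isLocalizedModule _ _ _ (K.coverRes (K.proj.preimage_mono hD)) γ
      (fun a => K.coverRes_coverRes _ _ a) f ((hU.preimage K.proj).isLocalization_basicOpen f)
      (σ.evenCliffordSheaf.res hD).toAddMonoidHom hβ
      (K.isBaseChange_res hcomm hD F hm hβ) _ hsm θ fun x => rfl
  constructor
  · intro t
    obtain ⟨⟨x, ⟨_, n, rfl⟩⟩, hx⟩ := IsLocalizedModule.surj (.powers f) θ t
    refine ⟨n, x, ?_⟩
    rw [← map_pow, ← map_pow]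
    exact hx
  · intro x hx
    obtain ⟨⟨_, n, rfl⟩, hn⟩ := (IsLocalizedModule.eq_zero_iff (.powers f) θ).1 hx
    refine ⟨n, ?_⟩
    rw [← map_pow]
    exact hn

end CentralCover

end LineValuedForm

namespace LineValuedForm

variable {S : Scheme.{u}} {E L : S.Modules} {σ : LineValuedForm E L} {m : ℕ}

namespace CentralCover

variable (K : σ.CentralCover m)
  (hcomm : ∀ (U : S.Opens), ∀ z ∈ σ.centralPart m U, ∀ a, Commute z a)
  (hopen : IsOpenMap K.proj)

/-- The canonical map from `𝓑₀` to the direct image of `𝓑̃₀`. -/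
def coverHom (U : S.Opens) :
    σ.evenCliffordSheaf.sec U →+* (K.coverAlg hcomm hopen).sec (K.proj ⁻¹ᵁ U) :=
  (AlgSheaf.ofPresheafMap (K.tensorPresheaf hcomm hopen) (K.tensorUnit hcomm hopen)
    (fun _ r a => CentralTensor.commute_inl _ _ _ r a) (K.proj ⁻¹ᵁ U)).comp
    (K.tensorInr hcomm hopen le_rfl)

theorem coverHom_hom {U : S.Opens} (r : Γ(K.cover, K.proj ⁻¹ᵁ U)) :
    K.coverHom hcomm hopen U (K.hom U r) = algebraMap _ _ r := by
  have h1 : K.coverRes (le_refl (K.proj ⁻¹ᵁ U)) r = r :=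
    congrArg (fun g : Γ(K.cover, K.proj ⁻¹ᵁ U) ⟶ Γ(K.cover, K.proj ⁻¹ᵁ U) => g.hom r)
      (K.cover.presheaf.map_id (op (K.proj ⁻¹ᵁ U)))
  have h2 := (K.tensorInr_hom hcomm hopen le_rfl r).trans
    (congrArg (K.tensorInl hcomm hopen _) h1)
  exact congrArg (AlgSheaf.ofPresheafMap (K.tensorPresheaf hcomm hopen)
    (K.tensorUnit hcomm hopen) (fun _ r a => CentralTensor.commute_inl _ _ _ r a)
    (K.proj ⁻¹ᵁ U)) h2

theorem res_coverHom {U V : S.Opens} (h : V ≤ U) (b : σ.evenCliffordSheaf.sec U) :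
    (K.coverAlg hcomm hopen).res (K.proj.preimage_mono h) (K.coverHom hcomm hopen U b) =
      K.coverHom hcomm hopen V (σ.evenCliffordSheaf.res h b) := by
  refine (AlgSheaf.res_ofPresheafMap _ _ _ _ _).trans ?_
  refine congrArg (AlgSheaf.ofPresheafMap (K.tensorPresheaf hcomm hopen)
    (K.tensorUnit hcomm hopen) (fun _ r a => CentralTensor.commute_inl _ _ _ r a)
    (K.proj ⁻¹ᵁ V)) ?_
  exact (K.tensorRes_inr hcomm hopen (K.proj.preimage_mono h) le_rfl b).trans
    (K.tensorInr_res hcomm hopen h le_rfl b).symm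

variable [∀ U : S.Opens, Algebra ℚ Γ(S, U)]

/-- Over the preimage of an affine open subset `U` with frames, `𝓑̃₀` is the quasi-coherent sheaf
associated with the sections of `𝓑₀` over `U`. -/
theorem coverHom_bijective_and_isLocalizingOn {U : S.Opens} (hU : IsAffineOpen U)
    (F : Framing E L (2 * m) U) (hm : 0 < m) :
    Function.Bijective (K.coverHom hcomm hopen U) ∧
      (K.coverAlg hcomm hopen).toModules.IsLocalizingOn (K.proj ⁻¹ᵁ U) := by
  have := K.isAffineHom
  have hV := hU.preimage K.proj
  let := K.coverModule hcomm U
  let P := K.tensorPresheaf hcomm hopen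
  let α := K.tensorUnit hcomm hopen
  have hα : ∀ (D : K.cover.Opens) (r : Γ(K.cover, D)) (a : P.obj (op D)),
    presheafUnit P α D r * a = a * presheafUnit P α D r :=
    fun _ r a => CentralTensor.commute_inl _ _ _ r a
  let θ (D : K.cover.Opens) (h : D ≤ K.proj ⁻¹ᵁ U) :
      σ.evenCliffordSheaf.sec U →+ P.obj (op D) := (K.tensorInr hcomm hopen h).toAddMonoidHom
  have hθ : ∀ D h (a : Γ(K.cover, K.proj ⁻¹ᵁ U)) (x : σ.evenCliffordSheaf.sec U),
      θ D h (a • x) =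
        presheafUnit P α D (K.cover.presheaf.map (homOfLE h).op a) * θ D h x := by
    intro D h a x
    refine (map_mul (K.tensorInr hcomm hopen h) (K.hom U a) x).trans ?_
    exact congrArg (· * _) (K.tensorInr_hom hcomm hopen h a)
  have hres : ∀ D h V (hV : V ≤ D) x,
      (P.map (homOfLE hV).op).hom (θ D h x) = θ V (hV.trans h) x :=
    fun D h V hV x => K.tensorRes_inr hcomm hopen hV h x
  have hsurj (f : Γ(K.cover, K.proj ⁻¹ᵁ U)) :=
    (K.tensorInr_localizes hcomm hopen hU F hm f).1
  have hinj (f : Γ(K.cover, K.proj ⁻¹ᵁ U)) (x : σ.evenCliffordSheaf.sec U)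
      (hx : θ _ (K.cover.basicOpen_le f) x = 0) : ∃ n : ℕ, f ^ n • x = 0 := by
    obtain ⟨n, hn⟩ := (K.tensorInr_localizes hcomm hopen hU F hm f).2 x hx
    refine ⟨n, ?_⟩
    change K.hom U (f ^ n) * x = 0
    rw [map_pow, hn]
  exact ⟨AlgSheaf.ofPresheafMap_comp_bijective P α hα hV θ hθ hres hsurj hinj,
    AlgSheaf.isLocalizingOn_ofPresheaf P α hα hV θ hθ hres hsurj hinj⟩

include K in
/-- A covering by the spectrum of `𝓩` carries the sheaf of algebras `𝓑̃₀`. -/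
theorem nonempty_centralReduction (hE : IsVectorBundle E (2 * m)) (hL : IsVectorBundle L 1)
    (hσ : σ.IsEmbedding) : Nonempty (σ.CentralReduction m) := by
  have hcomm (U : S.Opens) : ∀ z ∈ σ.centralPart m U, ∀ a, Commute z a :=
    fun z hz a => σ.commute_of_mem_centralPart hE hL hσ hz a
  have hopen : IsOpenMap K.proj := by
    have := K.flat hE hL hσ
    have := K.locallyOfFinitePresentation hE hL hσ
    exact K.proj.isOpenMap
  let A := K.coverAlg hcomm hopen
  let ι := {U : S.Opens // IsAffineOpen U ∧ (U : Set S).Nonempty ∧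
    Nonempty (Framing E L (2 * m) U)}
  have hcov {x : S} {V : S.Opens} (hx : x ∈ V) : ∃ U : ι, x ∈ U.1 ∧ U.1 ≤ V := by
    obtain ⟨W, hxW, ⟨F⟩⟩ := Framing.exists_mem hE hL x
    obtain ⟨U, hU, hxU, hUW⟩ := Opens.isBasis_iff_nbhd.1 S.isBasis_affineOpens
      (show x ∈ V ⊓ W from ⟨hx, hxW⟩)
    exact ⟨⟨U, hU, ⟨x, hxU⟩, ⟨F.restrict (hUW.trans inf_le_right)⟩⟩, hxU,
      hUW.trans inf_le_left⟩
  have key (U : ι) : Function.Bijective (K.coverHom hcomm hopen U.1) ∧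
      A.toModules.IsLocalizingOn (K.proj ⁻¹ᵁ U.1) := by
    obtain ⟨U, hU, ⟨x, -⟩, ⟨F⟩⟩ := U
    exact K.coverHom_bijective_and_isLocalizingOn hcomm hopen hU F (hσ.rank_pos hE x)
  let ψ : σ.evenCliffordSheaf.carrier ⟶ (A.pushforward K.proj).carrier :=
    ⟨{ app U := RingCat.ofHom (K.coverHom hcomm hopen U.unop)
       naturality U V i := by
        refine RingCat.hom_ext (RingHom.ext fun b => ?_)
        exact (K.res_coverHom hcomm hopen i.unop.le b).symm }⟩
  have hψ : IsIso ψ := by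
    refine TopCat.Sheaf.isIso_iff_isIso_basis (B := fun U : ι => U.1) ?_ fun U => ?_
    · refine Opens.isBasis_iff_nbhd.2 fun {V x} hx => ?_
      obtain ⟨U, hxU, hUV⟩ := hcov hx
      exact ⟨U.1, ⟨U, rfl⟩, hxU, hUV⟩
    · exact (ConcreteCategory.isIso_iff_bijective _).2 (key U).1
  have hhom (U : S.Opens) (r : Γ(K.cover, K.proj ⁻¹ᵁ U)) :
      ((inv ψ).hom.app (op U)).hom (algebraMap _ (A.sec (K.proj ⁻¹ᵁ U)) r) = K.hom U r := by
    rw [← K.coverHom_hom hcomm hopen]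
    have h := congrArg (fun g => (g.hom.app (op U)).hom (K.hom U r)) (IsIso.hom_inv_id ψ)
    exact h
  refine ⟨⟨K.cover, K.proj, K.isAffineHom, A, ?_, ⟨(asIso ψ).symm, ?_⟩, fun U => ?_,
    fun U => ?_⟩⟩
  · refine Scheme.Modules.isQuasicoherent_of_isLocalizingOn _ fun x => ?_
    obtain ⟨U, hxU, -⟩ := hcov (show K.proj x ∈ (⊤ : S.Opens) from trivial)
    have := K.isAffineHom
    exact ⟨K.proj ⁻¹ᵁ U.1, hxU, U.2.1.preimage K.proj, (key U).2⟩
  · refine Sheaf.hom_ext (NatTrans.ext (funext fun U => RingCat.hom_ext (RingHom.ext fun r => ?_)))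
    exact (hhom U.unop (K.proj.app U.unop r)).trans (K.hom_app r)
  · exact (funext (hhom U) : _ = ⇑(K.hom U)).symm ▸ K.injective U
  · exact (congrArg Set.range (funext (hhom U) : _ = ⇑(K.hom U))).trans (K.range_eq U)

end CentralCover

end LineValuedForm

/-! ### The Azumaya property outside the second degeneration locus -/

namespace AlgSheaf

variable {X : Scheme.{u}} (A : AlgSheaf X)

/-- Sections over a smaller open subset, as an algebra over the functions on a larger one. -/
abbrev resAlgebra {U V : X.Opens} (h : V ≤ U) : Algebra Γ(X, U) (A.sec V) :=
  ((algebraMap Γ(X, V) (A.sec V)).comp (X.presheaf.map (homOfLE h).op).hom).toAlgebra'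
    fun r a => Algebra.commutes (X.presheaf.map (homOfLE h).op r) a

/-- Restriction of sections as a homomorphism of algebras. -/
abbrev resAlgHom {U V : X.Opens} (h : V ≤ U) :
    letI := A.resAlgebra h; A.sec U →ₐ[Γ(X, U)] A.sec V :=
  letI := A.resAlgebra h
  { A.res h with commutes' := fun r => A.res_algebraMap h r }

variable {A} in
theorem isLocalizedModule_resAlgHom {U : X.Opens} (h : A.toModules.IsLocalizingOn U)
    (f : Γ(X, U)) : letI := A.resAlgebra (X.basicOpen_le f)
    IsLocalizedModule.Away f (A.resAlgHom (X.basicOpen_le f)).toLinearMap := by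
  rw [isLocalizingOn_iff] at h
  refine isLocalizedModule_presheaf A.carrier.obj A.unit.hom (U := U) (M := A.sec U)
    (fun D hD => (A.res hD).toAddMonoidHom) (fun D hD a x => ?_) f (fun t => ?_) (h f).2
  · rw [Algebra.smul_def]
    refine (map_mul (A.res hD) _ x).trans (congrArg (· * _) (A.res_algebraMap hD a))
  · obtain ⟨n, x, hx⟩ := (h f).1 t
    refine ⟨n, x, Eq.trans ?_ hx.symm⟩
    rw [← map_pow]
    exact (Algebra.smul_def (A := A.sec (X.basicOpen f)) _ _).symm

/-- The Azumaya property can be checked on a neighbourhood of each point. -/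
theorem isAzumayaOn_of_locally (hA : A.toModules.IsQuasicoherent) {W : X.Opens} {r : ℕ}
    (h : ∀ U : X.Opens, IsAffineOpen U → U ≤ W → ∀ x ∈ U, ∃ f : Γ(X, U), x ∈ X.basicOpen f ∧
      IsAzumaya Γ(X, X.basicOpen f) (A.sec (X.basicOpen f)) ∧
      ∀ p : PrimeSpectrum Γ(X, X.basicOpen f),
        Module.rankAtStalk (A.sec (X.basicOpen f)) p = r ^ 2) : A.IsAzumayaOn W r := by
  refine ⟨hA, fun U hU hUW => ?_⟩
  let s : Set Γ(X, U) := {f | IsAzumaya Γ(X, X.basicOpen f) (A.sec (X.basicOpen f)) ∧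
      ∀ p : PrimeSpectrum Γ(X, X.basicOpen f),
        Module.rankAtStalk (A.sec (X.basicOpen f)) p = r ^ 2}
  have hs : Ideal.span s = ⊤ := by
    rw [← hU.iSup_basicOpen_eq_self_iff]
    refine le_antisymm (iSup_le fun f => X.basicOpen_le _) fun x hx => ?_
    obtain ⟨f, hxf, hf⟩ := h U hU hUW x hx
    exact Opens.mem_iSup.2 ⟨⟨f, hf⟩, hxf⟩
  let _ (g : s) : Algebra Γ(X, U) (A.sec (X.basicOpen g.1)) := A.resAlgebra (X.basicOpen_le g.1)
  have hloc (g : s) : IsLocalization.Away g.1 Γ(X, X.basicOpen g.1) :=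
    hU.isLocalization_basicOpen g.1
  have ht (g : s) : IsScalarTower Γ(X, U) Γ(X, X.basicOpen g.1) (A.sec (X.basicOpen g.1)) :=
    .of_algebraMap_eq fun r => rfl
  have hmod (g : s) : IsLocalizedModule.Away g.1
      (A.resAlgHom (X.basicOpen_le g.1)).toLinearMap :=
    isLocalizedModule_resAlgHom (Scheme.Modules.isLocalizingOn_of_isQuasicoherent _ hU) g.1
  have haz : IsAzumaya Γ(X, U) (A.sec U) :=
    isAzumaya_of_localizationSpan s hs (W' := fun g => Γ(X, X.basicOpen g.1))
      (A' := fun g => A.sec (X.basicOpen g.1)) (fun g => A.resAlgHom (X.basicOpen_le g.1))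
      fun g => g.2.1
  exact ⟨haz, rankAtStalk_eq_of_localizationSpan s hs (W' := fun g => Γ(X, X.basicOpen g.1))
      (A' := fun g => A.sec (X.basicOpen g.1)) (fun g => A.resAlgHom (X.basicOpen_le g.1)) _
      fun g => g.2.2⟩

/-- A basis of products of anticommuting units of the sections over an affine open subset gives the
Azumaya property on its basic open subsets. -/
theorem isAzumaya_basicOpen_of_basis (hA : A.toModules.IsQuasicoherent) {U : X.Opens}
    (hU : IsAffineOpen U) (h2 : IsUnit (2 : Γ(X, U))) {r : ℕ} (g : Fin (2 * r) → A.sec U)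
    (hg : ∀ i j, i ≠ j → g i * g j = -(g j * g i)) (hu : ∀ i, IsUnit (g i))
    (bas : Module.Basis (Fin (2 * r) → Bool) Γ(X, U) (A.sec U))
    (hbas : ∀ ε, bas ε = boolProd g ε) (f : Γ(X, U)) :
    IsAzumaya Γ(X, X.basicOpen f) (A.sec (X.basicOpen f)) ∧
      ∀ p : PrimeSpectrum Γ(X, X.basicOpen f),
        Module.rankAtStalk (A.sec (X.basicOpen f)) p = (2 ^ r) ^ 2 := by
  let := A.resAlgebra (X.basicOpen_le f)
  have := hU.isLocalization_basicOpen f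
  have : IsScalarTower Γ(X, U) Γ(X, X.basicOpen f) (A.sec (X.basicOpen f)) :=
    .of_algebraMap_eq fun r => rfl
  have : IsLocalizedModule.Away f (A.resAlgHom (X.basicOpen_le f)).toLinearMap :=
    isLocalizedModule_resAlgHom (Scheme.Modules.isLocalizingOn_of_isQuasicoherent _ hU) f
  let bas' := bas.ofIsLocalizedModule Γ(X, X.basicOpen f) (.powers f)
    (A.resAlgHom (X.basicOpen_le f)).toLinearMap
  let ρ := A.res (X.basicOpen_le f)
  have h2' : IsUnit (2 : Γ(X, X.basicOpen f)) := by
    have h := h2.map (X.presheaf.map (homOfLE (X.basicOpen_le f)).op).hom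
    rwa [map_ofNat] at h
  let := h2'.invertible
  constructor
  · refine isAzumaya_of_anticommuting (fun i => ρ (g i)) (even_two_mul r) (fun i j hij => ?_)
      (fun i => (hu i).map ρ) bas' fun ε => ?_
    · rw [← map_mul, hg i j hij, map_neg, map_mul]
    · refine (Module.Basis.ofIsLocalizedModule_apply ..).trans ?_
      refine (congrArg ρ (hbas ε)).trans ?_
      exact map_boolProd ρ g ε
  · intro p
    have := p.nontrivial
    have := Module.Free.of_basis bas'
    rw [Module.rankAtStalk_eq_finrank_of_free, Module.finrank_eq_card_basis bas']
    rw [pow_right_comm, ← pow_mul]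
    simp

end AlgSheaf

namespace LineValuedForm

variable {S : Scheme.{u}} {E L : S.Modules} (σ : LineValuedForm E L)

/-- Elements of the residue field at a point of an affine open subset are fractions of values of
functions. -/
theorem _root_.AlgebraicGeometry.IsAffineOpen.exists_evaluation_eq {U : S.Opens}
    (hU : IsAffineOpen U) {x : S} (hx : x ∈ U) (y : S.residueField x) : ∃ a s : Γ(S, U),
      S.evaluation U x hx s ≠ 0 ∧ y * S.evaluation U x hx s = S.evaluation U x hx a := by
  let := S.presheaf.algebra_section_stalk ⟨x, hx⟩
  have := hU.isLocalization_stalk ⟨x, hx⟩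
  obtain ⟨z, rfl⟩ := S.residue_surjective x y
  obtain ⟨⟨a, s⟩, h⟩ := IsLocalization.surj (hU.primeIdealOf ⟨x, hx⟩).asIdeal.primeCompl z
  refine ⟨a, s, ?_, ?_⟩
  · have h1 : IsUnit (S.presheaf.germ U x hx s.1) :=
      IsLocalization.map_units (S.presheaf.stalk x) s
    exact (h1.map (S.residue x).hom).ne_zero
  · exact (map_mul (S.residue x).hom z _).symm.trans (congrArg (S.residue x).hom h)

theorem _root_.Framing.det_restrict {U V : S.Opens} {n : ℕ} (F : Framing E L n U) (h : V ≤ U)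
    (f : Fin n → Γ(E, U)) :
    (F.restrict h).be.det (fun i => E.presheaf.map (homOfLE h).op (f i)) =
      S.presheaf.map (homOfLE h).op (F.be.det f) := by
  refine Eq.trans ?_ ((S.presheaf.map (homOfLE h).op).hom.map_det _).symm
  rw [Module.Basis.det_apply]
  congr 1
  ext i j
  have h1 := congrArg (resSemilinear E (homOfLE h)) (F.be.sum_repr (f j))
  rw [map_sum] at h1
  have h2 : E.presheaf.map (homOfLE h).op (f j) =
      ∑ k, S.presheaf.map (homOfLE h).op (F.be.repr (f j) k) • (F.restrict h).be k := by
    refine h1.symm.trans (Finset.sum_congr rfl fun k _ => ?_)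
    rw [LinearMap.map_smulₛₗ, IsFrame.basis_apply, IsFrame.basis_apply]
    rfl
  rw [Module.Basis.toMatrix_apply, h2, Module.Basis.repr_sum_self]
  rfl

/-- Near a point where the corank is at most one there is an orthogonal frame all of whose members,
except possibly the last one, have invertible norm. -/
theorem exists_orthogonal_framing [∀ U : S.Opens, Algebra ℚ Γ(S, U)] {r : ℕ}
    (hE : IsVectorBundle E (2 * (r + 1))) (hL : IsVectorBundle L 1) {x : S}
    (hx : x ∈ σ.degeneracyCompl (2 * (r + 1)) 2) :
    ∃ (U : S.Opens) (F : Framing E L (2 * (r + 1)) U), IsAffineOpen U ∧ x ∈ U ∧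
      (∀ i j, i ≠ j → σ.form U (F.be i) (F.be j) (F.bl 0) = 0) ∧
      ∀ i : Fin (2 * r + 1),
        IsUnit (σ.form U (F.be i.castSucc) (F.be i.castSucc) (F.bl 0)) := by
  simp only [degeneracyCompl, Opens.mem_iSup] at hx
  obtain ⟨W, v, w, t, hx⟩ := hx
  obtain ⟨W', hxW', ⟨F'⟩⟩ := Framing.exists_mem hE hL x
  obtain ⟨U, hU, hxU, hUW⟩ := Opens.isBasis_iff_nbhd.1 S.isBasis_affineOpens
    (show x ∈ W ⊓ W' from ⟨S.basicOpen_le _ hx, hxW'⟩)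
  have hUW₁ : U ≤ W := hUW.trans inf_le_left
  let F := F'.restrict (hUW.trans inf_le_right)
  have h1 : x ∈ S.basicOpen (S.presheaf.map (homOfLE hUW₁).op
      (Matrix.of fun i j => σ.form W (v i) (w j) (t i)).det) := by
    rw [Scheme.basicOpen_res]
    exact ⟨hxU, hx⟩
  rw [← σ.det_minor_restrict] at h1
  let π := (S.evaluation U x hxU).hom
  have hπ (a : Γ(S, U)) : π a ≠ 0 ↔ x ∈ S.basicOpen a :=
    S.evaluation_ne_zero_iff_mem_basicOpen x hxU a
  -- The matrix is transposed because here the columns, not the rows, carry the sections of `L`.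
  have h2 : π (Matrix.of fun i j => σ.form U (E.presheaf.map (homOfLE hUW₁).op (w i))
      (E.presheaf.map (homOfLE hUW₁).op (v j)) (L.presheaf.map (homOfLE hUW₁).op (t j))).det ≠ 0 := by
    rw [hπ, ← Matrix.det_transpose]
    convert h1 using 4
    ext i j
    exact LinearMap.congr_fun (σ.symm U _ _) _
  obtain ⟨f, ho, hdet, hnorm⟩ := EvenClifford.exists_orthogonal_of_minor (σ.form U) π (σ.symm U)
    (hU.exists_evaluation_eq hxU) F.bl (n := 2 * r + 1) F.be _ _ _ h2
  -- The vectors `f` are a frame with invertible norms, apart from the last one, where `d` does not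
  -- vanish.
  let d : Γ(S, U) := F.be.det f * ∏ i : Fin (2 * r + 1),
    σ.form U (f i.castSucc) (f i.castSucc) (F.bl 0)
  have hxd : x ∈ S.basicOpen d := by
    rw [← hπ, map_mul, map_prod]
    exact mul_ne_zero hdet (Finset.prod_ne_zero_iff.2 fun i _ => hnorm i)
  let D := S.basicOpen d
  have hD : D ≤ U := S.basicOpen_le d
  let ρ := (S.presheaf.map (homOfLE hD).op).hom
  have hd : IsUnit (ρ d) := RingedSpace.isUnit_res_basicOpen _ d
  rw [map_mul, map_prod, IsUnit.mul_iff, IsUnit.prod_iff] at hd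
  have hbas := (F.restrict hD).be.is_basis_iff_det.2 ((F.det_restrict hD f).symm ▸ hd.1)
  let e := Module.Basis.mk hbas.1 hbas.2.ge
  let F₁ : Framing E L (2 * (r + 1)) D :=
    ⟨e, (F.restrict hD).l, (F.restrict hD).he.of_basis e, (F.restrict hD).hl⟩
  have key (i j : Fin (2 * (r + 1))) :
      σ.form D (F₁.be i) (F₁.be j) (F₁.bl 0) = ρ (σ.form U (f i) (f j) (F.bl 0)) := by
    rw [IsFrame.basis_apply, IsFrame.basis_apply, IsFrame.basis_apply, IsFrame.basis_apply]
    refine Eq.trans ?_ (σ.map_res (homOfLE hD) _ _ _)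
    change σ.form D (e i) (e j) _ = _
    rw [Module.Basis.mk_apply, Module.Basis.mk_apply]
    rfl
  refine ⟨D, F₁, hU.basicOpen d, hxd, fun i j hij => ?_, fun i => ?_⟩
  · rw [key, ho i j hij, map_zero]
  · exact (key i.castSucc i.castSucc).symm ▸ hd.2 i (Finset.mem_univ i)

namespace CentralReduction

variable {σ} {r : ℕ} (C : σ.CentralReduction (r + 1))

/-- The identification of the sections of `𝓑̃₀` over the inverse image of an open subset with frames
with the even Clifford algebra. -/
def equivEvenClifford [∀ U : S.Opens, Algebra ℚ Γ(S, U)] {U : S.Opens} {n : ℕ}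
    (F : Framing E L n U) : C.alg.sec (C.proj ⁻¹ᵁ U) ≃+* EvenClifford (σ.form U) :=
  let i := (sheafToPresheaf _ _).mapIso C.iso.ringIso
  ((i.app (op U)).ringCatIsoToRingEquiv : C.alg.sec (C.proj ⁻¹ᵁ U) ≃+* σ.evenCliffordSheaf.sec U).trans
    (σ.toSheafEquiv F).symm.toRingEquiv

/-- `𝓑̃₀` over the preimage of an open subset with an orthogonal frame has a basis over the functions on
the covering consisting of the products of anticommuting units. -/
theorem exists_basis [∀ U : S.Opens, Algebra ℚ Γ(S, U)] {U : S.Opens}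
    (F : Framing E L (2 * (r + 1)) U)
    (ho : ∀ i j, i ≠ j → σ.form U (F.be i) (F.be j) (F.bl 0) = 0)
    (hu : ∀ i : Fin (2 * r + 1),
      IsUnit (σ.form U (F.be i.castSucc) (F.be i.castSucc) (F.bl 0))) :
    ∃ g : Fin (2 * r) → C.alg.sec (C.proj ⁻¹ᵁ U), (∀ i j, i ≠ j → g i * g j = -(g j * g i)) ∧
      (∀ i, IsUnit (g i)) ∧
      ∃ bas : Module.Basis (Fin (2 * r) → Bool) Γ(C.cover, C.proj ⁻¹ᵁ U)
        (C.alg.sec (C.proj ⁻¹ᵁ U)), ∀ ε, bas ε = boolProd g ε := by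
  let e := C.equivEvenClifford F
  have he (a : C.alg.sec (C.proj ⁻¹ᵁ U)) : σ.toSheaf U (e a) = C.iso.app U a :=
    (σ.toSheafEquiv F).apply_symm_apply (C.iso.app U a)
  let : Algebra Γ(C.cover, C.proj ⁻¹ᵁ U) (EvenClifford (σ.form U)) :=
    (e.toRingHom.comp (algebraMap _ _)).toAlgebra' fun z a => by
      obtain ⟨a, rfl⟩ := e.surjective a
      exact (map_mul e _ _).symm.trans
        ((congrArg e (Algebra.commutes z a)).trans (map_mul e _ _))
  have hinj : Function.Injective
      (algebraMap Γ(C.cover, C.proj ⁻¹ᵁ U) (EvenClifford (σ.form U))) := by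
    intro z z' h
    exact C.injective U ((he _).symm.trans ((congrArg (σ.toSheaf U) h).trans (he _)))
  -- the image of the functions on the covering is `R + R ω`
  have hZ (x : EvenClifford (σ.form U)) :
      x ∈ (algebraMap Γ(C.cover, C.proj ⁻¹ᵁ U) (EvenClifford (σ.form U))).range ↔
        ∃ a s : Γ(S, U), x = algebraMap _ _ a + s • EvenClifford.omega (σ.form U) F.bl F.be := by
    have h1 : x ∈ (algebraMap Γ(C.cover, C.proj ⁻¹ᵁ U) (EvenClifford (σ.form U))).range ↔
        σ.toSheaf U x ∈ σ.centralPart (r + 1) U := by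
      rw [← C.range_eq U]
      constructor
      · rintro ⟨z, rfl⟩
        exact ⟨z, (he _).symm⟩
      · rintro ⟨z, hz⟩
        exact ⟨z, (σ.toSheaf_bijective F).1 ((he _).trans hz)⟩
    rw [h1, σ.mem_centralPart_iff F r.succ_pos]
    refine exists_congr fun a => exists_congr fun s => ?_
    rw [← σ.toSheaf_algebraMap, ← σ.toSheaf_smul, ← map_add]
    exact (σ.toSheaf_bijective F).1.eq_iff
  obtain ⟨bas, hbas⟩ := EvenClifford.exists_basis_over_centre (σ.form U) (σ.symm U) F.bl F.be
    ho hu hZ hinj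
  let c := EvenClifford.centralGen (σ.form U) F.bl F.be
  let e' : EvenClifford (σ.form U) ≃ₗ[Γ(C.cover, C.proj ⁻¹ᵁ U)] C.alg.sec (C.proj ⁻¹ᵁ U) :=
    { e.symm with
      map_smul' := fun z x => by
        obtain ⟨x, rfl⟩ := e.surjective x
        rw [Algebra.smul_def, Algebra.smul_def]
        refine (map_mul e.symm _ _).trans (congrArg (· * _) (e.symm_apply_apply _)) }
  refine ⟨fun i => e.symm (c i), fun i j hij => ?_, fun i => ?_, bas.map e', fun ε => ?_⟩
  · rw [← map_mul, ← map_mul, ← map_neg,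
      EvenClifford.centralGen_anticomm (σ.form U) (σ.symm U) F.bl F.be ho i j hij]
  · refine IsUnit.map e.symm ?_
    obtain ⟨q, hq⟩ := EvenClifford.centralGen_sq (σ.form U) (σ.symm U) F.bl F.be ho hu i
    have h1 : IsUnit (c i * c i) := hq.symm ▸ q.isUnit.map _
    exact ((Commute.refl (c i)).isUnit_mul_iff.1 h1).1
  · rw [Module.Basis.map_apply, hbas]
    exact map_boolProd e.symm c ε

end CentralReduction

/-- Outside the second degeneration locus `𝓑̃₀` is a sheaf of Azumaya algebras. -/
theorem CentralReduction.isAzumayaOn [∀ U : S.Opens, Algebra ℚ Γ(S, U)] {σ : LineValuedForm E L}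
    {m : ℕ} (hE : IsVectorBundle E (2 * m)) (hL : IsVectorBundle L 1) (hσ : σ.IsEmbedding)
    (C : σ.CentralReduction m) :
    C.alg.IsAzumayaOn (C.proj ⁻¹ᵁ σ.degeneracyCompl (2 * m) 2) (2 ^ (m - 1)) := by
  refine C.alg.isAzumayaOn_of_locally C.isQuasicoherent fun W hW hWU y hy => ?_
  obtain ⟨r, rfl⟩ := Nat.exists_eq_succ_of_ne_zero (hσ.rank_pos hE (C.proj y)).ne'
  have := C.isAffineHom
  obtain ⟨U, F, hU, hyU, ho, hu⟩ := σ.exists_orthogonal_framing hE hL (hWU hy)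
  obtain ⟨f, g, hfg, hyf⟩ := exists_basicOpen_le_affine_inter hW (hU.preimage C.proj) y ⟨hy, hyU⟩
  obtain ⟨c, hc, hcu, bas, hbas⟩ := C.exists_basis F ho hu
  have h2 : IsUnit (2 : Γ(C.cover, C.proj ⁻¹ᵁ U)) := by
    have h := (EvenClifford.isUnit_natCast_factorial Γ(S, U) 2).map (C.proj.app U).hom
    rwa [Nat.factorial_two, Nat.cast_ofNat, map_ofNat] at h
  refine ⟨f, hyf, ?_⟩
  have h := C.alg.isAzumaya_basicOpen_of_basis C.isQuasicoherent (hU.preimage C.proj) h2 c hc hcu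
    bas hbas g
  exact hfg.symm ▸ h

end LineValuedForm

end

theorem mainTheorem6 {k : Type u} [Field k] [IsAlgClosed k] [CharZero k]
    {S : Scheme.{u}} (p : S ⟶ Spec (CommRingCat.of k)) [Smooth p] [IsSeparated p] [QuasiCompact p]
    (m : ℕ) (E L : S.Modules) (hE : IsVectorBundle E (2 * m)) (hL : IsVectorBundle L 1)
    (σ : LineValuedForm E L) (hσ : σ.IsEmbedding) :
    -- `𝓩` is central in `𝓑₀`
    (∀ (U : S.Opens), ∀ z ∈ σ.centralPart m U, ∀ a : σ.evenCliffordSheaf.sec U, Commute z a) ∧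
    -- `𝓩 = 𝒪_S ⊕ det E ⊗ L^m`
    (∀ (U : S.Opens) (e : Fin (2 * m) → Γ(E, U)) (l : Fin 1 → Γ(L, U)),
      IsFrame E U e → IsFrame L U l →
      ∃ δ : (⋀[Γ(S, U)]^(2 * m) Γ(E, U)) ⊗[Γ(S, U)] (⨂[Γ(S, U)] _ : Fin m, Γ(L, U))
          →ₗ[Γ(S, U)] σ.evenCliffordSheaf.sec U,
        (∀ (v : Fin (2 * m) → Γ(E, U)) (t : Fin m → Γ(L, U)),
          δ (exteriorPower.ιMulti Γ(S, U) (2 * m) v ⊗ₜ PiTensorProduct.tprod Γ(S, U) t) =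
            σ.toSheaf U (EvenClifford.antisymm (σ.form U) v t)) ∧
        Function.Injective (fun q : Γ(S, U) × _ => algebraMap Γ(S, U) _ q.1 + δ q.2) ∧
        Set.range (fun q : Γ(S, U) × _ => algebraMap Γ(S, U) _ q.1 + δ q.2) =
          σ.centralPart m U) ∧
    -- existence of `S̃ = Spec_S 𝓩` and `𝓑̃₀`
    Nonempty (σ.CentralReduction m) ∧
    ∀ C : σ.CentralReduction m,
      -- `φ : S̃ ⟶ S` is a double covering
      (IsFinite C.proj ∧ Flat C.proj ∧ LocallyOfFinitePresentation C.proj ∧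
        ∀ s : S, C.proj.finrank s = 2) ∧
      -- ramified over `S₁`
      (∀ V : S.Opens, Etale (C.proj ∣_ V) ↔ V ≤ σ.degeneracyCompl (2 * m) 1) ∧
      -- `𝓑̃₀` is Azumaya of rank `2 ^ (m - 1)` outside `S̃₂ = φ⁻¹(S₂)`
      C.alg.IsAzumayaOn (C.proj ⁻¹ᵁ σ.degeneracyCompl (2 * m) 2) (2 ^ (m - 1)) := by
  -- characteristic zero makes the sections of `𝒪_S` algebras over `ℚ`
  let (U : S.Opens) : Algebra ℚ Γ(S, U) :=
    ((p.appLE ⊤ U le_top).hom.comp ((Scheme.ΓSpecIso (CommRingCat.of k)).inv.hom.comp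
      (algebraMap ℚ k))).toAlgebra
  have hcomm (U : S.Opens) : ∀ z ∈ σ.centralPart m U, ∀ a, Commute z a :=
    fun z hz a => σ.commute_of_mem_centralPart hE hL hσ hz a
  refine ⟨hcomm, fun U e l he hl => ?_, ?_, fun C => ?_⟩
  · let F : Framing E L (2 * m) U := ⟨e, l, he, hl⟩
    exact ⟨σ.antisymmMap F, σ.antisymmMap_tmul F, σ.antisymmMap_bijective F hE hσ⟩
  · obtain ⟨K⟩ := σ.nonempty_centralCover hcomm fun U hU =>
      σ.isLocalizingOn_centralSheaf hE hL hσ hU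
    exact K.nonempty_centralReduction hE hL hσ
  · let K := C.toCentralCover
    exact ⟨⟨K.isFinite hE hL hσ, K.flat hE hL hσ, K.locallyOfFinitePresentation hE hL hσ,
      K.finrank_eq_two hE hL hσ⟩, K.etale_restrict_iff hE hL hσ, C.isAzumayaOn hE hL hσ⟩
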